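/- Consider the word RAM with word length $w$: in unit time it loads and stores words in random access memory, sets a register to a constant, computes $+,-,\times$ (modulo $2^w$), bitwise and, or, exclusive or, not, left and right shift, and branches on the comparison of two words. Let $f\ge 1$. For bit strings $x_1,\dots,x_r$ of length $f$, the *$f$-packed sequence* $X=\langle x_1,\dots,x_r\rangle$ is the bit string $0\cdot x_r\cdot 0\cdot x_{r-1}\cdots 0\cdot x_1$ consisting of $r$ fields of $f+1$ bits; it is stored in consecutive words, with $s=\lfloor w/(f+1)\rfloor$ fields in each word. It is *sorted* if $x_1\le\cdots\le x_r$ as binary numbers. An *$f$-packed function* $G$ of length $u$ is a $2f$-packed sequence $\langle z_1\cdot g(z_1),\dots,z_u\cdot g(z_u)\rangle$ with $z_1<\dots<z_u$ bit strings of length $f$ and $g$ a function from bit strings of length $f$ to bit strings of length $f$; its domain is $\mathrm{dom}(G)=\langle z_1,\dots,z_u\rangle$. It is stored with $\lfloor w/(2f+1)\rfloor$ fields in each word. If every entry of $X$ appears in $\mathrm{dom}(G)$, put $\mathrm{Map}(G,X)=\langle g(x_1),\dots,g(x_r)\rangle$; for sorted $X$ this operation is denoted $\mathrm{Map}^{\triangle}(G,X)$.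 Then there is a single word RAM program and an absolute constant $C$ such that the following holds for all $w$, $f\ge 1$ with $2f+1\le w$ (a field of $G$ fits into a word), every sorted $f$-packed sequence $X$ of length $r\le 2^f$, and every $f$-packed function $G$ of length $u$ such that all entries of $X$ appear in $\mathrm{dom}(G)$. Given $w,f,r,u$, the stored sequences $X$ and $G$, and the address of an output area that does not overlap them, the program halts with $\mathrm{Map}^{\triangle}(G,X)$ stored in the output area after at most $$C\cdot\max\left(\frac{(r+u)f}{w},\,1\right)\cdot\log_2 w$$ steps, that is, in time $O\left(\frac{(r+u)f}{w}\log w\right)$ whenever $(r+u)f\ge w$. Moreover, if $r\le s$ and $u\le s$, it halts after at most $C\,(\log_2 s+1)$ steps. -/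

import Mathlib

/-! ## The word RAM

A machine with word length `w`.  It has a finite program, registers holding one word each, and a
random access memory that is addressed by words and holds one word per address. -/

namespace WordRAM

/-- The contents of the registers and of the memory. -/
structure State (w : ℕ) where
  reg : ℕ → BitVec w
  mem : BitVec w → BitVec w

/-- The binary word operations of the machine: addition, subtraction and multiplication
modulo `2 ^ w`, bitwise and, or, exclusive or, and left and right (logical) shift. -/
inductive BinOp
  | add | sub | mul | and | or | xor | shl | shr

/-- The value of a binary operation.  The second operand of a shift is the shift distance, read
as an unsigned integer. -/
def BinOp.eval {w : ℕ} : BinOp → BitVec w → BitVec w → BitVec w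
  | .add, x, y => x + y
  | .sub, x, y => x - y
  | .mul, x, y => x * y
  | .and, x, y => x &&& y
  | .or,  x, y => x ||| y
  | .xor, x, y => x ^^^ y
  | .shl, x, y => x <<< y.toNat
  | .shr, x, y => x >>> y.toNat

/-- The unit-time instructions.  Registers are named by natural numbers. -/
inductive Instr
  /-- `R[d] := c` (modulo `2 ^ w`) -/
  | const (d : ℕ) (c : ℕ)
  /-- `R[d] := R[a] op R[b]` -/
  | bin (op : BinOp) (d a b : ℕ)
  /-- `R[d] := bitwise not of R[a]` -/
  | not (d a : ℕ)
  /-- `R[d] := M[R[a]]` -/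
  | load (d a : ℕ)
  /-- `M[R[a]] := R[b]` -/
  | store (a b : ℕ)

/-- The effect of a single instruction. -/
def Instr.eval {w : ℕ} (σ : State w) : Instr → State w
  | .const d c => { σ with reg := Function.update σ.reg d (BitVec.ofNat w c) }
  | .bin op d a b => { σ with reg := Function.update σ.reg d (op.eval (σ.reg a) (σ.reg b)) }
  | .not d a => { σ with reg := Function.update σ.reg d (~~~(σ.reg a)) }
  | .load d a => { σ with reg := Function.update σ.reg d (σ.mem (σ.reg a)) }
  | .store a b => { σ with mem := Function.update σ.mem (σ.reg a) (σ.reg b) }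

/-- The tests on which a program may branch: comparison of two registers, read as unsigned
integers. -/
inductive Test
  | lt (a b : ℕ)
  | eq (a b : ℕ)

/-- The truth of a test in a state. -/
def Test.holds {w : ℕ} (σ : State w) : Test → Prop
  | .lt a b => (σ.reg a).toNat < (σ.reg b).toNat
  | .eq a b => σ.reg a = σ.reg b

/-- Programs in structured form.  A program is a finite object that does not mention the word
length, so that the same program can be run on machines of every word length. -/
inductive Program
  | skip
  | instr (i : Instr)
  | seq (p q : Program)
  | branch (c : Test) (p q : Program)
  | loop (c : Test) (p : Program)

/-- `Exec p σ t σ'`: the program `p`, started in the state `σ`, halts after exactly `t` steps in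
the state `σ'`.  Every instruction and every evaluation of a test takes one step. -/
inductive Exec {w : ℕ} : Program → State w → ℕ → State w → Prop
  | skip (σ : State w) : Exec .skip σ 1 σ
  | instr (i : Instr) (σ : State w) : Exec (.instr i) σ 1 (i.eval σ)
  | seq {p q : Program} {σ₀ σ₁ σ₂ : State w} {t₁ t₂ : ℕ} :
      Exec p σ₀ t₁ σ₁ → Exec q σ₁ t₂ σ₂ → Exec (.seq p q) σ₀ (t₁ + t₂) σ₂
  | branch_true {c : Test} {p q : Program} {σ σ' : State w} {t : ℕ} :
      c.holds σ → Exec p σ t σ' → Exec (.branch c p q) σ (t + 1) σ'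
  | branch_false {c : Test} {p q : Program} {σ σ' : State w} {t : ℕ} :
      ¬ c.holds σ → Exec q σ t σ' → Exec (.branch c p q) σ (t + 1) σ'
  | loop_done {c : Test} {p : Program} {σ : State w} :
      ¬ c.holds σ → Exec (.loop c p) σ 1 σ
  | loop_step {c : Test} {p : Program} {σ₀ σ₁ σ₂ : State w} {t₁ t₂ : ℕ} :
      c.holds σ₀ → Exec p σ₀ t₁ σ₁ → Exec (.loop c p) σ₁ t₂ σ₂ →
        Exec (.loop c p) σ₀ (t₁ + t₂ + 1) σ₂

end WordRAM

/-! ## Packed sequences -/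

namespace Packed

/-- The bit string `0 · x_r · 0 · x_{r-1} ⋯ 0 · x_1` of the `f`-packed sequence `⟨x_1, …, x_r⟩`,
read as a binary number: the `i`-th field has `f + 1` bits, its leading (test) bit is `0` and the
other `f` bits are the entry `x_i`; the field of `x_1` is the least significant one. -/
def value {f : ℕ} (X : List (BitVec f)) : ℕ :=
  Nat.ofDigits (2 ^ (f + 1)) (X.map BitVec.toNat)

/-- The number `s = ⌊w / (f + 1)⌋` of fields of an `f`-packed sequence that are stored in one word
of `w` bits. -/
def fieldsPerWord (w f : ℕ) : ℕ := w / (f + 1)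

/-- The number `⌈r / s⌉` of words that store an `f`-packed sequence of length `r`. -/
def wordCount (w f r : ℕ) : ℕ := (r + fieldsPerWord w f - 1) / fieldsPerWord w f

/-- The `j`-th word (counted from `0`) of the representation of `X` in words of `w` bits: it holds
the fields `j * s + 1, …, j * s + s` of `X`, as far as they exist, in its rightmost bits, and zeros
elsewhere. -/
def word (w : ℕ) {f : ℕ} (X : List (BitVec f)) (j : ℕ) : BitVec w :=
  BitVec.ofNat w (value ((X.drop (j * fieldsPerWord w f)).take (fieldsPerWord w f)))

/-- The addresses `a, a + 1, …, a + n - 1`. -/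
def block {w : ℕ} (a : BitVec w) (n : ℕ) : Set (BitVec w) :=
  {p | ∃ j < n, p = a + BitVec.ofNat w j}

/-- The memory holds the packed sequence `X` in consecutive words from the address `a` on. -/
def StoredAt {w f : ℕ} (mem : BitVec w → BitVec w) (a : BitVec w) (X : List (BitVec f)) : Prop :=
  ∀ j < wordCount w f X.length, mem (a + BitVec.ofNat w j) = word w X j

end Packed

/-- An `f`-packed function: entries `z_1 < ⋯ < z_u` and a function `g` from bit strings of length
`f` to bit strings of length `f`. -/
structure PackedFunction (f : ℕ) where
  dom : List (BitVec f)
  dom_increasing : dom.Pairwise (· < ·)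
  g : BitVec f → BitVec f

namespace PackedFunction

/-- The `2f`-packed sequence `⟨(z_1, g(z_1)), …, (z_u, g(z_u))⟩`, where `(x, y)` is the
concatenation `x · y`. -/
def toPacked {f : ℕ} (G : PackedFunction f) : List (BitVec (f + f)) :=
  G.dom.map fun z => z ++ G.g z

/-- `Map(G, X) = ⟨g(x_1), …, g(x_r)⟩`. -/
def map {f : ℕ} (G : PackedFunction f) (X : List (BitVec f)) : List (BitVec f) :=
  X.map G.g

end PackedFunction

/-- The initial states for the problem of computing `Map(G, X)`: the registers `0, …, 6` hold the
word length `w`, the entry length `f`, the lengths of `X` and of `G`, and the addresses of `X`,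
of `G`, and of the space for the output, which does not overlap the input.  All other registers
and the rest of the memory are arbitrary. -/
structure IsMapInput {w f : ℕ} (G : PackedFunction f) (X : List (BitVec f))
    (σ : WordRAM.State w) : Prop where
  reg_w : σ.reg 0 = BitVec.ofNat w w
  reg_f : σ.reg 1 = BitVec.ofNat w f
  reg_r : σ.reg 2 = BitVec.ofNat w X.length
  reg_u : σ.reg 3 = BitVec.ofNat w G.dom.length
  stored_X : Packed.StoredAt σ.mem (σ.reg 4) X
  stored_G : Packed.StoredAt σ.mem (σ.reg 5) G.toPacked
  disjoint_X : Disjoint (Packed.block (σ.reg 4) (Packed.wordCount w f X.length))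
    (Packed.block (σ.reg 6) (Packed.wordCount w f X.length))
  disjoint_G : Disjoint (Packed.block (σ.reg 5) (Packed.wordCount w (f + f) G.dom.length))
    (Packed.block (σ.reg 6) (Packed.wordCount w f X.length))

/-! Let `n = 2 ^ m`, where `m` is the largest number with `m ≤ f` and `(2 * f + 1) * 2 ^ m ≤ w`. The
heart of the matter is to look up `n` sorted arguments among `n` sorted pairs within `O(m + 1)` word
operations; traversing `X` and `G` in such blocks, as in a merge of two sorted lists, then needs
`O((r + u) f / w + 1)` lookups.

For the lookup, the arguments followed by the reversed keys of the pairs form a bitonic sequence. A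
half cleaner compares all lanes by a single subtraction and exchanges lanes by masked exclusive ors,
so Batcher's bitonic sorter takes constant time per round. The payload of a key is its value if it
comes from `G`, and `0` if it comes from `X`; it moves along with the key. After sorting, equal keys
are contiguous, and or-ing payloads over distances `1, 2, 4, …` gives every argument the value
stored with its key. Each half cleaner is an involution whose exchanges are recorded, one bit per
round, so replaying the record backwards returns the values to the order of the arguments. The `2 *
n` keys occupy two words: the opening half cleaner is a lanewise minimum and maximum of the two
words, each word is sorted separately, and the one run of equal keys that may cross the boundary is
repaired. The carrying lemmas are `BitonicBlocks.halfClean`, `testBit_spread`, `spread_eq_gather`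
and `wp_lookupProg`.

In a traversal step the last keys of the two current blocks are compared. If that of `G` is smaller,
its block cannot serve later arguments and the cursor in `G` advances; otherwise all arguments of
the block have been answered and the cursor in `X` advances (`wp_roundProg`). A block may be short
because its word ends, so the rounds are counted by full blocks plus words (`potential`). If `m <
f`, maximality of `m` makes `n` at least of order `w / f`; if `m = f`, both sequences have at most
`n` entries. Either way the number of rounds is `O((r + u) f / w + 1)` (`mul_rounds_le`), and `m ≤
log₂ s` gives both time bounds. -/

/-! ## Structured programs over expressions -/

namespace WordRAM

/-- Word expressions over registers and memory. -/
inductive Expr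
  | reg (i : ℕ)
  | const (c : ℕ)
  | bin (op : BinOp) (a b : Expr)
  | not (a : Expr)
  | load (a : Expr)

namespace Expr

instance : Add Expr := ⟨.bin .add⟩
instance : Sub Expr := ⟨.bin .sub⟩
instance : Mul Expr := ⟨.bin .mul⟩
instance : AndOp Expr := ⟨.bin .and⟩
instance : OrOp Expr := ⟨.bin .or⟩
instance : XorOp Expr := ⟨.bin .xor⟩
instance : ShiftLeft Expr := ⟨.bin .shl⟩
instance : ShiftRight Expr := ⟨.bin .shr⟩

/-- The value of an expression. -/
def eval {w : ℕ} (σ : State w) : Expr → BitVec w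
  | .reg i => σ.reg i
  | .const c => BitVec.ofNat w c
  | .bin op a b => op.eval (a.eval σ) (b.eval σ)
  | .not a => ~~~(a.eval σ)
  | .load a => σ.mem (a.eval σ)

/-- The number of instructions that evaluate an expression. -/
def cost : Expr → ℕ
  | .reg _ => 1
  | .const _ => 1
  | .bin _ a b => a.cost + b.cost + 1
  | .not a => a.cost + 1
  | .load a => a.cost + 1

/-- All registers of the expression are below `d`. -/
def bounded (d : ℕ) : Expr → Bool
  | .reg i => i < d
  | .const _ => true
  | .bin _ a b => a.bounded d && b.bounded d
  | .not a => a.bounded d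
  | .load a => a.bounded d

/-- Code that evaluates an expression into register `d`, using only registers from `d` on. -/
def compile : Expr → ℕ → Program
  | .reg i, d => .instr (.bin .or d i i)
  | .const c, d => .instr (.const d c)
  | .bin op a b, d => .seq (a.compile d) (.seq (b.compile (d + 1)) (.instr (.bin op d d (d + 1))))
  | .not a, d => .seq (a.compile d) (.instr (.not d d))
  | .load a, d => .seq (a.compile d) (.instr (.load d d))

section eval
variable {w : ℕ} (σ : State w) (a b : Expr)

@[simp] theorem eval_reg (i : ℕ) : (reg i).eval σ = σ.reg i := rfl
@[simp] theorem eval_const (c : ℕ) : (const c).eval σ = BitVec.ofNat w c := rfl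
@[simp] theorem eval_add : (a + b).eval σ = a.eval σ + b.eval σ := rfl
@[simp] theorem eval_sub : (a - b).eval σ = a.eval σ - b.eval σ := rfl
@[simp] theorem eval_mul : (a * b).eval σ = a.eval σ * b.eval σ := rfl
@[simp] theorem eval_and : (a &&& b).eval σ = a.eval σ &&& b.eval σ := rfl
@[simp] theorem eval_or : (a ||| b).eval σ = a.eval σ ||| b.eval σ := rfl
@[simp] theorem eval_xor : (a ^^^ b).eval σ = a.eval σ ^^^ b.eval σ := rfl
@[simp] theorem eval_shl : (a <<< b).eval σ = a.eval σ <<< (b.eval σ).toNat := rfl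
@[simp] theorem eval_shr : (a >>> b).eval σ = a.eval σ >>> (b.eval σ).toNat := rfl
@[simp] theorem eval_not : (not a).eval σ = ~~~(a.eval σ) := rfl
@[simp] theorem eval_load : (load a).eval σ = σ.mem (a.eval σ) := rfl

@[simp] theorem cost_reg (i : ℕ) : (reg i).cost = 1 := rfl
@[simp] theorem cost_const (c : ℕ) : (const c).cost = 1 := rfl
@[simp] theorem cost_add : (a + b).cost = a.cost + b.cost + 1 := rfl
@[simp] theorem cost_sub : (a - b).cost = a.cost + b.cost + 1 := rfl
@[simp] theorem cost_mul : (a * b).cost = a.cost + b.cost + 1 := rfl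
@[simp] theorem cost_and : (a &&& b).cost = a.cost + b.cost + 1 := rfl
@[simp] theorem cost_or : (a ||| b).cost = a.cost + b.cost + 1 := rfl
@[simp] theorem cost_xor : (a ^^^ b).cost = a.cost + b.cost + 1 := rfl
@[simp] theorem cost_shl : (a <<< b).cost = a.cost + b.cost + 1 := rfl
@[simp] theorem cost_shr : (a >>> b).cost = a.cost + b.cost + 1 := rfl
@[simp] theorem cost_not : (not a).cost = a.cost + 1 := rfl
@[simp] theorem cost_load : (load a).cost = a.cost + 1 := rfl

end eval

theorem eval_congr {w : ℕ} {σ τ : State w} {d : ℕ} (hm : τ.mem = σ.mem)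
    (hr : ∀ y < d, τ.reg y = σ.reg y) (e : Expr) (he : e.bounded d = true) :
    e.eval τ = e.eval σ := by
  induction e with
  | reg i => exact hr i (by simpa [bounded] using he)
  | const c => rfl
  | bin op a b iha ihb =>
    simp only [bounded, Bool.and_eq_true] at he
    simp only [eval, iha he.1, ihb he.2]
  | not a ih => simp only [eval, ih he]
  | load a ih => simp only [eval, ih he, hm]

theorem bounded_mono {d d' : ℕ} (hd : d ≤ d') (e : Expr) (he : e.bounded d = true) :
    e.bounded d' = true := by
  induction e with
  | reg i => simp only [bounded, decide_eq_true_eq] at *; omega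
  | const c => rfl
  | bin op a b iha ihb => simp only [bounded, Bool.and_eq_true] at *; exact ⟨iha he.1, ihb he.2⟩
  | not a ih => exact ih he
  | load a ih => exact ih he

/-- Stack discipline: the value of the left operand waits in register `d` while the right operand is
evaluated in the registers from `d + 1` on. -/
theorem exec_compile {w : ℕ} (e : Expr) {d : ℕ} (σ : State w) (he : e.bounded d = true) :
    ∃ σ', Exec (e.compile d) σ e.cost σ' ∧ σ'.mem = σ.mem ∧ σ'.reg d = e.eval σ ∧
      ∀ y < d, σ'.reg y = σ.reg y := by
  induction e generalizing d σ with
  | reg i =>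
    refine ⟨_, .instr _ _, rfl, ?_, fun y hy => ?_⟩
    · simp [Instr.eval, BinOp.eval]
    · simp [Instr.eval, Function.update_of_ne (ne_of_lt hy)]
  | const c =>
    refine ⟨_, .instr _ _, rfl, ?_, fun y hy => ?_⟩
    · simp [Instr.eval]
    · simp [Instr.eval, Function.update_of_ne (ne_of_lt hy)]
  | bin op a b iha ihb =>
    simp only [bounded, Bool.and_eq_true] at he
    have hb := bounded_mono (Nat.le_succ d) b he.2
    obtain ⟨σ₁, h₁, m₁, r₁, f₁⟩ := iha σ he.1
    obtain ⟨σ₂, h₂, m₂, r₂, f₂⟩ := ihb (d := d + 1) σ₁ hb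
    have hx := Exec.seq h₁ (Exec.seq h₂ (.instr (.bin op d d (d + 1)) σ₂))
    rw [← add_assoc] at hx
    refine ⟨_, hx, ?_, ?_, fun y hy => ?_⟩
    · simp [Instr.eval, m₂, m₁]
    · simp only [Instr.eval, Function.update_self, eval]
      rw [r₂, f₂ d (by omega), r₁, eval_congr m₁ f₁ b he.2]
    · simp only [Instr.eval]
      rw [Function.update_of_ne (ne_of_lt hy), f₂ y (by omega), f₁ y hy]
  | not a ih =>
    obtain ⟨σ₁, h₁, m₁, r₁, f₁⟩ := ih σ he
    refine ⟨_, .seq h₁ (.instr _ _), m₁, ?_, fun y hy => ?_⟩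
    · simp [Instr.eval, r₁, eval]
    · simp only [Instr.eval]
      rw [Function.update_of_ne (ne_of_lt hy), f₁ y hy]
  | load a ih =>
    obtain ⟨σ₁, h₁, m₁, r₁, f₁⟩ := ih σ he
    refine ⟨_, .seq h₁ (.instr _ _), m₁, ?_, fun y hy => ?_⟩
    · simp [Instr.eval, r₁, eval, m₁]
    · simp only [Instr.eval]
      rw [Function.update_of_ne (ne_of_lt hy), f₁ y hy]

end Expr

namespace Program

/-- `x := e` -/
def assign (x : ℕ) (e : Expr) : Program :=
  .seq (e.compile 100) (.instr (.bin .or x 100 100))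

/-- `M[a] := e` -/
def write (a e : Expr) : Program :=
  .seq (a.compile 100) (.seq (e.compile 101) (.instr (.store 100 101)))

/-- Evaluates the two sides of a comparison. -/
def operands (a b : Expr) : Program :=
  .seq (a.compile 100) (b.compile 101)

/-- `if a < b then p else q` -/
def ifLt (a b : Expr) (p q : Program) : Program :=
  .seq (operands a b) (.branch (.lt 100 101) p q)

/-- `while a < b do p` -/
def whileLt (a b : Expr) (p : Program) : Program :=
  .seq (operands a b) (.loop (.lt 100 101) (.seq p (operands a b)))

end Program

/-! ## Weakest preconditions with time bounds -/

variable {w : ℕ}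

/-- Equality of states up to the scratch registers `100, 101, …`. -/
def Agree (σ τ : State w) : Prop :=
  τ.mem = σ.mem ∧ ∀ y < 100, τ.reg y = σ.reg y

theorem Agree.refl (σ : State w) : Agree σ σ := ⟨rfl, fun _ _ => rfl⟩

/-- From `σ`, whatever the scratch registers hold, `p` halts within `T` steps in a state that
satisfies `Q` for some values of the scratch registers. -/
def wp (p : Program) (T : ℕ) (Q : State w → Prop) (σ : State w) : Prop :=
  ∀ τ, Agree σ τ → ∃ t ≤ T, ∃ τ' σ', Exec p τ t τ' ∧ Agree σ' τ' ∧ Q σ'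

namespace State

/-- The state with register `x` set to `v`. -/
def set (σ : State w) (x : ℕ) (v : BitVec w) : State w :=
  { σ with reg := Function.update σ.reg x v }

@[simp] theorem set_reg (σ : State w) (x y : ℕ) (v : BitVec w) :
    (σ.set x v).reg y = if y = x then v else σ.reg y := by
  simp [set, Function.update_apply]

@[simp] theorem set_mem (σ : State w) (x : ℕ) (v : BitVec w) : (σ.set x v).mem = σ.mem := rfl

/-- The state with memory cell `a` set to `v`. -/
def put (σ : State w) (a v : BitVec w) : State w :=
  { σ with mem := Function.update σ.mem a v }

@[simp] theorem put_reg (σ : State w) (a v : BitVec w) : (σ.put a v).reg = σ.reg := rfl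

@[simp] theorem put_mem (σ : State w) (a v p : BitVec w) :
    (σ.put a v).mem p = if p = a then v else σ.mem p := by
  simp [put, Function.update_apply]

end State

theorem wp_mono {p : Program} {T T' : ℕ} {Q Q' : State w → Prop} {σ : State w}
    (h : wp p T Q σ) (hT : T ≤ T') (hQ : ∀ σ', Q σ' → Q' σ') : wp p T' Q' σ := by
  intro τ hτ
  obtain ⟨t, ht, τ', σ', he, ha, hq⟩ := h τ hτ
  exact ⟨t, ht.trans hT, τ', σ', he, ha, hQ _ hq⟩

theorem wp_skip {Q : State w → Prop} {σ : State w} (h : Q σ) : wp .skip 1 Q σ :=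
  fun τ hτ => ⟨1, le_rfl, τ, σ, .skip τ, hτ, h⟩

/-- Composition works because `wp` allows arbitrary scratch registers on entry and forgets them on
exit. -/
theorem wp_seq {p q : Program} {T₁ T₂ T : ℕ} {Q : State w → Prop} {σ : State w}
    (h : wp p T₁ (wp q T₂ Q) σ) (hT : T₁ + T₂ ≤ T) : wp (.seq p q) T Q σ := by
  intro τ hτ
  obtain ⟨t, ht, τ', σ', he, ha, hq⟩ := h τ hτ
  obtain ⟨t', ht', τ'', σ'', he', ha', hq'⟩ := hq τ' ha
  exact ⟨t + t', by omega, τ'', σ'', .seq he he', ha', hq'⟩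

theorem exec_compile_agree {σ τ : State w} (h : Agree σ τ) (e : Expr) {d : ℕ}
    (hd : 100 ≤ d) (he : e.bounded 100 = true) :
    ∃ τ', Exec (e.compile d) τ e.cost τ' ∧ Agree σ τ' ∧ τ'.reg d = e.eval σ ∧
      ∀ y < d, τ'.reg y = τ.reg y := by
  have hb := Expr.bounded_mono hd e he
  obtain ⟨τ', h₁, m₁, r₁, f₁⟩ := Expr.exec_compile e τ hb
  refine ⟨τ', h₁, ⟨m₁.trans h.1, fun y hy => (f₁ y (by omega)).trans (h.2 y hy)⟩, ?_, f₁⟩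
  rw [r₁, Expr.eval_congr h.1 h.2 e he]

/-- The value `v` is a separate argument, so that the resulting state can be described by its
mathematical meaning instead of by the evaluated expression. -/
theorem wp_assign {x : ℕ} {e : Expr} {T : ℕ} {Q : State w → Prop} {σ : State w} (v : BitVec w)
    (hv : e.eval σ = v) (h : Q (σ.set x v))
    (he : e.bounded 100 = true := by rfl) (hT : e.cost + 1 ≤ T := by decide) :
    wp (.assign x e) T Q σ := by
  intro τ hτ
  obtain ⟨τ', h₁, a₁, r₁, -⟩ := exec_compile_agree hτ e le_rfl he
  refine ⟨_, hT, _, σ.set x v, .seq h₁ (.instr _ _), ⟨a₁.1, fun y hy => ?_⟩, h⟩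
  simp only [Instr.eval, State.set, Function.update_apply]
  split_ifs with hxy
  · simp [BinOp.eval, r₁, hv]
  · exact a₁.2 y hy

theorem wp_write {a e : Expr} {T : ℕ} {Q : State w → Prop} {σ : State w} (p v : BitVec w)
    (hp : a.eval σ = p) (hv : e.eval σ = v) (h : Q (σ.put p v))
    (ha : a.bounded 100 = true := by rfl) (he : e.bounded 100 = true := by rfl)
    (hT : a.cost + e.cost + 1 ≤ T := by decide) :
    wp (.write a e) T Q σ := by
  intro τ hτ
  obtain ⟨τ₁, h₁, a₁, r₁, f₁⟩ := exec_compile_agree hτ a le_rfl ha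
  obtain ⟨τ₂, h₂, a₂, r₂, f₂⟩ := exec_compile_agree a₁ e (d := 101) (by omega) he
  refine ⟨_, ?_, _, σ.put p v, .seq h₁ (.seq h₂ (.instr _ _)), ⟨?_, fun y hy => ?_⟩, h⟩
  · omega
  · simp only [Instr.eval, State.put]
    rw [a₂.1, r₂, f₂ 100 (by omega), r₁, hp, hv]
  · exact a₂.2 y hy

theorem exec_operands {σ τ : State w} (hτ : Agree σ τ) (a b : Expr)
    (ha : a.bounded 100 = true) (hb : b.bounded 100 = true) :
    ∃ τ', Exec (.operands a b) τ (a.cost + b.cost) τ' ∧ Agree σ τ' ∧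
      ((Test.lt 100 101).holds τ' ↔ (a.eval σ).toNat < (b.eval σ).toNat) := by
  obtain ⟨τ₁, h₁, a₁, r₁, f₁⟩ := exec_compile_agree hτ a le_rfl ha
  obtain ⟨τ₂, h₂, a₂, r₂, f₂⟩ := exec_compile_agree a₁ b (d := 101) (by omega) hb
  refine ⟨τ₂, .seq h₁ h₂, a₂, ?_⟩
  rw [Test.holds, f₂ 100 (by omega), r₁, r₂]

theorem wp_ifLt {a b : Expr} {p q : Program} {T T' : ℕ} {Q : State w → Prop} {σ : State w}
    (hp : (a.eval σ).toNat < (b.eval σ).toNat → wp p T Q σ)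
    (hq : ¬ (a.eval σ).toNat < (b.eval σ).toNat → wp q T Q σ)
    (hT : a.cost + b.cost + T + 1 ≤ T')
    (ha : a.bounded 100 = true := by rfl) (hb : b.bounded 100 = true := by rfl) :
    wp (.ifLt a b p q) T' Q σ := by
  intro τ hτ
  obtain ⟨τ₁, h₁, a₁, c₁⟩ := exec_operands hτ a b ha hb
  by_cases hc : (a.eval σ).toNat < (b.eval σ).toNat
  · obtain ⟨t, ht, τ', σ', he, hag, hQ⟩ := hp hc τ₁ a₁
    exact ⟨_, by omega, τ', σ', .seq h₁ (.branch_true (c₁.2 hc) he), hag, hQ⟩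
  · obtain ⟨t, ht, τ', σ', he, hag, hQ⟩ := hq hc τ₁ a₁
    exact ⟨_, by omega, τ', σ', .seq h₁ (.branch_false (fun h => hc (c₁.1 h)) he), hag, hQ⟩

/-- A loop whose body decreases the natural number `k` in the invariant. -/
theorem wp_whileLt {a b : Expr} {p : Program} {T T' k : ℕ} {Q : State w → Prop} {σ : State w}
    (Inv : ℕ → State w → Prop) (h₀ : Inv k σ)
    (hdone : ∀ k σ, Inv k σ → ¬ (a.eval σ).toNat < (b.eval σ).toNat → Q σ)
    (hstep : ∀ k σ, Inv k σ → (a.eval σ).toNat < (b.eval σ).toNat →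
      wp p T (fun σ' => ∃ k' < k, Inv k' σ') σ)
    (hT : (k + 1) * (T + a.cost + b.cost + 1) ≤ T')
    (ha : a.bounded 100 = true := by rfl) (hb : b.bounded 100 = true := by rfl) :
    wp (.whileLt a b p) T' Q σ := by
  -- This bounds the loop alone, with its operands already evaluated. The evaluation before the loop
  -- is paid for by the extra unit in `k + 1`.
  have key : ∀ k σ τ, Inv k σ → Agree σ τ →
      ((Test.lt 100 101).holds τ ↔ (a.eval σ).toNat < (b.eval σ).toNat) →
      ∃ t ≤ k * (T + a.cost + b.cost + 1) + 1, ∃ τ' σ',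
        Exec (.loop (.lt 100 101) (.seq p (.operands a b))) τ t τ' ∧ Agree σ' τ' ∧ Q σ' := by
    intro k
    induction k using Nat.strong_induction_on with
    | _ k ih =>
      intro σ τ hI hτ hc
      by_cases h : (a.eval σ).toNat < (b.eval σ).toNat
      · obtain ⟨t, ht, τ₁, σ₁, he, hag, k', hk', hI'⟩ := hstep k σ hI h τ hτ
        obtain ⟨τ₂, h₂, a₂, c₂⟩ := exec_operands hag a b ha hb
        obtain ⟨t', ht', τ₃, σ₃, he₃, hag₃, hQ⟩ := ih k' hk' σ₁ τ₂ hI' a₂ c₂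
        refine ⟨_, ?_, τ₃, σ₃, .loop_step (hc.2 h) (.seq he h₂) he₃, hag₃, hQ⟩
        have : (k' + 1) * (T + a.cost + b.cost + 1) ≤ k * (T + a.cost + b.cost + 1) :=
          Nat.mul_le_mul_right _ hk'
        rw [Nat.add_mul] at this
        omega
      · exact ⟨1, by omega, τ, σ, .loop_done fun h' => h (hc.1 h'), hτ, hdone k σ hI h⟩
  intro τ hτ
  obtain ⟨τ₁, h₁, a₁, c₁⟩ := exec_operands hτ a b ha hb
  obtain ⟨t, ht, τ', σ', he, hag, hQ⟩ := key k σ τ₁ h₀ a₁ c₁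
  refine ⟨_, ?_, τ', σ', .seq h₁ he, hag, hQ⟩
  rw [Nat.add_mul] at hT
  omega

end WordRAM

/-! ## Words divided into lanes -/

namespace WordRAM

/-- The number whose `i`-th block of `b` bits is `v i` for `i < n`. -/
def packNat (b n : ℕ) (v : ℕ → ℕ) : ℕ :=
  ∑ i ∈ Finset.range n, v i % 2 ^ b * 2 ^ (b * i)

theorem packNat_lt (b n : ℕ) (v : ℕ → ℕ) : packNat b n v < 2 ^ (b * n) := by
  induction n with
  | zero => simp [packNat]
  | succ n ih =>
    rw [packNat, Finset.sum_range_succ, ← packNat, Nat.mul_succ, pow_add]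
    have h : v n % 2 ^ b + 1 ≤ 2 ^ b := Nat.mod_lt _ (by positivity)
    have := Nat.mul_le_mul_right (2 ^ (b * n)) h
    rw [mul_comm (2 ^ (b * n))]
    linarith

theorem packNat_succ (b n : ℕ) (v : ℕ → ℕ) :
    packNat b (n + 1) v = 2 ^ (b * n) * (v n % 2 ^ b) + packNat b n v := by
  rw [packNat, Finset.sum_range_succ, ← packNat, add_comm, mul_comm]

/-- The bridge to bitwise extensionality, by which the lane identities for logical operations and
shifts are proved. -/
theorem testBit_packNat {b : ℕ} (hb : 0 < b) (n : ℕ) (v : ℕ → ℕ) (t : ℕ) :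
    (packNat b n v).testBit t = (decide (t < b * n) && (v (t / b)).testBit (t % b)) := by
  induction n with
  | zero => simp [packNat]
  | succ n ih =>
    rw [packNat_succ, Nat.testBit_two_pow_mul_add _ (packNat_lt b n v)]
    split_ifs with h
    · rw [ih]
      simp [h, show t < b * (n + 1) by rw [Nat.mul_succ]; omega]
    · rw [Nat.testBit_mod_two_pow]
      by_cases h' : t - b * n < b
      · have h1 : t / b = n := by
          rw [Nat.div_eq_of_lt_le] <;> [rw [mul_comm]; rw [Nat.succ_mul, mul_comm n]] <;> omega
        have h2 : t % b = t - b * n := by rw [Nat.mod_def, h1]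
        simp [h', h1, h2, show t < b * (n + 1) by rw [Nat.mul_succ]; omega]
      · simp [h', show ¬ t < b * (n + 1) by rw [Nat.mul_succ]; omega]

/-- The word of `n` lanes of `b` bits, the `i`-th of which holds `v i`. -/
def pk (w b n : ℕ) (v : ℕ → ℕ) : BitVec w :=
  BitVec.ofNat w (packNat b n v)

section
variable {w b n n' d e : ℕ} {u v : ℕ → ℕ}

theorem getLsbD_pk (hb : 0 < b) (t : ℕ) :
    (pk w b n v).getLsbD t =
      (decide (t < w) && (decide (t < b * n) && (v (t / b)).testBit (t % b))) := by
  rw [pk, BitVec.getLsbD_ofNat, testBit_packNat hb]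

theorem div_lt_iff_lanes {t : ℕ} (hb : 0 < b) : t / b < n ↔ t < b * n := by
  rw [Nat.div_lt_iff_lt_mul hb, mul_comm]

theorem div_lt_of_lt_lanes {t : ℕ} (h : t < b * n) : t / b < n :=
  Nat.div_lt_of_lt_mul h

theorem pk_congr (h : ∀ i < n, u i = v i) : pk w b n u = pk w b n v := by
  rw [pk, pk, packNat, packNat, Finset.sum_congr rfl]
  intro i hi
  rw [h i (Finset.mem_range.1 hi)]

theorem pk_zero : pk w b n (fun _ => 0) = 0#w := by
  simp [pk, packNat]

theorem pk_one (h : v 0 < 2 ^ b) : pk w b 1 v = BitVec.ofNat w (v 0) := by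
  simp [pk, packNat, Nat.mod_eq_of_lt h]

theorem pk_and_of_le (hb : 0 < b) (h : n ≤ n') :
    pk w b n' u &&& pk w b n v = pk w b n (fun i => u i &&& v i) := by
  apply BitVec.eq_of_getLsbD_eq
  intro t ht
  have := Nat.mul_le_mul_left b h
  simp only [BitVec.getLsbD_and, getLsbD_pk hb, Nat.testBit_and, ht]
  by_cases h' : t < b * n
  · simp [h', h'.trans_le this]
  · simp [h']

theorem pk_and (hb : 0 < b) : pk w b n u &&& pk w b n v = pk w b n (fun i => u i &&& v i) :=
  pk_and_of_le hb le_rfl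

theorem pk_or (hb : 0 < b) : pk w b n u ||| pk w b n v = pk w b n (fun i => u i ||| v i) := by
  apply BitVec.eq_of_getLsbD_eq
  intro t ht
  simp only [BitVec.getLsbD_or, getLsbD_pk hb, Nat.testBit_or, Bool.and_or_distrib_left]

theorem pk_xor (hb : 0 < b) : pk w b n u ^^^ pk w b n v = pk w b n (fun i => u i ^^^ v i) := by
  apply BitVec.eq_of_getLsbD_eq
  intro t ht
  simp only [BitVec.getLsbD_xor, getLsbD_pk hb, Nat.testBit_xor, Bool.and_xor_distrib_left]

/-- No carry leaves its lane, so the sum of the words is the sum of the lanes. -/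
theorem pk_add (h : ∀ i < n, u i + v i < 2 ^ b) :
    pk w b n u + pk w b n v = pk w b n (fun i => u i + v i) := by
  rw [pk, pk, pk, ← BitVec.ofNat_add, packNat, packNat, packNat, ← Finset.sum_add_distrib]
  congr 1
  refine Finset.sum_congr rfl fun i hi => ?_
  have := h i (Finset.mem_range.1 hi)
  rw [Nat.mod_eq_of_lt this, Nat.mod_eq_of_lt (by omega), Nat.mod_eq_of_lt (by omega), add_mul]

/-- No borrow occurs, since adding the subtrahend back is an addition without carries. -/
theorem pk_sub (h : ∀ i < n, v i ≤ u i) (hu : ∀ i < n, u i < 2 ^ b) :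
    pk w b n u - pk w b n v = pk w b n (fun i => u i - v i) := by
  rw [sub_eq_iff_eq_add, pk_add]
  · exact pk_congr fun i hi => by have := h i hi; omega
  · intro i hi
    have := h i hi
    have := hu i hi
    omega

theorem pk_mul {a : ℕ} (hv : ∀ i < n, v i < 2 ^ b) (h : ∀ i < n, v i * a < 2 ^ b) :
    pk w b n v * BitVec.ofNat w a = pk w b n (fun i => v i * a) := by
  rw [pk, pk, ← BitVec.ofNat_mul, packNat, packNat, Finset.sum_mul]
  congr 1
  refine Finset.sum_congr rfl fun i hi => ?_
  rw [Nat.mod_eq_of_lt (hv i (Finset.mem_range.1 hi)),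
    Nat.mod_eq_of_lt (h i (Finset.mem_range.1 hi))]
  ring

theorem pk_shr (hb : 0 < b) (hw : b * n ≤ w) :
    pk w b n v >>> (b * d) = pk w b n (fun i => if i + d < n then v (i + d) else 0) := by
  apply BitVec.eq_of_getLsbD_eq
  intro t ht
  simp only [BitVec.getLsbD_ushiftRight, getLsbD_pk hb, ht]
  rw [add_comm (b * d), Nat.add_mul_div_left _ _ hb, Nat.add_mul_mod_self_left]
  by_cases h : t / b + d < n
  · have h1 : t < b * n := by
      rw [← div_lt_iff_lanes hb]; omega
    have h2 : t + b * d < b * n := by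
      rw [← div_lt_iff_lanes hb, Nat.add_mul_div_left _ _ hb]; exact h
    simp [h, h1, h2, h2.trans_le hw]
  · have h2 : ¬ t + b * d < b * n := by
      rw [← div_lt_iff_lanes hb, Nat.add_mul_div_left _ _ hb]; exact h
    simp [h, h2]

/-- A left shift may push lanes beyond the `n`-th one; the mask removes them. -/
theorem pk_shl_and (hb : 0 < b) :
    (pk w b n v <<< (b * d)) &&& pk w b n u =
      pk w b n (fun i => if i < d then 0 else v (i - d) &&& u i) := by
  apply BitVec.eq_of_getLsbD_eq
  intro t ht
  simp only [BitVec.getLsbD_and, BitVec.getLsbD_shiftLeft, getLsbD_pk hb, ht]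
  by_cases h : t < b * d
  · have : t / b < d := div_lt_of_lt_lanes h
    simp [h, this]
  · have h1 : ¬ t / b < d := by rwa [div_lt_iff_lanes hb]
    have h2 : (t - b * d) / b = t / b - d := Nat.sub_mul_div _ _ _
    have h3 : (t - b * d) % b = t % b := Nat.sub_mul_mod (by omega)
    by_cases h4 : t < b * n
    · simp [h, h1, h2, h3, h4, show t - b * d < w by omega, show t - b * d < b * n by omega]
    · simp [h, h1, h4]

/-- A shift by less than a lane drags the low `e` bits of each lane into the top of the lane below.
The bound on `u` says that the mask is zero there. -/
theorem pk_inner_shr_and (hb : 0 < b) (h : n ≤ n') (hw : b * n' ≤ w)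
    (hu : ∀ i < n, u i < 2 ^ (b - e)) :
    (pk w b n' v >>> e) &&& pk w b n u = pk w b n (fun i => (v i >>> e) &&& u i) := by
  apply BitVec.eq_of_getLsbD_eq
  intro t ht
  have hle := Nat.mul_le_mul_left b h
  simp only [BitVec.getLsbD_and, BitVec.getLsbD_ushiftRight, getLsbD_pk hb, ht, Nat.testBit_and,
    Nat.testBit_shiftRight]
  by_cases h1 : t < b * n
  · by_cases h2 : t % b < b - e
    · have h3 : (e + t) % b = e + t % b := by
        rw [Nat.add_mod, Nat.mod_eq_of_lt (show e < b by omega), Nat.mod_eq_of_lt (by omega)]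
      have h4 : (e + t) / b = t / b := by
        have e1 := Nat.div_add_mod (e + t) b
        have e2 := Nat.div_add_mod t b
        exact Nat.eq_of_mul_eq_mul_left hb (by omega)
      have h5 : e + t < b * n' := by
        refine lt_of_lt_of_le ?_ hle
        rw [← div_lt_iff_lanes hb, h4]
        exact div_lt_of_lt_lanes h1
      simp [h1, h3, h4, h5, h5.trans_le hw]
    · have : (u (t / b)).testBit (t % b) = false := by
        apply Nat.testBit_lt_two_pow
        exact (hu _ (div_lt_of_lt_lanes h1)).trans_le (Nat.pow_le_pow_right (by omega) (by omega))
      simp [this]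
  · simp [h1]

theorem pk_high_and (hb : 0 < b) {c : ℕ} :
    ((~~~(0#w)) <<< (b * c)) &&& pk w b n u = pk w b n (fun i => if i < c then 0 else u i) := by
  apply BitVec.eq_of_getLsbD_eq
  intro t ht
  simp only [BitVec.getLsbD_and, BitVec.getLsbD_shiftLeft, getLsbD_pk hb, ht, BitVec.getLsbD_not,
    BitVec.getLsbD_zero]
  by_cases h : t < b * c
  · simp [h, div_lt_of_lt_lanes h]
  · have h1 : ¬ t / b < c := by rwa [div_lt_iff_lanes hb]
    simp [h, h1, show t - b * c < w by omega]

theorem pk_append (hb : 0 < b) :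
    pk w b n u ||| (pk w b n' v <<< (b * n)) =
      pk w b (n + n') (fun i => if i < n then u i else v (i - n)) := by
  apply BitVec.eq_of_getLsbD_eq
  intro t ht
  simp only [BitVec.getLsbD_or, BitVec.getLsbD_shiftLeft, getLsbD_pk hb, ht]
  by_cases h : t < b * n
  · simp [h, div_lt_of_lt_lanes h, show t < b * (n + n') by rw [mul_add]; omega]
  · have h1 : ¬ t / b < n := by rwa [div_lt_iff_lanes hb]
    have h2 : (t - b * n) / b = t / b - n := Nat.sub_mul_div _ _ _
    have h3 : (t - b * n) % b = t % b := Nat.sub_mul_mod (by omega)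
    have h4 : (t - b * n < b * n') = (t < b * (n + n')) := by
      rw [mul_add, eq_iff_iff]; omega
    simp [h, h1, h2, h3, h4, show t - b * n < w by omega]

/-- The same bits can be read as `n` wide lanes or as `n * h` narrow ones. The reversal of lanes
changes between these views. -/
theorem pk_regroup (hb : 0 < b) {h : ℕ} (hh : 0 < h) :
    pk w (b * h) n (fun i => packNat b h (fun l => v (i * h + l))) = pk w b (n * h) v := by
  apply BitVec.eq_of_getLsbD_eq
  intro t ht
  simp only [getLsbD_pk hb, getLsbD_pk (Nat.mul_pos hb hh), ht, testBit_packNat hb]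
  have h1 : t % (b * h) < b * h := Nat.mod_lt _ (Nat.mul_pos hb hh)
  have h2 : t % (b * h) / b = t / b % h := Nat.mod_mul_right_div_self _ _ _
  have h3 : t / (b * h) * h + t / b % h = t / b := by
    rw [← Nat.div_div_eq_div_mul, mul_comm, Nat.div_add_mod]
  have h4 : t % (b * h) % b = t % b := Nat.mod_mul_right_mod _ _ _
  rw [h2, h3, h4, mul_assoc, mul_comm h n]
  simp [h1]

end

end WordRAM

/-! ## Bitonic merging and propagation along runs of equal keys -/

namespace WordRAM

/-- The involution that exchanges `i` and `i + 2 ^ k`, where bit `k` of `i` is `0`, if `c i`. -/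
def exch (k : ℕ) (c : ℕ → Bool) (i : ℕ) : ℕ :=
  if i.testBit k then (if c (i - 2 ^ k) then i - 2 ^ k else i)
  else (if c i then i + 2 ^ k else i)

theorem testBit_add_two_pow_self (i k : ℕ) : (i + 2 ^ k).testBit k = !i.testBit k := by
  rw [add_comm, Nat.testBit_two_pow_add_eq]

theorem testBit_sub_two_pow_self {i k : ℕ} (h : i.testBit k = true) :
    (i - 2 ^ k).testBit k = false := by
  have h1 := Nat.ge_two_pow_of_testBit h
  have := testBit_add_two_pow_self (i - 2 ^ k) k
  rw [Nat.sub_add_cancel h1, h] at this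
  simpa using this.symm

theorem exch_exch (k : ℕ) (c : ℕ → Bool) (i : ℕ) : exch k c (exch k c i) = i := by
  by_cases h : i.testBit k = true
  · have h1 := Nat.ge_two_pow_of_testBit h
    by_cases hc : c (i - 2 ^ k) = true
    · simp [exch, h, hc, testBit_sub_two_pow_self h, Nat.sub_add_cancel h1]
    · simp [exch, h, hc]
  · by_cases hc : c i = true
    · simp [exch, h, hc, testBit_add_two_pow_self]
    · simp [exch, h, hc]

theorem div_two_pow_of_testBit_false {i k : ℕ} (h : i.testBit k = false) :
    i / 2 ^ k = 2 * (i / 2 ^ (k + 1)) := by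
  rw [pow_succ, ← Nat.div_div_eq_div_mul]
  rw [Nat.testBit_eq_decide_div_mod_eq] at h
  simp only [decide_eq_false_iff_not] at h
  omega

theorem div_two_pow_of_testBit_true {i k : ℕ} (h : i.testBit k = true) :
    i / 2 ^ k = 2 * (i / 2 ^ (k + 1)) + 1 := by
  rw [pow_succ, ← Nat.div_div_eq_div_mul]
  rw [Nat.testBit_eq_decide_div_mod_eq] at h
  simp only [decide_eq_true_eq] at h
  omega

theorem add_two_pow_div {i k : ℕ} (h : i.testBit k = false) :
    (i + 2 ^ k) / 2 ^ (k + 1) = i / 2 ^ (k + 1) := by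
  have h1 := div_two_pow_of_testBit_false h
  have h2 : (i + 2 ^ k) / 2 ^ k = i / 2 ^ k + 1 := Nat.add_div_right _ (by positivity)
  have h3 := div_two_pow_of_testBit_true (i := i + 2 ^ k) (k := k)
    (by simp [testBit_add_two_pow_self, h])
  omega

theorem lt_of_div_eq {i j c n : ℕ} (hi : i < n) (hn : c ∣ n) (h : j / c = i / c)
    (hc : 0 < c) : j < n := by
  obtain ⟨m, rfl⟩ := hn
  rw [mul_comm, ← Nat.div_lt_iff_lt_mul hc] at *
  omega

theorem add_two_pow_lt {i k n : ℕ} (h : i.testBit k = false) (hi : i < n) (hn : 2 ^ (k + 1) ∣ n) :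
    i + 2 ^ k < n :=
  lt_of_div_eq hi hn (add_two_pow_div h) (by positivity)

theorem exch_lt {k n i : ℕ} (c : ℕ → Bool) (hn : 2 ^ (k + 1) ∣ n) (hi : i < n) :
    exch k c i < n := by
  by_cases h : i.testBit k = true
  · simp only [exch, h, if_true]
    split_ifs <;> omega
  · simp only [exch, h, Bool.false_eq_true, if_false]
    have := add_two_pow_lt (by simpa using h) hi hn
    split_ifs <;> omega

/-- The comparators of a half cleaner: the pair `i`, `i + 2 ^ k` is out of order. -/
def outOfOrder (k : ℕ) (a : ℕ → ℕ) (i : ℕ) : Bool :=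
  decide (a (i + 2 ^ k) ≤ a i)

/-- One half cleaner. -/
def halfClean (k : ℕ) (a : ℕ → ℕ) (i : ℕ) : ℕ :=
  a (exch k (outOfOrder k a) i)

theorem halfClean_low {k i : ℕ} (a : ℕ → ℕ) (h : i.testBit k = false) :
    halfClean k a i = min (a i) (a (i + 2 ^ k)) := by
  by_cases hc : a (i + 2 ^ k) ≤ a i
  · simp [halfClean, exch, h, outOfOrder, hc]
  · simp [halfClean, exch, h, outOfOrder, hc, (not_le.1 hc).le]

theorem halfClean_high {k i : ℕ} (a : ℕ → ℕ) (h : i.testBit k = false) :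
    halfClean k a (i + 2 ^ k) = max (a i) (a (i + 2 ^ k)) := by
  by_cases hc : a (i + 2 ^ k) ≤ a i
  · simp [halfClean, exch, h, outOfOrder, hc, testBit_add_two_pow_self]
  · simp [halfClean, exch, h, outOfOrder, hc, testBit_add_two_pow_self, (not_le.1 hc).le]

/-! ### Bitonic sequences and half cleaners -/

/-- Four values that alternate around a threshold. -/
def Alternating (x y z t : ℕ) : Prop :=
  (x < y ∧ x < t ∧ z < y ∧ z < t) ∨ (y < x ∧ y < z ∧ t < x ∧ t < z)

/-- The blocks of length `2 ^ k` of `a` are bitonic, and their values increase from block to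
block. -/
structure BitonicBlocks (n k : ℕ) (a : ℕ → ℕ) : Prop where
  bitonic : ∀ i j l r, i < j → j < l → l < r → r < n → i / 2 ^ k = r / 2 ^ k →
    ¬ Alternating (a i) (a j) (a l) (a r)
  le : ∀ i j, i < n → j < n → i / 2 ^ k < j / 2 ^ k → a i ≤ a j

/-- Read the arguments as values at positions `i < j < l < r < i' < j' < l' < r'`. In an alternation
of the minima, choose for each of the two small minima the position where it is attained. Each of
the four choices yields an alternation of one of the four excluded quadruples, all of which are in
increasing order of position. For maxima the two large entries are chosen instead. -/
theorem alternating_min {i j l r i' j' l' r' : ℕ}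
    (h1 : ¬ Alternating i j l r) (h2 : ¬ Alternating i j l' r')
    (h3 : ¬ Alternating l r i' j') (h4 : ¬ Alternating i' j' l' r') :
    ¬ Alternating (min i i') (min j j') (min l l') (min r r') := by
  simp only [Alternating, lt_min_iff, min_lt_iff] at *
  grind

theorem alternating_max {i j l r i' j' l' r' : ℕ}
    (h1 : ¬ Alternating i j l r) (h2 : ¬ Alternating i j l' r')
    (h3 : ¬ Alternating l r i' j') (h4 : ¬ Alternating i' j' l' r') :
    ¬ Alternating (max i i') (max j j') (max l l') (max r r') := by
  simp only [Alternating, max_lt_iff, lt_max_iff] at *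
  grind

theorem testBit_eq_of_div_eq {i j k : ℕ} (h : i / 2 ^ k = j / 2 ^ k) :
    i.testBit k = j.testBit k := by
  rw [Nat.testBit_eq_decide_div_mod_eq, Nat.testBit_eq_decide_div_mod_eq, h]

theorem sub_two_pow_lt_of_div_eq {i r k : ℕ} (h : i / 2 ^ k = r / 2 ^ k) : r < i + 2 ^ k := by
  have e1 := Nat.div_add_mod i (2 ^ k)
  have e2 := Nat.div_add_mod r (2 ^ k)
  have e3 := Nat.mod_lt r (show 0 < 2 ^ k by positivity)
  rw [h] at e1
  omega

theorem div_eq_of_le_of_le {i j r c : ℕ} (h : i / c = r / c) (h1 : i ≤ j) (h2 : j ≤ r) :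
    j / c = r / c :=
  le_antisymm (Nat.div_le_div_right h2) (h ▸ Nat.div_le_div_right h1)

/-- Bitonicity is expressed by forbidden alternations because these pass to the halves: four outputs
in one half come from eight inputs in one block, to which `alternating_min` or `alternating_max`
applies. If a low output exceeded a high output, the two pairs of inputs behind them would
themselves alternate. -/
theorem BitonicBlocks.halfClean {n k : ℕ} {a : ℕ → ℕ} (hn : 2 ^ (k + 1) ∣ n)
    (h : BitonicBlocks n (k + 1) a) : BitonicBlocks n k (halfClean k a) := by
  have quad : ∀ i j l r, i < j → j < l → l < r → r < n → i / 2 ^ k = r / 2 ^ k →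
      r.testBit k = false →
      (¬ Alternating (a i) (a j) (a l) (a r) ∧
        ¬ Alternating (a i) (a j) (a (l + 2 ^ k)) (a (r + 2 ^ k)) ∧
        ¬ Alternating (a l) (a r) (a (i + 2 ^ k)) (a (j + 2 ^ k)) ∧
        ¬ Alternating (a (i + 2 ^ k)) (a (j + 2 ^ k)) (a (l + 2 ^ k)) (a (r + 2 ^ k))) := by
    intro i j l r hij hjl hlr hr hd hb
    have tb : ∀ x, i ≤ x → x ≤ r → x.testBit k = false := fun x h1 h2 => by
      rw [← hb]; exact testBit_eq_of_div_eq (div_eq_of_le_of_le hd h1 h2)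
    have hd' : i / 2 ^ (k + 1) = r / 2 ^ (k + 1) := by
      have h1 := div_two_pow_of_testBit_false hb
      have h2 := div_two_pow_of_testBit_false (tb i le_rfl (by omega))
      omega
    have dv : ∀ x, i ≤ x → x ≤ r → x / 2 ^ (k + 1) = r / 2 ^ (k + 1) := fun x h1 h2 =>
      div_eq_of_le_of_le hd' h1 h2
    have dv' : ∀ x, i ≤ x → x ≤ r → (x + 2 ^ k) / 2 ^ (k + 1) = r / 2 ^ (k + 1) :=
      fun x h1 h2 => by rw [add_two_pow_div (tb x h1 h2), dv x h1 h2]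
    have lt' : ∀ x, i ≤ x → x ≤ r → x + 2 ^ k < n := fun x h1 h2 =>
      add_two_pow_lt (tb x h1 h2) (by omega) hn
    have hlt := sub_two_pow_lt_of_div_eq hd
    refine ⟨h.bitonic _ _ _ _ hij hjl hlr hr hd', h.bitonic _ _ _ _ hij ?_ ?_ ?_ ?_,
      h.bitonic _ _ _ _ hlr ?_ ?_ ?_ ?_, h.bitonic _ _ _ _ ?_ ?_ ?_ ?_ ?_⟩
    · omega
    · omega
    · exact lt' r (by omega) le_rfl
    · rw [dv' r (by omega) le_rfl, hd']
    · omega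
    · omega
    · exact lt' j (by omega) (by omega)
    · rw [dv' j (by omega) (by omega), dv l (by omega) (by omega)]
    · omega
    · omega
    · omega
    · exact lt' r (by omega) le_rfl
    · rw [dv' r (by omega) le_rfl, dv' i le_rfl (by omega)]
  refine ⟨fun i j l r hij hjl hlr hr hd => ?_, fun i j hi hj hd => ?_⟩
  · by_cases hb : r.testBit k = true
    · have tb : ∀ x, i ≤ x → x ≤ r → x.testBit k = true := fun x h1 h2 => by
        rw [← hb]; exact testBit_eq_of_div_eq (div_eq_of_le_of_le hd h1 h2)
      have key : ∀ x, i ≤ x → x ≤ r → ∃ y, x = y + 2 ^ k ∧ y.testBit k = false :=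
        fun x h1 h2 => ⟨x - 2 ^ k,
          (Nat.sub_add_cancel (Nat.ge_two_pow_of_testBit (tb x h1 h2))).symm,
          testBit_sub_two_pow_self (tb x h1 h2)⟩
      obtain ⟨i, rfl, bi⟩ := key i le_rfl (by omega)
      obtain ⟨j, rfl, bj⟩ := key j (by omega) (by omega)
      obtain ⟨l, rfl, bl⟩ := key l (by omega) (by omega)
      obtain ⟨r, rfl, br⟩ := key r (by omega) (by omega)
      rw [halfClean_high a bi, halfClean_high a bj, halfClean_high a bl, halfClean_high a br]
      rw [Nat.add_div_right _ (by positivity), Nat.add_div_right _ (by positivity)] at hd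
      obtain ⟨h1, h2, h3, h4⟩ := quad i j l r (by omega) (by omega) (by omega) (by omega)
        (by omega) br
      exact alternating_max h1 h2 h3 h4
    · simp only [Bool.not_eq_true] at hb
      have tb : ∀ x, i ≤ x → x ≤ r → x.testBit k = false := fun x h1 h2 => by
        rw [← hb]; exact testBit_eq_of_div_eq (div_eq_of_le_of_le hd h1 h2)
      rw [halfClean_low a (tb i le_rfl (by omega)), halfClean_low a (tb j (by omega) (by omega)),
        halfClean_low a (tb l (by omega) (by omega)), halfClean_low a hb]
      obtain ⟨h1, h2, h3, h4⟩ := quad i j l r hij hjl hlr hr hd hb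
      exact alternating_min h1 h2 h3 h4
  · by_cases hlt : i / 2 ^ (k + 1) < j / 2 ^ (k + 1)
    -- An exchange never leaves its block of length `2 ^ (k + 1)`, so the order between different
    -- such blocks is inherited.
    · have key : ∀ (c : ℕ → Bool) (x : ℕ), exch k c x / 2 ^ (k + 1) = x / 2 ^ (k + 1) := by
        intro c x
        by_cases hx : x.testBit k = true
        · have := add_two_pow_div (testBit_sub_two_pow_self hx)
          rw [Nat.sub_add_cancel (Nat.ge_two_pow_of_testBit hx)] at this
          simp only [exch, hx, if_true]
          split_ifs
          · exact this.symm
          · rfl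
        · have := add_two_pow_div (i := x) (k := k) (by simpa using hx)
          simp only [exch, hx, Bool.false_eq_true, if_false]
          split_ifs
          · exact this
          · rfl
      refine h.le _ _ (exch_lt _ hn hi) (exch_lt _ hn hj) ?_
      rw [key, key]
      exact hlt
    · have e1 : i / 2 ^ (k + 1) = j / 2 ^ (k + 1) := by
        refine le_antisymm ?_ (not_lt.1 hlt)
        rw [pow_succ, ← Nat.div_div_eq_div_mul, ← Nat.div_div_eq_div_mul]
        omega
      have bi : i.testBit k = false := by
        by_contra hb
        have h1 := div_two_pow_of_testBit_true (i := i) (k := k) (by simpa using hb)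
        rcases hj' : j.testBit k with _ | _
        · have := div_two_pow_of_testBit_false hj'; omega
        · have := div_two_pow_of_testBit_true hj'; omega
      have bj : j.testBit k = true := by
        by_contra hb
        have h1 := div_two_pow_of_testBit_false bi
        have h2 := div_two_pow_of_testBit_false (i := j) (k := k) (by simpa using hb)
        omega
      obtain ⟨j, rfl⟩ : ∃ y, j = y + 2 ^ k :=
        ⟨j - 2 ^ k, (Nat.sub_add_cancel (Nat.ge_two_pow_of_testBit bj)).symm⟩
      have bj' : j.testBit k = false := by simpa [testBit_add_two_pow_self] using bj
      rw [halfClean_low a bi, halfClean_high a bj']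
      have e2 := add_two_pow_div bj'
      have e3 := add_two_pow_div bi
      have e4 : i / 2 ^ k = j / 2 ^ k := by
        have h1 := div_two_pow_of_testBit_false bi
        have h2 := div_two_pow_of_testBit_false bj'
        omega
      have hlt1 := sub_two_pow_lt_of_div_eq e4
      have hlt2 := sub_two_pow_lt_of_div_eq e4.symm
      have hi' := add_two_pow_lt bi hi hn
      rcases lt_trichotomy i j with hij | rfl | hij
      -- If the minimum for `i` exceeded the maximum for `j`, both entries of the pair of `i` would
      -- exceed both of the pair of `j`; the two pairs interleave, which is an alternation.
      · have := h.bitonic i j (i + 2 ^ k) (j + 2 ^ k) hij (by omega) (by omega) hj (by omega)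
        simp only [Alternating] at this
        omega
      · omega
      · have := h.bitonic j i (j + 2 ^ k) (i + 2 ^ k) hij (by omega) (by omega) hi' (by omega)
        simp only [Alternating] at this
        omega

theorem BitonicBlocks.monotone {n : ℕ} {a : ℕ → ℕ} (h : BitonicBlocks n 0 a) {i j : ℕ}
    (hij : i ≤ j) (hj : j < n) : a i ≤ a j := by
  rcases hij.eq_or_lt with rfl | hlt
  · exact le_rfl
  · exact h.le i j (by omega) hj (by simpa using hlt)

/-- The minimum of an increasing and a decreasing sequence first follows the former and then the
latter. This is the lower output of the opening half cleaner of a merge of `2 ^ (m + 1)` keys, so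
that `m` rounds remain inside the word. -/
theorem bitonicBlocks_min {m : ℕ} {a b : ℕ → ℕ} (ha : ∀ i j, i ≤ j → j < 2 ^ m → a i ≤ a j)
    (hb : ∀ i j, i ≤ j → j < 2 ^ m → b j ≤ b i) :
    BitonicBlocks (2 ^ m) m (fun i => min (a i) (b i)) := by
  refine ⟨fun i j l r hij hjl hlr hr _ => ?_, fun i j hi hj h => ?_⟩
  · have := ha i j (by omega) (by omega)
    have := ha j l (by omega) (by omega)
    have := ha l r (by omega) (by omega)
    have := hb i j (by omega) (by omega)
    have := hb j l (by omega) (by omega)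
    have := hb l r (by omega) (by omega)
    simp only [Alternating]
    omega
  · simp [Nat.div_eq_of_lt hi, Nat.div_eq_of_lt hj] at h

theorem bitonicBlocks_max {m : ℕ} {a b : ℕ → ℕ} (ha : ∀ i j, i ≤ j → j < 2 ^ m → a i ≤ a j)
    (hb : ∀ i j, i ≤ j → j < 2 ^ m → b j ≤ b i) :
    BitonicBlocks (2 ^ m) m (fun i => max (a i) (b i)) := by
  refine ⟨fun i j l r hij hjl hlr hr _ => ?_, fun i j hi hj h => ?_⟩
  · have := ha i j (by omega) (by omega)
    have := ha j l (by omega) (by omega)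
    have := ha l r (by omega) (by omega)
    have := hb i j (by omega) (by omega)
    have := hb j l (by omega) (by omega)
    have := hb l r (by omega) (by omega)
    simp only [Alternating]
    omega
  · simp [Nat.div_eq_of_lt hi, Nat.div_eq_of_lt hj] at h

/-! ### The bitonic sorter with payload and history -/

/-- The keys after `j` half cleaners of the bitonic sorter for `2 ^ m` keys. -/
def netKeys (m : ℕ) (a : ℕ → ℕ) : ℕ → ℕ → ℕ
  | 0 => a
  | j + 1 => halfClean (m - 1 - j) (netKeys m a j)

/-- The exchanges of the `j`-th half cleaner. -/
def netExch (m : ℕ) (a : ℕ → ℕ) (j : ℕ) : ℕ → Bool :=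
  outOfOrder (m - 1 - j) (netKeys m a j)

/-- The payload after `j` half cleaners, which moves along with the keys. -/
def netPay (m : ℕ) (a p : ℕ → ℕ) : ℕ → ℕ → ℕ
  | 0 => p
  | j + 1 => fun i => netPay m a p j (exch (m - 1 - j) (netExch m a j) i)

/-- The record of the exchanges of the first `j` half cleaners. -/
def netHist (m : ℕ) (a : ℕ → ℕ) : ℕ → ℕ → ℕ
  | 0 => fun _ => 0
  | j + 1 => fun i => netHist m a j i |||
      (if i.testBit (m - 1 - j) = false ∧ netExch m a j i = true then 1 else 0) * 2 ^ (m - 1 - j)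

theorem netKeys_succ (m : ℕ) (a : ℕ → ℕ) (j i : ℕ) :
    netKeys m a (j + 1) i = netKeys m a j (exch (m - 1 - j) (netExch m a j) i) := rfl

theorem two_pow_dvd_of_lt {m j : ℕ} (h : j < m) : 2 ^ (m - 1 - j + 1) ∣ 2 ^ m :=
  pow_dvd_pow _ (by omega)

theorem netKeys_lt {m B : ℕ} {a : ℕ → ℕ} (ha : ∀ i < 2 ^ m, a i < B) {j : ℕ} (hj : j ≤ m) :
    ∀ i < 2 ^ m, netKeys m a j i < B := by
  induction j with
  | zero => exact ha
  | succ j ih =>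
    intro i hi
    exact ih (by omega) _ (exch_lt _ (two_pow_dvd_of_lt (by omega)) hi)

theorem netPay_lt {m B : ℕ} {a p : ℕ → ℕ} (hp : ∀ i < 2 ^ m, p i < B) {j : ℕ} (hj : j ≤ m) :
    ∀ i < 2 ^ m, netPay m a p j i < B := by
  induction j with
  | zero => exact hp
  | succ j ih =>
    intro i hi
    exact ih (by omega) _ (exch_lt _ (two_pow_dvd_of_lt (by omega)) hi)

theorem bitonicBlocks_netKeys {m : ℕ} {a : ℕ → ℕ} (ha : BitonicBlocks (2 ^ m) m a) {j : ℕ}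
    (hj : j ≤ m) : BitonicBlocks (2 ^ m) (m - j) (netKeys m a j) := by
  induction j with
  | zero => exact ha
  | succ j ih =>
    have h := ih (by omega)
    rw [show m - j = m - 1 - j + 1 by omega] at h
    rw [show m - (j + 1) = m - 1 - j by omega]
    exact h.halfClean (two_pow_dvd_of_lt (by omega))

theorem netKeys_monotone {m : ℕ} {a : ℕ → ℕ} (ha : BitonicBlocks (2 ^ m) m a) {i j : ℕ}
    (hij : i ≤ j) (hj : j < 2 ^ m) : netKeys m a m i ≤ netKeys m a m j := by
  have := bitonicBlocks_netKeys ha (le_refl m)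
  rw [Nat.sub_self] at this
  exact this.monotone hij hj

/-- Different rounds use different distances `2 ^ k` with `k < m`, so one lane has room for one
recorded bit per round. -/
theorem testBit_netHist (m : ℕ) (a : ℕ → ℕ) {j : ℕ} (hj : j ≤ m) {k : ℕ} (hk : k < m) (i : ℕ) :
    (netHist m a j i).testBit k = (decide (m ≤ k + j) &&
      (!i.testBit k && netExch m a (m - 1 - k) i)) := by
  induction j with
  | zero => simp [netHist, show ¬ m ≤ k by omega]
  | succ j ih =>
    simp only [netHist, Nat.testBit_or, ih (by omega)]
    rcases eq_or_ne (m - 1 - j) k with rfl | hne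
    · rw [show m - 1 - (m - 1 - j) = j by omega]
      simp only [show ¬ m ≤ m - 1 - j + j by omega, show m ≤ m - 1 - j + (j + 1) by omega]
      split_ifs with h
      · simp [h, Nat.testBit_two_pow_self]
      · have : i.testBit (m - 1 - j) = true ∨ netExch m a j i = false := by
          by_contra h'
          push Not at h'
          exact h ⟨by simpa using h'.1, by simpa using h'.2⟩
        rcases this with h' | h' <;> simp [h']
    · have : (m ≤ k + j) = (m ≤ k + (j + 1)) := by rw [eq_iff_iff]; omega
      simp only [this]
      split_ifs
      · simp [Nat.testBit_two_pow_of_ne hne]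
      · simp

/-- Every round is an involution of the lanes that acts on keys and payload alike, so the set of
pairs of key and payload does not change. -/
theorem exists_net {m : ℕ} {a p : ℕ → ℕ} {j : ℕ} (hj : j ≤ m) (P : ℕ → ℕ → Prop) :
    (∃ i < 2 ^ m, P (netKeys m a j i) (netPay m a p j i)) ↔ ∃ i < 2 ^ m, P (a i) (p i) := by
  induction j with
  | zero => rfl
  | succ j ih =>
    rw [← ih (by omega)]
    constructor
    · rintro ⟨i, hi, h⟩
      exact ⟨_, exch_lt _ (two_pow_dvd_of_lt (by omega)) hi, h⟩
    · rintro ⟨i, hi, h⟩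
      refine ⟨exch (m - 1 - j) (netExch m a j) i, exch_lt _ (two_pow_dvd_of_lt (by omega)) hi, ?_⟩
      rw [netKeys_succ]
      simp only [netPay]
      rwa [exch_exch]

/-! ### Propagation along runs by doubling -/

/-- The payload after `k` rounds of propagation along runs of equal keys. -/
def spread (n : ℕ) (a p : ℕ → ℕ) : ℕ → ℕ → ℕ
  | 0 => p
  | k + 1 => fun i => spread n a p k i |||
      ((if i + 2 ^ k < n ∧ a (i + 2 ^ k) ≤ a i then spread n a p k (i + 2 ^ k) else 0) |||
      (if 2 ^ k ≤ i ∧ a i ≤ a (i - 2 ^ k) then spread n a p k (i - 2 ^ k) else 0))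

theorem spread_lt {n f : ℕ} {a p : ℕ → ℕ} (hp : ∀ i < n, p i < 2 ^ f) (k : ℕ) :
    ∀ i < n, spread n a p k i < 2 ^ f := by
  induction k with
  | zero => exact hp
  | succ k ih =>
    intro i hi
    have h0 : 0 < 2 ^ f := by positivity
    refine Nat.or_lt_two_pow (ih i hi) (Nat.or_lt_two_pow ?_ ?_)
    · split_ifs with h
      · exact ih _ h.1
      · exact h0
    · split_ifs with h
      · exact ih _ ((Nat.sub_le _ _).trans_lt hi)
      · exact h0

/-- After `k` rounds a payload has travelled every distance below `2 ^ k` within its run. Since the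
keys are sorted, equality at distance `2 ^ k` needs only one inequality, and it forces all keys in
between to be equal. -/
theorem testBit_spread {n : ℕ} {a : ℕ → ℕ} (ha : ∀ i j, i ≤ j → j < n → a i ≤ a j) (p : ℕ → ℕ)
    (b k : ℕ) {i : ℕ} (hi : i < n) :
    (spread n a p k i).testBit b = true ↔
      ∃ j < n, i < j + 2 ^ k ∧ j < i + 2 ^ k ∧ a j = a i ∧ (p j).testBit b = true := by
  induction k generalizing i with
  | zero =>
    constructor
    · intro h
      exact ⟨i, hi, by omega, by omega, rfl, h⟩
    · rintro ⟨j, hj, h1, h2, h3, h4⟩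
      rw [show j = i by simp at h1 h2; omega] at h4
      exact h4
  | succ k ih =>
    have hk : 0 < 2 ^ k := by positivity
    simp only [spread, Nat.testBit_or, Bool.or_eq_true, ih hi, pow_succ]
    constructor
    · rintro (⟨j, hj, h1, h2, h3, h4⟩ | h | h)
      · exact ⟨j, hj, by omega, by omega, h3, h4⟩
      · split_ifs at h with hc
        · obtain ⟨j, hj, h1, h2, h3, h4⟩ := (ih hc.1).1 h
          refine ⟨j, hj, by omega, by omega, ?_, h4⟩
          have := ha i (i + 2 ^ k) (by omega) hc.1
          omega
        · simp at h
      · split_ifs at h with hc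
        · obtain ⟨j, hj, h1, h2, h3, h4⟩ := (ih (show i - 2 ^ k < n by omega)).1 h
          refine ⟨j, hj, by omega, by omega, ?_, h4⟩
          have := ha (i - 2 ^ k) i (by omega) hi
          omega
        · simp at h
    · rintro ⟨j, hj, h1, h2, h3, h4⟩
      by_cases c1 : i + 2 ^ k ≤ j
      · right; left
        have e1 := ha i (i + 2 ^ k) (by omega) (by omega)
        have e2 := ha (i + 2 ^ k) j c1 hj
        rw [if_pos ⟨by omega, by omega⟩, ih (by omega)]
        exact ⟨j, hj, by omega, by omega, by omega, h4⟩
      · by_cases c2 : j + 2 ^ k ≤ i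
        · right; right
          have e1 := ha j (i - 2 ^ k) (by omega) (by omega)
          have e2 := ha (i - 2 ^ k) i (by omega) hi
          rw [if_pos ⟨by omega, by omega⟩, ih (by omega)]
          exact ⟨j, hj, by omega, by omega, by omega, h4⟩
        · left
          exact ⟨j, hj, by omega, by omega, h3, h4⟩

/-- The bitwise or of the values `p j`, `j < n`, with key `a j = κ`. -/
def gather (a p : ℕ → ℕ) (κ : ℕ) : ℕ → ℕ
  | 0 => 0
  | n + 1 => gather a p κ n ||| (if a n = κ then p n else 0)

theorem testBit_gather (a p : ℕ → ℕ) (κ n b : ℕ) :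
    (gather a p κ n).testBit b = true ↔ ∃ j < n, a j = κ ∧ (p j).testBit b = true := by
  induction n with
  | zero => simp [gather]
  | succ n ih =>
    simp only [gather, Nat.testBit_or, Bool.or_eq_true, ih]
    constructor
    · rintro (⟨j, hj, h⟩ | h)
      · exact ⟨j, by omega, h⟩
      · split_ifs at h with hc
        · exact ⟨n, by omega, hc, h⟩
        · simp at h
    · rintro ⟨j, hj, h⟩
      rcases (Nat.lt_succ_iff_lt_or_eq.1 hj) with h' | rfl
      · exact Or.inl ⟨j, h', h⟩
      · right; simpa [h.1] using h.2

end WordRAM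

/-! ## Lane-parallel comparison and exchange -/

namespace WordRAM

theorem lt_two_pow_of_le {x w : ℕ} (h : x ≤ w) : x < 2 ^ w :=
  h.trans_lt Nat.lt_two_pow_self

theorem toNat_ofNat_of_le {x w : ℕ} (h : x ≤ w) : (BitVec.ofNat w x).toNat = x := by
  rw [BitVec.toNat_ofNat, Nat.mod_eq_of_lt (lt_two_pow_of_le h)]

theorem ofNat_sub_ofNat {w a b : ℕ} (h : b ≤ a) :
    BitVec.ofNat w a - BitVec.ofNat w b = BitVec.ofNat w (a - b) := by
  rw [sub_eq_iff_eq_add, ← BitVec.ofNat_add, Nat.sub_add_cancel h]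

theorem one_shl {w k : ℕ} : 1#w <<< k = BitVec.ofNat w (2 ^ k) := by
  apply BitVec.eq_of_toNat_eq
  rw [BitVec.toNat_shiftLeft, BitVec.toNat_ofNat, BitVec.toNat_ofNat, Nat.shiftLeft_eq, Nat.mul_mod,
    Nat.mod_mod, ← Nat.mul_mod, one_mul]

theorem ofNat_two_mul_shr {w x : ℕ} (h : 2 * x < 2 ^ w) (hw : 1 ≤ w) :
    BitVec.ofNat w (2 * x) >>> (1#w).toNat = BitVec.ofNat w x := by
  apply BitVec.eq_of_toNat_eq
  rw [BitVec.toNat_ushiftRight, BitVec.toNat_ofNat, toNat_ofNat_of_le hw, BitVec.toNat_ofNat,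
    Nat.mod_eq_of_lt h, Nat.mod_eq_of_lt (by omega), Nat.shiftRight_eq_div_pow]
  omega

theorem two_mul_lt_two_pow {w : ℕ} (h : 3 ≤ w) : 2 * w < 2 ^ w := by
  induction w, h using Nat.le_induction with
  | base => norm_num
  | succ w h ih => rw [pow_succ]; omega

/-- Quantities that are doubled until they exceed `w` stay within `2 * w`, hence do not wrap around.
The bound `3 ≤ w` is sharp, as `2 * 2 = 2 ^ 2`. -/
theorem toNat_ofNat_of_le_two_mul {x w : ℕ} (hw : 3 ≤ w) (h : x ≤ 2 * w) :
    (BitVec.ofNat w x).toNat = x := by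
  rw [BitVec.toNat_ofNat, Nat.mod_eq_of_lt (h.trans_lt (two_mul_lt_two_pow hw))]

theorem and_two_pow_sub_one {x f : ℕ} (h : x < 2 ^ f) : x &&& (2 ^ f - 1) = x := by
  rw [Nat.and_two_pow_sub_one_eq_mod, Nat.mod_eq_of_lt h]

section
variable {w f m n : ℕ} {a a' u v : ℕ → ℕ}

/-- Comparison of all lanes by one subtraction: the test bit of lane `i` survives iff
`a' i ≤ a i`. -/
theorem pk_compare (hw : (f + 1) * n ≤ w) (ha : ∀ i < n, a i < 2 ^ f) (ha' : ∀ i < n, a' i < 2 ^ f)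
    (hu : ∀ i < n, u i ≤ 1) :
    (((pk w (f + 1) n a + pk w (f + 1) n fun _ => 2 ^ f) - pk w (f + 1) n a') >>> f) &&&
      pk w (f + 1) n u = pk w (f + 1) n (fun i => if a' i ≤ a i then u i else 0) := by
  have h2 : 2 ^ (f + 1) = 2 * 2 ^ f := by rw [pow_succ, mul_comm]
  rw [pk_add, pk_sub, pk_inner_shr_and (by omega) le_rfl hw]
  · refine pk_congr fun i hi => ?_
    have h1 := ha i hi
    have h1' := ha' i hi
    rw [Nat.shiftRight_eq_div_pow]
    have h3 : (a i + 2 ^ f - a' i) / 2 ^ f = if a' i ≤ a i then 1 else 0 := by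
      split_ifs with hc
      · apply Nat.div_eq_of_lt_le <;> omega
      · apply Nat.div_eq_of_lt; omega
    rw [h3]
    have := hu i hi
    split_ifs
    · interval_cases (u i) <;> rfl
    · simp
  · intro i hi
    have := hu i hi
    rw [show f + 1 - f = 1 by omega]
    omega
  · intro i hi
    have := ha' i hi
    omega
  · intro i hi
    have := ha i hi
    omega
  · intro i hi
    have := ha i hi
    omega

/-- Widens a one-bit flag to a mask for the `f` bits of the entry; the test bit stays clear. -/
theorem pk_mask (hu : ∀ i < n, u i ≤ 1) :
    pk w (f + 1) n u * BitVec.ofNat w (2 ^ f - 1) =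
      pk w (f + 1) n (fun i => u i * (2 ^ f - 1)) := by
  have h2 : 2 ^ (f + 1) = 2 * 2 ^ f := by rw [pow_succ, mul_comm]
  have h3 : 0 < 2 ^ f := by positivity
  refine pk_mul (fun i hi => ?_) (fun i hi => ?_)
  · have := hu i hi
    omega
  · have := Nat.mul_le_mul_right (2 ^ f - 1) (hu i hi)
    omega

/-- The lanes whose index has bit `k` equal to `0`. -/
def lowLanes (k i : ℕ) : ℕ := if i.testBit k then 0 else 1

theorem lowLanes_le (k i : ℕ) : lowLanes k i ≤ 1 := by
  rw [lowLanes]; split_ifs <;> omega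

/-- Bit `k` of every lane index is extracted from the word of indices and complemented. -/
theorem pk_lowLanes {b k : ℕ} (hk : k < b) (hw : b * n ≤ w) :
    (pk w b n fun _ => 1) ^^^ ((pk w b n fun i => i) >>> k &&& pk w b n fun _ => 1) =
      pk w b n (lowLanes k) := by
  rw [pk_inner_shr_and (by omega) le_rfl hw, pk_xor (by omega)]
  · refine pk_congr fun i hi => ?_
    rw [Nat.and_one_is_mod, lowLanes, Nat.testBit_eq_decide_div_mod_eq, Nat.shiftRight_eq_div_pow]
    rcases Nat.mod_two_eq_zero_or_one (i / 2 ^ k) with h | h <;> simp [h]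
  · intro i hi
    exact Nat.one_lt_two_pow (by omega)

/-- Exchange by exclusive or: `t` holds, in the lower lane of each pair to be exchanged, the
difference of the two entries. Adding the difference to both lanes of the pair swaps them. -/
theorem pk_exch {k : ℕ} {c : ℕ → Bool} (hk : k < m) (hw : (f + 1) * 2 ^ m ≤ w)
    (hv : ∀ i < 2 ^ m, v i < 2 ^ f)
    {t : BitVec w}
    (ht : (pk w (f + 1) (2 ^ m) v ^^^ (pk w (f + 1) (2 ^ m) v >>> ((f + 1) * 2 ^ k))) &&&
      (pk w (f + 1) (2 ^ m) fun i => (if c i then lowLanes k i else 0) * (2 ^ f - 1)) = t) :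
    pk w (f + 1) (2 ^ m) v ^^^ (t ^^^ ((t <<< ((f + 1) * 2 ^ k)) &&&
      pk w (f + 1) (2 ^ m) fun _ => 2 ^ f - 1)) =
        pk w (f + 1) (2 ^ m) (fun i => v (exch k c i)) := by
  have hf : 0 < f + 1 := by omega
  rw [← ht, pk_shr hf hw, pk_xor hf, pk_and hf, pk_shl_and hf, pk_xor hf, pk_xor hf]
  refine pk_congr fun i hi => ?_
  have hd : 2 ^ (k + 1) ∣ 2 ^ m := pow_dvd_pow _ hk
  by_cases h : i.testBit k = true
  · have h1 := Nat.ge_two_pow_of_testBit h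
    have h2 := testBit_sub_two_pow_self h
    simp only [exch, lowLanes, h, h2, if_true, Nat.sub_add_cancel h1, hi, not_lt.2 h1, if_false,
      Bool.false_eq_true]
    by_cases hc : c (i - 2 ^ k) = true
    · have hx : v (i - 2 ^ k) ^^^ v i < 2 ^ f :=
        Nat.xor_lt_two_pow (hv _ ((Nat.sub_le _ _).trans_lt hi)) (hv _ hi)
      simp only [hc, if_true, one_mul, and_two_pow_sub_one hx, ite_self, zero_mul, Nat.and_zero,
        Nat.zero_xor]
      rw [Nat.xor_comm (v (i - 2 ^ k)), ← Nat.xor_assoc, Nat.xor_self, Nat.zero_xor]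
    · simp [hc]
  · simp only [Bool.not_eq_true] at h
    have h1 := add_two_pow_lt h hi hd
    -- A low lane receives nothing from the shifted copy of `t`: the lane `2 ^ k` below it is a high
    -- lane, where `t` vanishes.
    have h3 : (if i < 2 ^ k then 0 else
        ((v (i - 2 ^ k) ^^^ if i - 2 ^ k + 2 ^ k < 2 ^ m then v (i - 2 ^ k + 2 ^ k) else 0) &&&
          (if c (i - 2 ^ k) then lowLanes k (i - 2 ^ k) else 0) * (2 ^ f - 1)) &&& (2 ^ f - 1)) =
          0 := by
      split_ifs with h4 h5 h6 <;> try simp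
      all_goals
        have h7 := testBit_add_two_pow_self (i - 2 ^ k) k
        rw [Nat.sub_add_cancel (by omega), h] at h7
        simp [lowLanes, show (i - 2 ^ k).testBit k = true by simpa using h7.symm]
    rw [h3]
    simp only [exch, lowLanes, h, h1, if_true, if_false, Bool.false_eq_true, Nat.xor_zero]
    by_cases hc : c i = true
    · have hx : v i ^^^ v (i + 2 ^ k) < 2 ^ f := Nat.xor_lt_two_pow (hv _ hi) (hv _ h1)
      simp only [hc, if_true, one_mul, and_two_pow_sub_one hx]
      rw [← Nat.xor_assoc, Nat.xor_self, Nat.zero_xor]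
    · simp [hc]

end

end WordRAM

/-! ## Sorting, spreading and unsorting of the lanes of a word -/

namespace WordRAM

infixr:60 " ;; " => Program.seq

/-- `σ'` differs from `σ` only in the registers from `b` on. -/
structure Frame {w : ℕ} (b : ℕ) (σ σ' : State w) : Prop where
  mem : σ'.mem = σ.mem
  reg : ∀ y < b, σ'.reg y = σ.reg y

theorem Frame.refl {w : ℕ} (b : ℕ) (σ : State w) : Frame b σ σ := ⟨rfl, fun _ _ => rfl⟩

theorem Frame.trans {w b : ℕ} {σ σ' σ'' : State w} (h : Frame b σ σ') (h' : Frame b σ' σ'') :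
    Frame b σ σ'' :=
  ⟨h'.mem.trans h.mem, fun y hy => (h'.reg y hy).trans (h.reg y hy)⟩

theorem Frame.mono {w b b' : ℕ} {σ σ' : State w} (h : Frame b σ σ') (hb : b' ≤ b) :
    Frame b' σ σ' :=
  ⟨h.mem, fun y hy => h.reg y (hy.trans_le hb)⟩

theorem Frame.set {w b x : ℕ} {σ σ' : State w} {v : BitVec w} (h : Frame b σ σ') (hx : b ≤ x) :
    Frame b σ (σ'.set x v) :=
  ⟨h.mem, fun y hy => by rw [State.set_reg, if_neg (by omega), h.reg y hy]⟩

theorem wp_assign_seq {w x : ℕ} {e : Expr} {q : Program} {T : ℕ} {Q : State w → Prop}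
    {σ : State w} (v : BitVec w) (hv : e.eval σ = v) (h : wp q (T - (e.cost + 1)) Q (σ.set x v))
    (he : e.bounded 100 = true := by rfl) (hT : e.cost + 1 ≤ T := by decide) :
    wp (.assign x e ;; q) T Q σ :=
  wp_seq (wp_assign v hv h he le_rfl) (by omega)

theorem wp_run_seq {w : ℕ} {p q : Program} {T T₁ : ℕ} {R Q : State w → Prop} {σ : State w}
    (T₂ : ℕ) (hp : wp p T₁ R σ) (hq : ∀ σ', R σ' → wp q T₂ Q σ') (hT : T₁ + T₂ ≤ T) :
    wp (p ;; q) T Q σ :=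
  wp_seq (wp_mono hp le_rfl hq) hT

/-- The constants of the computation: `n = 2 ^ m` lanes of `f + 1` or `2 f + 1` bits. -/
structure Env (w f m : ℕ) (σ : State w) : Prop where
  f_pos : 1 ≤ f
  m_le : m ≤ f
  fits : (f + f + 1) * 2 ^ m ≤ w
  r0 : σ.reg 0 = BitVec.ofNat w w
  r1 : σ.reg 1 = BitVec.ofNat w f
  r7 : σ.reg 7 = BitVec.ofNat w (f + 1)
  r8 : σ.reg 8 = BitVec.ofNat w (f + f + 1)
  r10 : σ.reg 10 = BitVec.ofNat w (2 ^ m)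
  r11 : σ.reg 11 = BitVec.ofNat w m
  r12 : σ.reg 12 = pk w (f + 1) (2 ^ m) fun _ => 1
  r13 : σ.reg 13 = pk w (f + 1) (2 ^ m) fun i => i
  r14 : σ.reg 14 = pk w (f + f + 1) (2 ^ m) fun _ => 1
  r15 : σ.reg 15 = pk w (f + f + 1) (2 ^ m) fun i => i
  r17 : σ.reg 17 = BitVec.ofNat w ((f + 1) * 2 ^ m)
  r19 : σ.reg 19 = BitVec.ofNat w (2 ^ f - 1)
  r20 : σ.reg 20 = pk w (f + 1) (2 ^ m) fun _ => 2 ^ f - 1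
  r21 : σ.reg 21 = pk w (f + 1) (2 ^ m) fun _ => 2 ^ f
  r22 : σ.reg 22 = pk w (f + f + 1) (2 ^ m) fun _ => 2 ^ f - 1
  r23 : σ.reg 23 = BitVec.ofNat w (w / (f + 1))
  r24 : σ.reg 24 = BitVec.ofNat w (w / (f + f + 1))

theorem Env.congr {w f m : ℕ} {σ σ' : State w} (h : Env w f m σ)
    (hr : ∀ y < 30, σ'.reg y = σ.reg y) : Env w f m σ' := by
  constructor
  case f_pos => exact h.f_pos
  case m_le => exact h.m_le
  case fits => exact h.fits
  all_goals rw [hr _ (by decide)]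
  exacts [h.r0, h.r1, h.r7, h.r8, h.r10, h.r11, h.r12, h.r13, h.r14, h.r15, h.r17, h.r19, h.r20,
    h.r21, h.r22, h.r23, h.r24]

theorem Env.frame {w f m b : ℕ} {σ σ' : State w} (h : Env w f m σ) (hF : Frame b σ σ')
    (hb : 30 ≤ b := by decide) : Env w f m σ' :=
  h.congr fun y hy => hF.reg y (hy.trans_le hb)

section
variable {w f m : ℕ} {σ : State w}

theorem Env.fits' (h : Env w f m σ) : (f + 1) * 2 ^ m ≤ w :=
  (Nat.mul_le_mul_right _ (by omega)).trans h.fits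

theorem Env.lane_le (h : Env w f m σ) {k : ℕ} (hk : k ≤ m) : (f + 1) * 2 ^ k ≤ w :=
  (Nat.mul_le_mul_left _ (Nat.pow_le_pow_right (by omega) hk)).trans h.fits'

theorem Env.lane_le' (h : Env w f m σ) {k : ℕ} (hk : k ≤ m) : (f + f + 1) * 2 ^ k ≤ w :=
  (Nat.mul_le_mul_left _ (Nat.pow_le_pow_right (by omega) hk)).trans h.fits

theorem Env.width (h : Env w f m σ) : f + f + 1 ≤ w := by
  simpa using h.lane_le' (Nat.zero_le m)

end

open WordRAM.Expr in
/-- Sorts the bitonic keys in register `70`, moves the payload in register `71` along, and records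
the exchanges in register `72`. -/
def sortProg : Program :=
  .assign 72 (const 0) ;;
  .assign 73 (reg 11) ;;
  .assign 74 (reg 17) ;;
  .whileLt (const 0) (reg 73)
    (.assign 73 (reg 73 - const 1) ;;
    .assign 74 (reg 74 >>> const 1) ;;
    .assign 75 ((((reg 70 + reg 21) - (reg 70 >>> reg 74)) >>> reg 1) &&&
      (reg 12 ^^^ ((reg 13 >>> reg 73) &&& reg 12))) ;;
    .assign 72 (reg 72 ||| (reg 75 * (const 1 <<< reg 73))) ;;
    .assign 75 (reg 75 * reg 19) ;;
    .assign 76 ((reg 70 ^^^ (reg 70 >>> reg 74)) &&& reg 75) ;;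
    .assign 70 (reg 70 ^^^ (reg 76 ^^^ ((reg 76 <<< reg 74) &&& reg 20))) ;;
    .assign 76 ((reg 71 ^^^ (reg 71 >>> reg 74)) &&& reg 75) ;;
    .assign 71 (reg 71 ^^^ (reg 76 ^^^ ((reg 76 <<< reg 74) &&& reg 20))))

theorem wp_sortProg {w f m : ℕ} {σ : State w} (hE : Env w f m σ) {a p : ℕ → ℕ}
    (ha : ∀ i < 2 ^ m, a i < 2 ^ f) (hp : ∀ i < 2 ^ m, p i < 2 ^ f)
    (h70 : σ.reg 70 = pk w (f + 1) (2 ^ m) a) (h71 : σ.reg 71 = pk w (f + 1) (2 ^ m) p) :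
    wp sortProg (200 * (m + 1)) (fun σ' => Frame 70 σ σ' ∧
      σ'.reg 70 = pk w (f + 1) (2 ^ m) (netKeys m a m) ∧
      σ'.reg 71 = pk w (f + 1) (2 ^ m) (netPay m a p m) ∧
      σ'.reg 72 = pk w (f + 1) (2 ^ m) (netHist m a m)) σ := by
  have hq : 0 < f + 1 := by omega
  have hmw : m ≤ w := by have := hE.m_le; have := hE.width; omega
  refine wp_assign_seq (pk w (f + 1) (2 ^ m) (netHist m a 0)) (by simp [netHist, pk_zero]) ?_ rfl
    (by simp [Expr.cost]; omega)
  refine wp_assign_seq (BitVec.ofNat w m) (by simp [hE.r11]) ?_ rfl (by simp [Expr.cost]; omega)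
  refine wp_assign_seq (BitVec.ofNat w ((f + 1) * 2 ^ m)) (by simp [hE.r17]) ?_ rfl
    (by simp [Expr.cost]; omega)
  refine wp_whileLt (T := 150) (k := m) (fun k σ' => k ≤ m ∧ Frame 70 σ σ' ∧
      σ'.reg 70 = pk w (f + 1) (2 ^ m) (netKeys m a (m - k)) ∧
      σ'.reg 71 = pk w (f + 1) (2 ^ m) (netPay m a p (m - k)) ∧
      σ'.reg 72 = pk w (f + 1) (2 ^ m) (netHist m a (m - k)) ∧
      σ'.reg 73 = BitVec.ofNat w k ∧ σ'.reg 74 = BitVec.ofNat w ((f + 1) * 2 ^ k)) ?_ ?_ ?_ ?_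
  · refine ⟨le_rfl, ?_, ?_, ?_, ?_, ?_, ?_⟩
    · exact (((Frame.refl 70 σ).set (by decide)).set (by decide)).set (by decide)
    all_goals simp [h70, h71, netKeys, netPay]
  · rintro k σ' ⟨hk, hF, h1, h2, h3, h4, h5⟩ hc
    obtain rfl : k = 0 := by
      simp only [Expr.eval_const, Expr.eval_reg, h4, toNat_ofNat_of_le (hk.trans hmw)] at hc
      simpa using hc
    exact ⟨hF, h1, h2, h3⟩
  · rintro k σ' ⟨hk, hF, h1, h2, h3, h4, h5⟩ hc
    obtain ⟨k, rfl⟩ : ∃ k', k = k' + 1 := by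
      refine Nat.exists_eq_succ_of_ne_zero ?_
      rintro rfl
      simp [h4] at hc
    -- With `k + 1` rounds left, round `j` comes next, and its distance `2 ^ (m - 1 - j)` is `2 ^
    -- k`.
    obtain ⟨j, rfl⟩ : ∃ j, m = j + k + 1 := ⟨m - k - 1, by omega⟩
    rw [show j + k + 1 - (k + 1) = j by omega] at h1 h2 h3
    have hE' := hE.frame hF
    have hkw : (f + 1) * 2 ^ k ≤ w := hE.lane_le (by omega)
    have hj : j + k + 1 - 1 - j = k := by omega
    have hjm : j ≤ j + k + 1 := by omega
    have hka := netKeys_lt ha hjm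
    have hpa := netPay_lt (a := a) hp hjm
    have hD := toNat_ofNat_of_le hkw
    have hk' := toNat_ofNat_of_le (show k ≤ w by omega)
    have hf' := toNat_ofNat_of_le (show f ≤ w by have := hE.width; omega)
    have hc1 : ∀ i < 2 ^ (j + k + 1),
        (if netExch (j + k + 1) a j i then lowLanes k i else 0) ≤ 1 := fun i _ => by
      have := lowLanes_le k i
      split_ifs <;> omega
    refine wp_assign_seq (BitVec.ofNat w k) ?_ ?_
    · simp [h4, ofNat_sub_ofNat]
    refine wp_assign_seq (BitVec.ofNat w ((f + 1) * 2 ^ k)) ?_ ?_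
    · have e : (f + 1) * 2 ^ (k + 1) = 2 * ((f + 1) * 2 ^ k) := by rw [pow_succ]; ring
      have := hE.lane_le (k := k + 1) (by omega)
      simp only [Expr.eval_shr, Expr.eval_reg, State.set_reg, Expr.eval_const, reduceIte,
        Nat.reduceEqDiff, h5]
      rw [e, ofNat_two_mul_shr (lt_two_pow_of_le (by omega)) (by have := hE.width; omega)]
    refine wp_assign_seq (pk w (f + 1) (2 ^ (j + k + 1))
      (fun i => if netExch (j + k + 1) a j i then lowLanes k i else 0)) ?_ ?_
    · simp only [Expr.eval_and, Expr.eval_xor, Expr.eval_shr, Expr.eval_sub, Expr.eval_add,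
        Expr.eval_reg, State.set_reg]
      simp only [h1, hE'.r21, hE'.r1, hE'.r12, hE'.r13, hD, hk', hf', reduceIte, Nat.reduceEqDiff]
      rw [pk_lowLanes (by have := hE.m_le; omega) hE.fits', pk_shr hq hE.fits',
        pk_compare hE.fits' hka]
      -- The shift brings zeros into the top lanes, which spoils their comparison. Only low lanes
      -- are kept, and their partners exist.
      · refine pk_congr fun i hi => ?_
        by_cases hb : i.testBit k = true
        · simp [lowLanes, hb]
        · have := add_two_pow_lt (k := k) (by simpa using hb) hi (pow_dvd_pow _ (by omega))
          simp [netExch, outOfOrder, this]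
      · intro i hi
        split_ifs with h
        · exact hka _ h
        · positivity
      · exact fun i _ => lowLanes_le k i
    refine wp_assign_seq (pk w (f + 1) (2 ^ (j + k + 1)) (netHist (j + k + 1) a (j + 1))) ?_ ?_
    · simp only [Expr.eval_or, Expr.eval_mul, Expr.eval_shl, Expr.eval_const, Expr.eval_reg,
        State.set_reg]
      simp only [h3, hk', reduceIte, Nat.reduceEqDiff]
      -- The history bit fits into a lane because `k < m ≤ f`.
      have hpow : 2 ^ k < 2 ^ (f + 1) :=
        Nat.pow_lt_pow_right (by omega) (by have := hE.m_le; omega)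
      rw [one_shl, pk_mul, pk_or hq]
      · refine pk_congr fun i _ => ?_
        simp only [netHist, hj, lowLanes]
        by_cases hb : i.testBit k = true <;> by_cases he : netExch (j + k + 1) a j i = true <;>
          simp [hb, he]
      · intro i hi
        have := hc1 i hi
        have := Nat.one_lt_two_pow (show f + 1 ≠ 0 by omega)
        omega
      · intro i hi
        have := Nat.mul_le_mul_right (2 ^ k) (hc1 i hi)
        omega
    refine wp_assign_seq (pk w (f + 1) (2 ^ (j + k + 1))
      (fun i => (if netExch (j + k + 1) a j i then lowLanes k i else 0) * (2 ^ f - 1))) ?_ ?_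
    · simp only [Expr.eval_mul, Expr.eval_reg, State.set_reg]
      simp only [hE'.r19, reduceIte, Nat.reduceEqDiff]
      exact pk_mask hc1
    refine wp_assign_seq _ rfl ?_
    refine wp_assign_seq (pk w (f + 1) (2 ^ (j + k + 1)) (netKeys (j + k + 1) a (j + 1))) ?_ ?_
    · simp only [Expr.eval_and, Expr.eval_xor, Expr.eval_shr, Expr.eval_shl,
        Expr.eval_reg, State.set_reg]
      simp only [h1, hE'.r20, hD, reduceIte, Nat.reduceEqDiff]
      rw [pk_exch (by omega) hE.fits' hka rfl]
      exact pk_congr fun i _ => by rw [netKeys_succ, hj]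
    refine wp_assign_seq _ rfl ?_
    refine wp_assign (pk w (f + 1) (2 ^ (j + k + 1)) (netPay (j + k + 1) a p (j + 1))) ?_ ?_
    · simp only [Expr.eval_and, Expr.eval_xor, Expr.eval_shr, Expr.eval_shl,
        Expr.eval_reg, State.set_reg]
      simp only [h2, hE'.r20, hD, reduceIte, Nat.reduceEqDiff]
      rw [pk_exch (by omega) hE.fits' hpa rfl]
      exact pk_congr fun i _ => by rw [netPay, hj]
    refine ⟨k, by omega, by omega, ?_, ?_⟩
    · repeat refine Frame.set ?_ (by decide)
      exact hF
    · rw [show j + k + 1 - k = j + 1 by omega]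
      simp
  · simp only [Expr.cost]
    omega

end WordRAM

/-! ### Spreading the payload and undoing the sort -/

namespace WordRAM

open WordRAM.Expr in
/-- Propagates the payload in register `71` along runs of equal keys in register `70`. -/
def spreadProg : Program :=
  .assign 73 (const 0) ;;
  .assign 74 (reg 7) ;;
  .whileLt (reg 73) (reg 11)
    (.assign 75 (((((reg 70 + reg 21) - (reg 70 >>> reg 74)) >>> reg 1) &&& reg 12) * reg 19) ;;
    .assign 71 (reg 71 ||| (((reg 71 >>> reg 74) &&& reg 75) |||
      (((reg 71 &&& reg 75) <<< reg 74) &&& reg 20))) ;;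
    .assign 73 (reg 73 + const 1) ;;
    .assign 74 (reg 74 + reg 74))

open WordRAM.Expr in
/-- Undoes on the payload in register `71` the exchanges recorded in register `72`. -/
def unsortProg : Program :=
  .assign 73 (const 0) ;;
  .assign 74 (reg 7) ;;
  .whileLt (reg 73) (reg 11)
    (.assign 75 (((reg 72 >>> reg 73) &&&
      (reg 12 ^^^ ((reg 13 >>> reg 73) &&& reg 12))) * reg 19) ;;
    .assign 76 ((reg 71 ^^^ (reg 71 >>> reg 74)) &&& reg 75) ;;
    .assign 71 (reg 71 ^^^ (reg 76 ^^^ ((reg 76 <<< reg 74) &&& reg 20))) ;;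
    .assign 73 (reg 73 + const 1) ;;
    .assign 74 (reg 74 + reg 74))

section
variable {w f m : ℕ} {σ : State w}

theorem ofNat_lane_double (b k : ℕ) :
    BitVec.ofNat w (b * 2 ^ k) + BitVec.ofNat w (b * 2 ^ k) = BitVec.ofNat w (b * 2 ^ (k + 1)) := by
  rw [← BitVec.ofNat_add, pow_succ]
  congr 1
  ring

theorem wp_spreadProg (hE : Env w f m σ) {a p : ℕ → ℕ}
    (ha : ∀ i < 2 ^ m, a i < 2 ^ f) (hp : ∀ i < 2 ^ m, p i < 2 ^ f)
    (h70 : σ.reg 70 = pk w (f + 1) (2 ^ m) a) (h71 : σ.reg 71 = pk w (f + 1) (2 ^ m) p) :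
    wp spreadProg (200 * (m + 1)) (fun σ' => Frame 71 σ σ' ∧
      σ'.reg 71 = pk w (f + 1) (2 ^ m) (spread (2 ^ m) a p m)) σ := by
  have hq : 0 < f + 1 := by omega
  have hmw : m ≤ w := by have := hE.m_le; have := hE.width; omega
  refine wp_assign_seq (BitVec.ofNat w 0) rfl ?_ rfl (by simp [Expr.cost]; omega)
  refine wp_assign_seq (BitVec.ofNat w ((f + 1) * 2 ^ 0)) (by simp [hE.r7]) ?_ rfl
    (by simp [Expr.cost]; omega)
  refine wp_whileLt (T := 150) (k := m) (fun k σ' => ∃ j, j + k = m ∧ Frame 71 σ σ' ∧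
      σ'.reg 71 = pk w (f + 1) (2 ^ m) (spread (2 ^ m) a p j) ∧
      σ'.reg 73 = BitVec.ofNat w j ∧ σ'.reg 74 = BitVec.ofNat w ((f + 1) * 2 ^ j)) ?_ ?_ ?_ ?_
  · refine ⟨0, by omega, ?_, ?_, ?_, ?_⟩
    · exact ((Frame.refl 71 σ).set (by decide)).set (by decide)
    all_goals simp [h71, spread]
  · rintro k σ' ⟨j, hj, hF, h1, h2, h3⟩ hc
    obtain rfl : j = m := by
      simp only [Expr.eval_reg, h2, (hE.frame hF).r11, toNat_ofNat_of_le hmw,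
        toNat_ofNat_of_le (show j ≤ w by omega)] at hc
      omega
    exact ⟨hF, h1⟩
  · rintro k σ' ⟨j, hj, hF, h1, h2, h3⟩ hc
    have hE' := hE.frame hF
    have hjm : j < m := by
      simpa only [Expr.eval_reg, h2, hE'.r11, toNat_ofNat_of_le hmw,
        toNat_ofNat_of_le (show j ≤ w by omega)] using hc
    have hD := toNat_ofNat_of_le (hE.lane_le hjm.le)
    have hf' := toNat_ofNat_of_le (show f ≤ w by have := hE.width; omega)
    have h70' : σ'.reg 70 = pk w (f + 1) (2 ^ m) a := by rw [hF.reg 70 (by decide), h70]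
    have hs := spread_lt (a := a) hp j
    -- One comparison with the lane `2 ^ j` above serves both directions. Lanes without a partner
    -- always get the mask, which is harmless: zeros are shifted into them from above, and what they
    -- send upwards is cut off by register `20`.
    refine wp_assign_seq (pk w (f + 1) (2 ^ m) (fun i =>
      (if (if i + 2 ^ j < 2 ^ m then a (i + 2 ^ j) else 0) ≤ a i then 1 else 0) * (2 ^ f - 1)))
      ?_ ?_
    · simp only [Expr.eval_and, Expr.eval_mul, Expr.eval_shr, Expr.eval_sub, Expr.eval_add,
        Expr.eval_reg]
      simp only [h70', h3, hE'.r21, hE'.r1, hE'.r12, hE'.r19, hD, hf']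
      rw [pk_shr hq hE.fits', pk_compare hE.fits' ha, pk_mask]
      · intro i hi; split_ifs <;> omega
      · intro i hi
        split_ifs with h
        · exact ha _ h
        · positivity
      · exact fun i _ => le_rfl
    refine wp_assign_seq (pk w (f + 1) (2 ^ m) (spread (2 ^ m) a p (j + 1))) ?_ ?_
    · simp only [Expr.eval_and, Expr.eval_or, Expr.eval_shr, Expr.eval_shl, Expr.eval_reg,
        State.set_reg]
      simp only [h1, h3, hE'.r20, hD, reduceIte, Nat.reduceEqDiff]
      rw [pk_shr hq hE.fits', pk_and hq, pk_and hq, pk_shl_and hq, pk_or hq, pk_or hq]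
      refine pk_congr fun i hi => ?_
      simp only [spread]
      congr 1
      congr 1
      · by_cases h : i + 2 ^ j < 2 ^ m
        · by_cases hc : a (i + 2 ^ j) ≤ a i
          · simp only [h, hc, if_true, one_mul, and_two_pow_sub_one (hs _ h), and_self]
          · simp [h, hc]
        · simp [h]
      · by_cases h : i < 2 ^ j
        · simp [h]
        · have h' : 2 ^ j ≤ i := by omega
          simp only [h, h', if_false, Nat.sub_add_cancel h', hi, if_true, true_and]
          have h4 := hs (i - 2 ^ j) ((Nat.sub_le _ _).trans_lt hi)
          by_cases hc : a i ≤ a (i - 2 ^ j)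
          · simp only [hc, if_true, one_mul, and_two_pow_sub_one h4]
          · simp [hc]
    refine wp_assign_seq (BitVec.ofNat w (j + 1)) ?_ ?_
    · simp [h2, BitVec.ofNat_add]
    refine wp_assign (BitVec.ofNat w ((f + 1) * 2 ^ (j + 1))) ?_ ?_
    · simp only [Expr.eval_add, Expr.eval_reg, State.set_reg]
      simp only [h3, reduceIte, Nat.reduceEqDiff]
      exact ofNat_lane_double _ _
    refine ⟨k - 1, by omega, j + 1, by omega, ?_, by simp⟩
    repeat refine Frame.set ?_ (by decide)
    exact hF
  · simp only [Expr.cost]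
    omega

/-- The payload to be restored is a function `φ` of the key alone. Undoing an exchange thus turns
the values of the keys after a round into those of the keys before it, although the keys themselves
are not moved back. -/
theorem wp_unsortProg (hE : Env w f m σ) {a : ℕ → ℕ} (φ : ℕ → ℕ)
    (hφ : ∀ i < 2 ^ m, φ (a i) < 2 ^ f)
    (h71 : σ.reg 71 = pk w (f + 1) (2 ^ m) (fun i => φ (netKeys m a m i)))
    (h72 : σ.reg 72 = pk w (f + 1) (2 ^ m) (netHist m a m)) :
    wp unsortProg (200 * (m + 1)) (fun σ' => Frame 70 σ σ' ∧
      σ'.reg 71 = pk w (f + 1) (2 ^ m) (fun i => φ (a i))) σ := by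
  have hq : 0 < f + 1 := by omega
  have hmw : m ≤ w := by have := hE.m_le; have := hE.width; omega
  refine wp_assign_seq (BitVec.ofNat w 0) rfl ?_ rfl (by simp [Expr.cost]; omega)
  refine wp_assign_seq (BitVec.ofNat w ((f + 1) * 2 ^ 0)) (by simp [hE.r7]) ?_ rfl
    (by simp [Expr.cost]; omega)
  refine wp_whileLt (T := 150) (k := m) (fun k σ' => ∃ j, j + k = m ∧ Frame 70 σ σ' ∧
      σ'.reg 71 = pk w (f + 1) (2 ^ m) (fun i => φ (netKeys m a k i)) ∧
      σ'.reg 72 = pk w (f + 1) (2 ^ m) (netHist m a m) ∧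
      σ'.reg 73 = BitVec.ofNat w j ∧ σ'.reg 74 = BitVec.ofNat w ((f + 1) * 2 ^ j)) ?_ ?_ ?_ ?_
  · refine ⟨0, by omega, ?_, ?_, ?_, ?_, ?_⟩
    · exact ((Frame.refl 70 σ).set (by decide)).set (by decide)
    all_goals simp [h71, h72]
  · rintro k σ' ⟨j, hj, hF, h1, h4, h2, h3⟩ hc
    obtain rfl : k = 0 := by
      simp only [Expr.eval_reg, h2, (hE.frame hF).r11, toNat_ofNat_of_le hmw,
        toNat_ofNat_of_le (show j ≤ w by omega)] at hc
      omega
    exact ⟨hF, h1⟩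
  · rintro k σ' ⟨j, hj, hF, h1, h4, h2, h3⟩ hc
    have hE' := hE.frame hF
    have hjm : j < m := by
      simpa only [Expr.eval_reg, h2, hE'.r11, toNat_ofNat_of_le hmw,
        toNat_ofNat_of_le (show j ≤ w by omega)] using hc
    obtain ⟨k, rfl⟩ : ∃ k', k = k' + 1 := ⟨k - 1, by omega⟩
    -- Rounds are undone in reverse order, hence with increasing distances: sorter round `k` had
    -- distance `2 ^ (m - 1 - k)`.
    obtain rfl : j = m - 1 - k := by omega
    have hD := toNat_ofNat_of_le (hE.lane_le hjm.le)
    have hk' := toNat_ofNat_of_le (show m - 1 - k ≤ w by omega)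
    have hlt : ∀ i < 2 ^ m, φ (netKeys m a (k + 1) i) < 2 ^ f := by
      have : ∀ j ≤ m, ∀ i < 2 ^ m, φ (netKeys m a j i) < 2 ^ f := by
        intro j
        induction j with
        | zero => exact fun _ => hφ
        | succ j ih =>
          exact fun hj i hi => ih (by omega) _ (exch_lt _ (two_pow_dvd_of_lt (by omega)) hi)
      exact this _ (by omega)
    have hc1 : ∀ i < 2 ^ m, (if netExch m a k i then lowLanes (m - 1 - k) i else 0) ≤ 1 :=
      fun i _ => by
        have := lowLanes_le (m - 1 - k) i
        split_ifs <;> omega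
    refine wp_assign_seq (pk w (f + 1) (2 ^ m) (fun i =>
      (if netExch m a k i then lowLanes (m - 1 - k) i else 0) * (2 ^ f - 1))) ?_ ?_
    · simp only [Expr.eval_and, Expr.eval_mul, Expr.eval_shr, Expr.eval_xor, Expr.eval_reg]
      simp only [h4, h2, hE'.r12, hE'.r13, hE'.r19, hk']
      have hmf := hE.m_le
      rw [pk_lowLanes (by omega) hE.fits', pk_inner_shr_and hq le_rfl hE.fits', ← pk_mask hc1]
      · congr 1
        refine pk_congr fun i _ => ?_
        have ht := testBit_netHist m a (le_refl m) hjm i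
        rw [show m - 1 - (m - 1 - k) = k by omega] at ht
        by_cases hb : i.testBit (m - 1 - k) = true
        · simp [lowLanes, hb]
        · simp only [lowLanes, hb, Bool.false_eq_true, if_false, Nat.and_one_is_mod]
          simp only [Nat.le_add_left, decide_true, Bool.true_and, hb, Bool.not_false] at ht
          rw [← ht, Nat.testBit_eq_decide_div_mod_eq, Nat.shiftRight_eq_div_pow]
          rcases Nat.mod_two_eq_zero_or_one (netHist m a m i / 2 ^ (m - 1 - k)) with h | h <;>
            simp [h]
      · intro i _
        have := lowLanes_le (m - 1 - k) i
        have := Nat.one_lt_two_pow (show f + 1 - (m - 1 - k) ≠ 0 by omega)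
        omega
    refine wp_assign_seq _ rfl ?_
    refine wp_assign_seq (pk w (f + 1) (2 ^ m) (fun i => φ (netKeys m a k i))) ?_ ?_
    · simp only [Expr.eval_and, Expr.eval_xor, Expr.eval_shr, Expr.eval_shl,
        Expr.eval_reg, State.set_reg]
      simp only [h1, h3, hE'.r20, hD, reduceIte, Nat.reduceEqDiff]
      rw [pk_exch hjm hE.fits' hlt rfl]
      exact pk_congr fun i _ => by rw [netKeys_succ, exch_exch]
    refine wp_assign_seq (BitVec.ofNat w (m - 1 - k + 1)) ?_ ?_
    · simp [h2, BitVec.ofNat_add]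
    refine wp_assign (BitVec.ofNat w ((f + 1) * 2 ^ (m - 1 - k + 1))) ?_ ?_
    · simp only [Expr.eval_add, Expr.eval_reg, State.set_reg]
      simp only [h3, reduceIte, Nat.reduceEqDiff]
      exact ofNat_lane_double _ _
    refine ⟨k, by omega, m - 1 - k + 1, by omega, ?_, by simp [h4]⟩
    repeat refine Frame.set ?_ (by decide)
    exact hF
  · simp only [Expr.cost]
    omega

end

end WordRAM

/-! ## Reversal of the lanes, combined with a change of the lane width -/

namespace WordRAM

theorem packNat_add (b n n' : ℕ) (v : ℕ → ℕ) :
    packNat b (n + n') v = 2 ^ (b * n) * packNat b n' (fun i => v (n + i)) + packNat b n v := by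
  induction n' with
  | zero => simp [packNat]
  | succ n' ih =>
    rw [← add_assoc, packNat_succ, ih, packNat_succ, mul_add, mul_add, pow_add]
    ring

theorem packNat_congr {b n : ℕ} {u v : ℕ → ℕ} (h : ∀ i < n, u i = v i) :
    packNat b n u = packNat b n v := by
  rw [packNat, packNat]
  exact Finset.sum_congr rfl fun i hi => by rw [h i (Finset.mem_range.1 hi)]

theorem packNat_indicator {b h : ℕ} (hb : 0 < b) (hh : 0 < h) {v : ℕ → ℕ} (h0 : v 0 = 1)
    (h1 : ∀ i < h, 0 < i → v i = 0) : packNat b h v = 1 := by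
  rw [packNat, Finset.sum_eq_single 0]
  · simp [h0, Nat.mod_eq_of_lt (Nat.one_lt_two_pow hb.ne')]
  · intro i hi h2
    simp [h1 i (Finset.mem_range.1 hi) (Nat.pos_of_ne_zero h2)]
  · simp [hh.ne']

/-- The `c`-th block of `2 ^ k` consecutive values, reversed and packed into lanes of `q` bits. -/
def revBlock (q : ℕ) (v : ℕ → ℕ) (k c : ℕ) : ℕ :=
  packNat q (2 ^ k) (fun i => v (c * 2 ^ k + (2 ^ k - 1 - i)))

theorem revBlock_lt (q : ℕ) (v : ℕ → ℕ) (k c : ℕ) : revBlock q v k c < 2 ^ (q * 2 ^ k) :=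
  packNat_lt _ _ _

theorem revBlock_zero {q : ℕ} {v : ℕ → ℕ} {c : ℕ} (h : v c < 2 ^ q) : revBlock q v 0 c = v c := by
  simp [revBlock, packNat, Nat.mod_eq_of_lt h]

/-- Reversing a block reverses both halves and exchanges them. The half that moves up lands at
offset `q * 2 ^ k`, independent of the old lane width; this is how the lanes get narrower at the
same time. -/
theorem revBlock_succ (q : ℕ) (v : ℕ → ℕ) (k c : ℕ) :
    revBlock q v (k + 1) c =
      revBlock q v k (2 * c + 1) ||| revBlock q v k (2 * c) * 2 ^ (q * 2 ^ k) := by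
  have h2 : 2 ^ (k + 1) = 2 ^ k + 2 ^ k := by ring
  rw [Nat.or_comm, mul_comm (revBlock q v k (2 * c)),
    ← Nat.two_pow_add_eq_or_of_lt (revBlock_lt _ _ _ _), revBlock, h2, packNat_add]
  congr 1
  · congr 1
    refine packNat_congr fun i hi => ?_
    congr 1
    rw [show c * (2 ^ k + 2 ^ k) = 2 * c * 2 ^ k by ring]
    omega
  · refine packNat_congr fun i hi => ?_
    congr 1
    rw [show (2 * c + 1) * 2 ^ k = c * (2 ^ k + 2 ^ k) + 2 ^ k by ring]
    omega

theorem pk_pair {w b n : ℕ} (hb : 0 < b) {v : ℕ → ℕ} (hv : ∀ i < n * 2, v i < 2 ^ b) :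
    pk w b (n * 2) v = pk w (b * 2) n (fun c => v (2 * c) + 2 ^ b * v (2 * c + 1)) := by
  rw [← pk_regroup hb (by omega)]
  refine pk_congr fun i hi => ?_
  simp only [packNat, Finset.sum_range_succ, Finset.sum_range_zero]
  rw [Nat.mod_eq_of_lt (hv _ (by omega)), Nat.mod_eq_of_lt (hv _ (by omega)), mul_comm i]
  simp [mul_comm]

/-- One round of the reversal exchanges the two halves of every block of `2 ^ (k + 1)` lanes. -/
theorem pk_revBlock_step {w p q k n : ℕ} (hq : 0 < q) (hpq : q ≤ p)
    (hw : p * 2 ^ k * 2 * n ≤ w) (v : ℕ → ℕ) {D M : BitVec w}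
    (hD : D = pk w (p * 2 ^ k) (n * 2) (revBlock q v k))
    (hM : M = pk w (p * 2 ^ k * 2) n (fun _ => 2 ^ (q * 2 ^ k) - 1)) :
    ((D >>> (p * 2 ^ k)) &&& M) ||| ((D &&& M) * BitVec.ofNat w (2 ^ (q * 2 ^ k))) =
      pk w (p * 2 ^ k * 2) n (revBlock q v (k + 1)) := by
  have hp0 : 0 < p * 2 ^ k := Nat.mul_pos (by omega) (by positivity)
  have hle : q * 2 ^ k ≤ p * 2 ^ k := Nat.mul_le_mul_right _ hpq
  have hpos : 0 < 2 ^ (q * 2 ^ k) := by positivity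
  have hpow : 2 ^ (q * 2 ^ k) ≤ 2 ^ (p * 2 ^ k) := Nat.pow_le_pow_right (by omega) hle
  have hpow2 : 2 ^ (p * 2 ^ k * 2) = 2 ^ (p * 2 ^ k) * 2 ^ (p * 2 ^ k) := by rw [← pow_add]; ring_nf
  have hpow3 : 2 ^ (p * 2 ^ k) ≤ 2 ^ (p * 2 ^ k * 2) := Nat.pow_le_pow_right (by omega) (by omega)
  -- In a pair of neighbouring blocks, the mask of `q * 2 ^ k` bits selects the lower one, whose
  -- content is right-justified.
  have hlow : ∀ x y : ℕ, x < 2 ^ (q * 2 ^ k) →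
      (x + 2 ^ (p * 2 ^ k) * y) &&& (2 ^ (q * 2 ^ k) - 1) = x := fun x y hx => by
    rw [Nat.and_two_pow_sub_one_eq_mod]
    obtain ⟨e, he⟩ := Nat.exists_eq_add_of_le hle
    rw [he, pow_add, mul_assoc, Nat.add_mul_mod_self_left, Nat.mod_eq_of_lt hx]
  rw [pk_pair hp0 fun i _ => (revBlock_lt q v k i).trans_le hpow] at hD
  rw [hD, hM, pk_inner_shr_and (by omega) le_rfl hw, pk_and (by omega), pk_mul, pk_or (by omega)]
  · refine pk_congr fun c _ => ?_
    rw [hlow _ _ (revBlock_lt _ _ _ _), revBlock_succ, Nat.shiftRight_eq_div_pow,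
      Nat.add_mul_div_left _ _ (by positivity),
      Nat.div_eq_of_lt ((revBlock_lt _ _ _ _).trans_le hpow), zero_add,
      and_two_pow_sub_one (revBlock_lt _ _ _ _)]
  · intro c _
    rw [hlow _ _ (revBlock_lt _ _ _ _)]
    exact (revBlock_lt _ _ _ _).trans_le (hpow.trans hpow3)
  · intro c _
    rw [hlow _ _ (revBlock_lt _ _ _ _), hpow2]
    exact Nat.mul_lt_mul_of_lt_of_le ((revBlock_lt _ _ _ _).trans_le hpow) hpow (by positivity)
  · intro c _
    rw [show p * 2 ^ k * 2 - p * 2 ^ k = p * 2 ^ k by omega]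
    omega

/-- A multiple of `2 ^ k` is a multiple of `2 ^ (k + 1)` iff its bit `k` vanishes. -/
theorem pk_multiples_step {w p n k : ℕ} (hk : k < p) (hw : p * n ≤ w) :
    (pk w p n fun i => if 2 ^ k ∣ i then 1 else 0) ^^^
      (((pk w p n fun i => i) >>> k) &&& pk w p n fun i => if 2 ^ k ∣ i then 1 else 0) =
    pk w p n fun i => if 2 ^ (k + 1) ∣ i then 1 else 0 := by
  rw [pk_inner_shr_and (by omega) le_rfl hw, pk_xor (by omega)]
  · refine pk_congr fun i _ => ?_
    by_cases h : 2 ^ k ∣ i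
    · obtain ⟨c, rfl⟩ := h
      have hd : 2 ^ (k + 1) ∣ 2 ^ k * c ↔ c % 2 = 0 := by
        rw [pow_succ, Nat.mul_dvd_mul_iff_left (by positivity), Nat.dvd_iff_mod_eq_zero]
      simp only [Nat.dvd_mul_right, if_true, Nat.shiftRight_eq_div_pow, Nat.and_one_is_mod, hd]
      rw [Nat.mul_div_cancel_left _ (by positivity)]
      rcases Nat.mod_two_eq_zero_or_one c with h | h <;> simp [h]
    · have : ¬ 2 ^ (k + 1) ∣ i := fun h' => h ((pow_dvd_pow 2 (by omega)).trans h')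
      simp [h, this]
  · intro i _
    have := Nat.one_lt_two_pow (show p - k ≠ 0 by omega)
    split_ifs <;> omega

theorem pk_multiples {w p n k : ℕ} (hp : 0 < p) :
    (pk w p (n * 2 ^ k) fun i => if 2 ^ k ∣ i then 1 else 0) = pk w (p * 2 ^ k) n fun _ => 1 := by
  rw [← pk_regroup hp (by positivity)]
  refine pk_congr fun i _ => packNat_indicator hp (by positivity) (by simp) fun l hl h0 => ?_
  rw [if_neg]
  rw [Nat.dvd_add_right (Nat.dvd_mul_left _ _)]
  exact Nat.not_dvd_of_pos_of_lt h0 hl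

open WordRAM.Expr in
/-- Moves the lanes of `2 f + 1` bits in register `71` to lanes of `f + 1` bits, in reverse
order. -/
def revProg : Program :=
  .assign 73 (const 0) ;;
  .assign 74 (reg 7) ;;
  .assign 75 (reg 8) ;;
  .assign 76 (reg 14) ;;
  .whileLt (reg 73) (reg 11)
    (.assign 76 (reg 76 ^^^ ((reg 15 >>> reg 73) &&& reg 76)) ;;
    .assign 77 (reg 76 * ((const 1 <<< reg 74) - const 1)) ;;
    .assign 71 (((reg 71 >>> reg 75) &&& reg 77) |||
      ((reg 71 &&& reg 77) * (const 1 <<< reg 74))) ;;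
    .assign 73 (reg 73 + const 1) ;;
    .assign 74 (reg 74 + reg 74) ;;
    .assign 75 (reg 75 + reg 75))

theorem wp_revProg {w f m : ℕ} {σ : State w} (hE : Env w f m σ) {v : ℕ → ℕ}
    (hv : ∀ i < 2 ^ m, v i < 2 ^ f) (h71 : σ.reg 71 = pk w (f + f + 1) (2 ^ m) v) :
    wp revProg (200 * (m + 1)) (fun σ' => Frame 70 σ σ' ∧
      σ'.reg 71 = pk w (f + 1) (2 ^ m) (fun i => v (2 ^ m - 1 - i))) σ := by
  have hmw : m ≤ w := by have := hE.m_le; have := hE.width; omega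
  have hf1 : 2 ^ f < 2 ^ (f + 1) := Nat.pow_lt_pow_right (by omega) (by omega)
  refine wp_assign_seq (BitVec.ofNat w 0) rfl ?_ rfl (by simp [Expr.cost]; omega)
  refine wp_assign_seq (BitVec.ofNat w ((f + 1) * 2 ^ 0)) (by simp [hE.r7]) ?_ rfl
    (by simp [Expr.cost]; omega)
  refine wp_assign_seq (BitVec.ofNat w ((f + f + 1) * 2 ^ 0)) (by simp [hE.r8]) ?_ rfl
    (by simp [Expr.cost]; omega)
  refine wp_assign_seq (pk w (f + f + 1) (2 ^ m) fun i => if 2 ^ 0 ∣ i then 1 else 0)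
    (by simp [hE.r14]) ?_ rfl (by simp [Expr.cost]; omega)
  refine wp_whileLt (T := 150) (k := m) (fun k σ' => ∃ j, j + k = m ∧ Frame 70 σ σ' ∧
      σ'.reg 71 = pk w ((f + f + 1) * 2 ^ j) (2 ^ k) (revBlock (f + 1) v j) ∧
      σ'.reg 73 = BitVec.ofNat w j ∧ σ'.reg 74 = BitVec.ofNat w ((f + 1) * 2 ^ j) ∧
      σ'.reg 75 = BitVec.ofNat w ((f + f + 1) * 2 ^ j) ∧
      σ'.reg 76 = pk w (f + f + 1) (2 ^ m) fun i => if 2 ^ j ∣ i then 1 else 0) ?_ ?_ ?_ ?_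
  · refine ⟨0, by omega, ?_, ?_, by simp⟩
    · repeat refine Frame.set ?_ (by decide)
      exact Frame.refl 70 σ
    · simp only [State.set_reg, Nat.reduceEqDiff, if_false, h71, pow_zero, mul_one]
      exact pk_congr fun i hi => (revBlock_zero ((hv i hi).trans hf1)).symm
  · rintro k σ' ⟨j, hj, hF, h1, h2, h3, h4, h5⟩ hc
    obtain rfl : j = m := by
      simp only [Expr.eval_reg, h2, (hE.frame hF).r11, toNat_ofNat_of_le hmw,
        toNat_ofNat_of_le (show j ≤ w by omega)] at hc
      omega
    obtain rfl : k = 0 := by omega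
    refine ⟨hF, ?_⟩
    -- A single wide lane is left, and its content is already the complete word of narrow lanes.
    rw [h1, pow_zero, pk_one]
    · simp [revBlock, pk]
    · exact (revBlock_lt _ _ _ _).trans_le
        (Nat.pow_le_pow_right (by omega) (Nat.mul_le_mul_right _ (by omega)))
  · rintro k σ' ⟨j, hj, hF, h1, h2, h3, h4, h5⟩ hc
    have hE' := hE.frame hF
    have hjm : j < m := by
      simpa only [Expr.eval_reg, h2, hE'.r11, toNat_ofNat_of_le hmw,
        toNat_ofNat_of_le (show j ≤ w by omega)] using hc
    obtain ⟨k, rfl⟩ : ∃ k', k = k' + 1 := ⟨k - 1, by omega⟩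
    have hD := toNat_ofNat_of_le (hE.lane_le hjm.le)
    have hD' := toNat_ofNat_of_le (hE.lane_le' hjm.le)
    have hj' := toNat_ofNat_of_le (show j ≤ w by omega)
    have hfit : (f + f + 1) * 2 ^ j * 2 * 2 ^ k ≤ w := by
      have := hE.fits
      rw [show m = j + 1 + k by omega, pow_add, pow_succ] at this
      simpa only [mul_assoc] using this
    -- The markers at multiples of `2 ^ (j + 1)` are ones in lanes of that many times the width. A
    -- multiplication turns them into the mask for the pairs of blocks.
    have hE2 : (pk w (f + f + 1) (2 ^ m) fun i => if 2 ^ (j + 1) ∣ i then 1 else 0) =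
        pk w ((f + f + 1) * 2 ^ j * 2) (2 ^ k) fun _ => 1 := by
      rw [show m = k + (j + 1) by omega, pow_add, pk_multiples (by omega), pow_succ, mul_assoc]
    have hpos : 0 < 2 ^ ((f + 1) * 2 ^ j) := by positivity
    have hlt : 2 ^ ((f + 1) * 2 ^ j) ≤ 2 ^ ((f + f + 1) * 2 ^ j * 2) :=
      Nat.pow_le_pow_right (by omega)
        ((Nat.mul_le_mul_right (2 ^ j) (show f + 1 ≤ f + f + 1 by omega)).trans (by omega))
    refine wp_assign_seq
      (pk w (f + f + 1) (2 ^ m) fun i => if 2 ^ (j + 1) ∣ i then 1 else 0) ?_ ?_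
    · simp only [Expr.eval_and, Expr.eval_shr, Expr.eval_xor, Expr.eval_reg]
      simp only [h5, h2, hE'.r15, hj']
      exact pk_multiples_step (by have := hE.m_le; omega) hE.fits
    refine wp_assign_seq
      (pk w ((f + f + 1) * 2 ^ j * 2) (2 ^ k) fun _ => 2 ^ ((f + 1) * 2 ^ j) - 1) ?_ ?_
    · simp only [Expr.eval_mul, Expr.eval_sub, Expr.eval_shl, Expr.eval_const, Expr.eval_reg,
        State.set_reg]
      simp only [h3, hD, hE2, reduceIte, Nat.reduceEqDiff]
      rw [one_shl, ofNat_sub_ofNat hpos, pk_mul]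
      · exact pk_congr fun i _ => one_mul _
      · exact fun i _ => Nat.one_lt_two_pow (by positivity)
      · intro i _
        omega
    refine wp_assign_seq
      (pk w ((f + f + 1) * 2 ^ j * 2) (2 ^ k) (revBlock (f + 1) v (j + 1))) ?_ ?_
    · simp only [Expr.eval_mul, Expr.eval_and, Expr.eval_or, Expr.eval_shr, Expr.eval_shl,
        Expr.eval_const, Expr.eval_reg, State.set_reg]
      simp only [h1, h3, h4, hD, hD', reduceIte, Nat.reduceEqDiff]
      rw [one_shl]
      exact pk_revBlock_step (by omega) (by omega) hfit v (by rw [pow_succ]) rfl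
    refine wp_assign_seq (BitVec.ofNat w (j + 1)) ?_ ?_
    · simp [h2, BitVec.ofNat_add]
    refine wp_assign_seq (BitVec.ofNat w ((f + 1) * 2 ^ (j + 1))) ?_ ?_
    · simp only [Expr.eval_add, Expr.eval_reg, State.set_reg]
      simp only [h3, reduceIte, Nat.reduceEqDiff]
      exact ofNat_lane_double _ _
    refine wp_assign (BitVec.ofNat w ((f + f + 1) * 2 ^ (j + 1))) ?_ ?_
    · simp only [Expr.eval_add, Expr.eval_reg, State.set_reg]
      simp only [h4, reduceIte, Nat.reduceEqDiff]
      exact ofNat_lane_double _ _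
    refine ⟨k, by omega, j + 1, by omega, ?_, ?_⟩
    · repeat refine Frame.set ?_ (by decide)
      exact hF
    · simp [pow_succ, mul_assoc]
  · simp only [Expr.cost]
    omega

end WordRAM

/-! ## Lookup of a block of sorted keys in a block of sorted pairs -/

namespace WordRAM

theorem gather_lt {a p : ℕ → ℕ} {n f : ℕ} (hp : ∀ i < n, p i < 2 ^ f) (κ : ℕ) :
    gather a p κ n < 2 ^ f := by
  have h0 : 0 < 2 ^ f := by positivity
  have : ∀ k ≤ n, gather a p κ k < 2 ^ f := by
    intro k
    induction k with
    | zero => exact fun _ => h0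
    | succ k ih =>
      intro hk
      refine Nat.or_lt_two_pow (ih (by omega)) ?_
      split_ifs
      · exact hp _ (by omega)
      · exact h0
  exact this n le_rfl

theorem exists_netKeys_eq {m : ℕ} {a : ℕ → ℕ} {i : ℕ} (hi : i < 2 ^ m) :
    ∃ i' < 2 ^ m, netKeys m a m i = a i' := by
  have := (exists_net (a := a) (p := a) (le_refl m) (fun x _ => netKeys m a m i = x)).1 ⟨i, hi, rfl⟩
  exact this

/-- The sorted blocks `KA`, `KB` of the merged keys and the payload that propagates along runs of
equal keys, including the run that may cross from `KA` to `KB`. -/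
theorem spread_eq_gather {m : ℕ} {a b pb : ℕ → ℕ}
    (ha : ∀ i j, i ≤ j → j < 2 ^ m → a i ≤ a j) (hb : ∀ i j, i ≤ j → j < 2 ^ m → b j ≤ b i)
    {a₁ b₁ pa₁ pb₁ KA KB PA PB : ℕ → ℕ}
    (ea : a₁ = fun i => min (a i) (b i)) (eb : b₁ = fun i => max (a i) (b i))
    (epa : pa₁ = fun i => if b i ≤ a i then pb i else 0)
    (epb : pb₁ = fun i => if b i ≤ a i then 0 else pb i)
    (eKA : KA = netKeys m a₁ m) (eKB : KB = netKeys m b₁ m)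
    (ePA : PA = spread (2 ^ m) KA (netPay m a₁ pa₁ m) m)
    (ePB : PB = spread (2 ^ m) KB (netPay m b₁ pb₁ m) m) {i : ℕ} (hi : i < 2 ^ m) :
    PA i ||| (if KB 0 ≤ KA i then PB 0 else 0) = gather b pb (KA i) (2 ^ m) ∧
    PB i ||| (if KB i ≤ KA (2 ^ m - 1) then PA (2 ^ m - 1) else 0) =
      gather b pb (KB i) (2 ^ m) := by
  have h0 : 0 < 2 ^ m := by positivity
  have mA : ∀ i j, i ≤ j → j < 2 ^ m → KA i ≤ KA j := fun i j h1 h2 => by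
    rw [eKA]; exact netKeys_monotone (ea ▸ bitonicBlocks_min ha hb) h1 h2
  have mB : ∀ i j, i ≤ j → j < 2 ^ m → KB i ≤ KB j := fun i j h1 h2 => by
    rw [eKB]; exact netKeys_monotone (eb ▸ bitonicBlocks_max ha hb) h1 h2
  -- Every lower key is at most every upper key: with `i' ≤ j'` compare along the increasing `a`,
  -- otherwise along the decreasing `b`.
  have hAB : ∀ i < 2 ^ m, ∀ j < 2 ^ m, KA i ≤ KB j := fun i hi j hj => by
    obtain ⟨i', hi', e1⟩ := exists_netKeys_eq (a := a₁) hi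
    obtain ⟨j', hj', e2⟩ := exists_netKeys_eq (a := b₁) hj
    rw [eKA, eKB, e1, e2, ea, eb]
    rcases le_total i' j' with h | h
    · have := ha i' j' h hj'
      simp only
      omega
    · have := hb j' i' h hi'
      simp only
      omega
  -- Each pair of `b` went with its payload to one of the two words, and entries of `a` carry
  -- payload `0`. Hence the hits for `κ` are those in the lower word together with those in the
  -- upper one.
  have main : ∀ κ t, (∃ j < 2 ^ m, b j = κ ∧ (pb j).testBit t = true) ↔
      (∃ j < 2 ^ m, KA j = κ ∧ (netPay m a₁ pa₁ m j).testBit t = true) ∨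
      (∃ j < 2 ^ m, KB j = κ ∧ (netPay m b₁ pb₁ m j).testBit t = true) := by
    intro κ t
    rw [eKA, eKB, exists_net le_rfl (fun x y => x = κ ∧ y.testBit t = true),
      exists_net le_rfl (fun x y => x = κ ∧ y.testBit t = true), ea, eb, epa, epb]
    constructor
    · rintro ⟨j, hj, h1, h2⟩
      by_cases hc : b j ≤ a j
      · left
        refine ⟨j, hj, ?_, ?_⟩
        · simp only; omega
        · simp only [hc, if_true, h2]
      · right
        refine ⟨j, hj, ?_, ?_⟩
        · simp only; omega
        · simp only [hc, if_false, h2]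
    · rintro (⟨j, hj, h1, h2⟩ | ⟨j, hj, h1, h2⟩) <;> simp only at h1 h2 <;> split_ifs at h2 with hc
      · exact ⟨j, hj, by omega, h2⟩
      · simp at h2
      · simp at h2
      · exact ⟨j, hj, by omega, h2⟩
  -- After `m` rounds the range of propagation covers all `2 ^ m` lanes.
  have sA : ∀ t, ∀ i < 2 ^ m, (PA i).testBit t = true ↔
      ∃ j < 2 ^ m, KA j = KA i ∧ (netPay m a₁ pa₁ m j).testBit t = true := fun t i hi => by
    rw [ePA, testBit_spread mA _ _ _ hi]
    constructor
    · rintro ⟨j, hj, -, -, h⟩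
      exact ⟨j, hj, h⟩
    · rintro ⟨j, hj, h⟩
      exact ⟨j, hj, by omega, by omega, h⟩
  have sB : ∀ t, ∀ i < 2 ^ m, (PB i).testBit t = true ↔
      ∃ j < 2 ^ m, KB j = KB i ∧ (netPay m b₁ pb₁ m j).testBit t = true := fun t i hi => by
    rw [ePB, testBit_spread mB _ _ _ hi]
    constructor
    · rintro ⟨j, hj, -, -, h⟩
      exact ⟨j, hj, h⟩
    · rintro ⟨j, hj, h⟩
      exact ⟨j, hj, by omega, by omega, h⟩
  constructor
  · refine Nat.eq_of_testBit_eq fun t => ?_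
    rw [Bool.eq_iff_iff, testBit_gather, main, Nat.testBit_or, Bool.or_eq_true, sA t i hi]
    refine or_congr Iff.rfl ?_
    have e0 := hAB i hi 0 h0
    constructor
    · intro h
      split_ifs at h with hc
      · obtain ⟨j, hj, h1, h2⟩ := (sB t 0 h0).1 h
        exact ⟨j, hj, by omega, h2⟩
      · simp at h
    · rintro ⟨j, hj, h1, h2⟩
      -- A lower key that also occurs in the upper word equals its smallest key, so lane `0` already
      -- knows the whole upper part of the run.
      have := mB 0 j (by omega) hj
      rw [if_pos (by omega), sB t 0 h0]
      exact ⟨j, hj, by omega, h2⟩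
  · refine Nat.eq_of_testBit_eq fun t => ?_
    rw [Bool.eq_iff_iff, testBit_gather, main, Nat.testBit_or, Bool.or_eq_true, sB t i hi, or_comm]
    refine or_congr ?_ Iff.rfl
    have e0 := hAB (2 ^ m - 1) (by omega) i hi
    constructor
    · intro h
      split_ifs at h with hc
      · obtain ⟨j, hj, h1, h2⟩ := (sA t _ (by omega)).1 h
        exact ⟨j, hj, by omega, h2⟩
      · simp at h
    · rintro ⟨j, hj, h1, h2⟩
      have := mA j (2 ^ m - 1) (by omega) (by omega)
      rw [if_pos (by omega), sA t _ (by omega)]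
      exact ⟨j, hj, by omega, h2⟩

theorem gather_reverse (a p : ℕ → ℕ) (κ n : ℕ) :
    gather (fun i => a (n - 1 - i)) (fun i => p (n - 1 - i)) κ n = gather a p κ n := by
  refine Nat.eq_of_testBit_eq fun t => ?_
  rw [Bool.eq_iff_iff, testBit_gather, testBit_gather]
  constructor
  · rintro ⟨j, hj, h⟩
    exact ⟨n - 1 - j, by omega, h⟩
  · rintro ⟨j, hj, h⟩
    exact ⟨n - 1 - j, by omega, by simpa only [show n - 1 - (n - 1 - j) = j by omega] using h⟩

/-- Branch-free choice: adding the masked difference `u ^^^ v` to `u` gives `v` where the mask is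
set. -/
theorem pk_select {w f n : ℕ} {u v : ℕ → ℕ} {c : ℕ → Prop} [DecidablePred c]
    (hu : ∀ i < n, u i < 2 ^ f) (hv : ∀ i < n, v i < 2 ^ f) :
    pk w (f + 1) n u ^^^ ((pk w (f + 1) n u ^^^ pk w (f + 1) n v) &&&
      pk w (f + 1) n (fun i => (if c i then 1 else 0) * (2 ^ f - 1))) =
    pk w (f + 1) n (fun i => if c i then v i else u i) := by
  rw [pk_xor (by omega), pk_and (by omega), pk_xor (by omega)]
  refine pk_congr fun i hi => ?_
  split_ifs with h
  · rw [one_mul, and_two_pow_sub_one (Nat.xor_lt_two_pow (hu i hi) (hv i hi)), ← Nat.xor_assoc,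
      Nat.xor_self, Nat.zero_xor]
  · simp

open WordRAM.Expr in
/-- The mask of the lanes in which the key of `a` is at least that of `b`. -/
def geMask (a b : Expr) : Expr :=
  ((((a + reg 21) - b) >>> reg 1) &&& reg 12) * reg 19

theorem eval_geMask {w f m : ℕ} {σ : State w} {x y : Expr} {a b : ℕ → ℕ} (hE : Env w f m σ)
    (ha : ∀ i < 2 ^ m, a i < 2 ^ f) (hb : ∀ i < 2 ^ m, b i < 2 ^ f)
    (hx : x.eval σ = pk w (f + 1) (2 ^ m) a) (hy : y.eval σ = pk w (f + 1) (2 ^ m) b) :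
    (geMask x y).eval σ =
      pk w (f + 1) (2 ^ m) (fun i => (if b i ≤ a i then 1 else 0) * (2 ^ f - 1)) := by
  have hf' := toNat_ofNat_of_le (show f ≤ w by have := hE.width; omega)
  simp only [geMask, Expr.eval_and, Expr.eval_mul, Expr.eval_shr, Expr.eval_sub, Expr.eval_add,
    Expr.eval_reg, hx, hy, hE.r21, hE.r1, hE.r12, hE.r19, hf']
  rw [pk_compare hE.fits' ha hb, pk_mask]
  · intro i hi; split_ifs <;> omega
  · exact fun i _ => le_rfl

theorem pk_top {w b n : ℕ} {v : ℕ → ℕ} (hb : 0 < b) (hn : 0 < n) (hw : b * n ≤ w)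
    (hv : v (n - 1) < 2 ^ b) :
    pk w b n v >>> (b * (n - 1)) = BitVec.ofNat w (v (n - 1)) := by
  rw [pk_shr hb hw, pk, packNat, Finset.sum_eq_single 0]
  · simp [show n - 1 < n by omega, Nat.mod_eq_of_lt hv]
  · intro i _ h0
    simp [show ¬ i + (n - 1) < n by omega]
  · simp [hn.ne']

theorem pk_bottom {w f n : ℕ} {v : ℕ → ℕ} (hn : 0 < n) (hv : v 0 < 2 ^ f) :
    pk w (f + 1) n v &&& BitVec.ofNat w (2 ^ f - 1) = BitVec.ofNat w (v 0) := by
  have h2 : 2 ^ (f + 1) = 2 * 2 ^ f := by rw [pow_succ, mul_comm]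
  have e : BitVec.ofNat w (2 ^ f - 1) = pk w (f + 1) 1 (fun _ => 2 ^ f - 1) :=
    (pk_one (v := fun _ => 2 ^ f - 1) (by omega)).symm
  rw [e, pk_and_of_le (by omega) hn, pk_one]
  · rw [and_two_pow_sub_one hv]
  · rw [and_two_pow_sub_one hv]
    omega

theorem pk_broadcast {w b n c : ℕ} (hb : 0 < b) (hc : c < 2 ^ b) :
    (pk w b n fun _ => 1) * BitVec.ofNat w c = pk w b n fun _ => c := by
  rw [pk_mul (fun _ _ => Nat.one_lt_two_pow hb.ne') (fun _ _ => by rwa [one_mul])]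
  exact pk_congr fun _ _ => one_mul c

open WordRAM.Expr in
/-- For the sorted keys in register `50` and the sorted pairs with keys in register `51` and values
in register `52` (in lanes of `2 f + 1` bits), leaves the values of the keys in register `59`. -/
def lookupProg : Program :=
  .assign 71 (reg 51) ;; revProg ;; .assign 51 (reg 71) ;;
  .assign 71 (reg 52) ;; revProg ;;
  .assign 52 (reg 71) ;;
  .assign 53 (geMask (reg 50) (reg 51)) ;;
  .assign 70 (reg 50 ^^^ ((reg 50 ^^^ reg 51) &&& reg 53)) ;;
  .assign 54 (reg 51 ^^^ ((reg 51 ^^^ reg 50) &&& reg 53)) ;;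
  .assign 71 (const 0 ^^^ ((const 0 ^^^ reg 52) &&& reg 53)) ;;
  .assign 55 (reg 52 ^^^ ((reg 52 ^^^ const 0) &&& reg 53)) ;;
  sortProg ;; .assign 61 (reg 72) ;; spreadProg ;;
  .assign 56 (reg 70) ;; .assign 57 (reg 71) ;;
  .assign 70 (reg 54) ;; .assign 71 (reg 55) ;;
  sortProg ;; .assign 62 (reg 72) ;; spreadProg ;;
  .assign 63 (reg 56 >>> (reg 17 - reg 7)) ;;
  .assign 64 (reg 57 >>> (reg 17 - reg 7)) ;;
  .assign 65 (reg 70 &&& reg 19) ;;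
  .assign 66 (reg 71 &&& reg 19) ;;
  .assign 71 (reg 71 ||| (geMask (reg 12 * reg 63) (reg 70) &&& (reg 12 * reg 64))) ;;
  .assign 57 (reg 57 ||| (geMask (reg 56) (reg 12 * reg 65) &&& (reg 12 * reg 66))) ;;
  .assign 72 (reg 62) ;;
  unsortProg ;;
  .assign 58 (reg 71) ;; .assign 71 (reg 57) ;; .assign 72 (reg 61) ;;
  unsortProg ;;
  .assign 59 (reg 71 ^^^ ((reg 71 ^^^ reg 58) &&& reg 53))

-- Register `53` remembers which word received the argument of each lane. The time consists of eight
-- passes, namely reversal, sorting, spreading and unsorting for two words each, of at most `200 *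
-- (m + 1)` steps, and boundedly many single operations.
set_option maxHeartbeats 1000000 in
theorem wp_lookupProg {w f m : ℕ} {σ : State w} (hE : Env w f m σ) {a z v : ℕ → ℕ}
    (ha : ∀ i < 2 ^ m, a i < 2 ^ f) (hz : ∀ i < 2 ^ m, z i < 2 ^ f) (hv : ∀ i < 2 ^ m, v i < 2 ^ f)
    (ma : ∀ i j, i ≤ j → j < 2 ^ m → a i ≤ a j) (mz : ∀ i j, i ≤ j → j < 2 ^ m → z i ≤ z j)
    (h50 : σ.reg 50 = pk w (f + 1) (2 ^ m) a) (h51 : σ.reg 51 = pk w (f + f + 1) (2 ^ m) z)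
    (h52 : σ.reg 52 = pk w (f + f + 1) (2 ^ m) v) :
    wp lookupProg (3000 * (m + 1)) (fun σ' => Frame 50 σ σ' ∧
      σ'.reg 59 = pk w (f + 1) (2 ^ m) (fun i => gather z v (a i) (2 ^ m))) σ := by
  have hq : 0 < f + 1 := by omega
  have h0 : 0 < 2 ^ m := by positivity
  have hf0 : 0 < 2 ^ f := by positivity
  have h2 : 2 ^ (f + 1) = 2 * 2 ^ f := by rw [pow_succ, mul_comm]
  obtain ⟨b, eb⟩ : ∃ b : ℕ → ℕ, b = fun i => z (2 ^ m - 1 - i) := ⟨_, rfl⟩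
  obtain ⟨pb, epb⟩ : ∃ b : ℕ → ℕ, b = fun i => v (2 ^ m - 1 - i) := ⟨_, rfl⟩
  have hb : ∀ i < 2 ^ m, b i < 2 ^ f := fun i hi => by rw [eb]; exact hz _ (by omega)
  have hpb : ∀ i < 2 ^ m, pb i < 2 ^ f := fun i hi => by rw [epb]; exact hv _ (by omega)
  have mb : ∀ i j, i ≤ j → j < 2 ^ m → b j ≤ b i := fun i j h1 h2 => by
    rw [eb]; exact mz _ _ (by omega) (by omega)
  obtain ⟨a₁, ea₁⟩ : ∃ c : ℕ → ℕ, c = fun i => min (a i) (b i) := ⟨_, rfl⟩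
  obtain ⟨b₁, eb₁⟩ : ∃ c : ℕ → ℕ, c = fun i => max (a i) (b i) := ⟨_, rfl⟩
  obtain ⟨pa₁, epa₁⟩ : ∃ c : ℕ → ℕ, c = fun i => if b i ≤ a i then pb i else 0 := ⟨_, rfl⟩
  obtain ⟨pb₁, epb₁⟩ : ∃ c : ℕ → ℕ, c = fun i => if b i ≤ a i then 0 else pb i := ⟨_, rfl⟩
  have ha₁ : ∀ i < 2 ^ m, a₁ i < 2 ^ f := fun i hi => by
    rw [ea₁]; exact (min_le_left _ _).trans_lt (ha i hi)
  have hb₁ : ∀ i < 2 ^ m, b₁ i < 2 ^ f := fun i hi => by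
    rw [eb₁]; exact max_lt (ha i hi) (hb i hi)
  have hpa₁ : ∀ i < 2 ^ m, pa₁ i < 2 ^ f := fun i hi => by
    have := hpb i hi
    simp only [epa₁]
    split_ifs <;> omega
  have hpb₁ : ∀ i < 2 ^ m, pb₁ i < 2 ^ f := fun i hi => by
    have := hpb i hi
    simp only [epb₁]
    split_ifs <;> omega
  have main := fun i hi =>
    spread_eq_gather (pb := pb) ma mb ea₁ eb₁ epa₁ epb₁ rfl rfl rfl rfl (i := i) hi
  obtain ⟨KA, eKA⟩ : ∃ c : ℕ → ℕ, c = netKeys m a₁ m := ⟨_, rfl⟩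
  obtain ⟨KB, eKB⟩ : ∃ c : ℕ → ℕ, c = netKeys m b₁ m := ⟨_, rfl⟩
  obtain ⟨PA, ePA⟩ : ∃ c : ℕ → ℕ, c = spread (2 ^ m) KA (netPay m a₁ pa₁ m) m := ⟨_, rfl⟩
  obtain ⟨PB, ePB⟩ : ∃ c : ℕ → ℕ, c = spread (2 ^ m) KB (netPay m b₁ pb₁ m) m := ⟨_, rfl⟩
  rw [← eKA, ← eKB, ← ePA, ← ePB] at main
  have hKA : ∀ i < 2 ^ m, KA i < 2 ^ f := eKA ▸ netKeys_lt ha₁ le_rfl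
  have hKB : ∀ i < 2 ^ m, KB i < 2 ^ f := eKB ▸ netKeys_lt hb₁ le_rfl
  have hPA : ∀ i < 2 ^ m, PA i < 2 ^ f := ePA ▸ spread_lt (netPay_lt hpa₁ le_rfl) m
  have hPB : ∀ i < 2 ^ m, PB i < 2 ^ f := ePB ▸ spread_lt (netPay_lt hpb₁ le_rfl) m
  -- Once the crossing run is repaired, the payload depends on the key only, as unsorting requires.
  obtain ⟨φ, eφ⟩ : ∃ φ : ℕ → ℕ, φ = fun κ => gather b pb κ (2 ^ m) := ⟨_, rfl⟩
  have hφ : ∀ κ, φ κ < 2 ^ f := fun κ => by rw [eφ]; exact gather_lt hpb κ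
  have hn1 := toNat_ofNat_of_le
    ((Nat.mul_le_mul_left (f + 1) (show 2 ^ m - 1 ≤ 2 ^ m by omega)).trans hE.fits')
  have htop : BitVec.ofNat w ((f + 1) * 2 ^ m) - BitVec.ofNat w (f + 1) =
      BitVec.ofNat w ((f + 1) * (2 ^ m - 1)) := by
    rw [ofNat_sub_ofNat (Nat.le_mul_of_pos_right _ h0), Nat.mul_sub_one]
  -- reversal
  refine wp_assign_seq _ h51 ?_ rfl (by simp; omega)
  have F0 : Frame 50 σ (σ.set 71 (pk w (f + f + 1) (2 ^ m) z)) := (Frame.refl 50 σ).set (by decide)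
  refine wp_run_seq (2600 * (m + 1)) (wp_revProg (hE.frame F0) hz (by simp)) ?_ (by simp; omega)
  rintro σ₁ ⟨F₁, h₁⟩
  have g50 : σ₁.reg 50 = pk w (f + 1) (2 ^ m) a := by rw [F₁.reg 50 (by decide)]; simp [h50]
  have g52 : σ₁.reg 52 = pk w (f + f + 1) (2 ^ m) v := by rw [F₁.reg 52 (by decide)]; simp [h52]
  replace F₁ := F0.trans (F₁.mono (by decide))
  clear F0
  rw [← eb] at h₁
  refine wp_assign_seq _ h₁ ?_ rfl (by simp; omega)
  refine wp_assign_seq (pk w (f + f + 1) (2 ^ m) v) (by simp [g52]) ?_ rfl (by simp; omega)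
  refine wp_run_seq (2300 * (m + 1)) (wp_revProg
    ((hE.frame F₁).frame (((Frame.refl 50 _).set (by decide)).set
    (by decide))) hv (by simp)) ?_ (by simp; omega)
  rintro σ₂ ⟨F₂, h₂⟩
  have k50 : σ₂.reg 50 = pk w (f + 1) (2 ^ m) a := by rw [F₂.reg 50 (by decide)]; simp [g50]
  have k51 : σ₂.reg 51 = pk w (f + 1) (2 ^ m) b := by rw [F₂.reg 51 (by decide)]; simp
  replace F₂ : Frame 50 σ σ₂ :=
    ((F₁.set (by decide)).set (by decide)).trans (F₂.mono (by decide))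
  clear F₁ g50 g52 h₁
  rw [← epb] at h₂
  have hE₂ := hE.frame F₂
  -- the first half cleaner
  refine wp_assign_seq _ h₂ ?_ rfl (by simp; omega)
  refine wp_assign_seq _ (eval_geMask (hE₂.frame ((Frame.refl 50 _).set (by decide))) ha hb
    (by simp [k50]) (by simp [k51])) ?_ rfl (by simp [geMask]; omega)
  refine wp_assign_seq (pk w (f + 1) (2 ^ m) a₁) ?_ ?_ rfl (by simp [geMask]; omega)
  · simp only [Expr.eval_xor, Expr.eval_and, Expr.eval_reg, State.set_reg]
    simp only [k50, k51, reduceIte, Nat.reduceEqDiff]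
    rw [pk_select ha hb]
    refine pk_congr fun i _ => ?_
    rw [ea₁]
    simp only
    split_ifs <;> omega
  refine wp_assign_seq (pk w (f + 1) (2 ^ m) b₁) ?_ ?_ rfl (by simp [geMask]; omega)
  · simp only [Expr.eval_xor, Expr.eval_and, Expr.eval_reg, State.set_reg]
    simp only [k50, k51, reduceIte, Nat.reduceEqDiff]
    rw [pk_select hb ha]
    refine pk_congr fun i _ => ?_
    rw [eb₁]
    simp only
    split_ifs <;> omega
  have ez : BitVec.ofNat w 0 = pk w (f + 1) (2 ^ m) fun _ => 0 := pk_zero.symm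
  refine wp_assign_seq (pk w (f + 1) (2 ^ m) pa₁) ?_ ?_ rfl (by simp [geMask]; omega)
  · simp only [Expr.eval_xor, Expr.eval_and, Expr.eval_reg, State.set_reg, Expr.eval_const]
    simp only [reduceIte, Nat.reduceEqDiff]
    rw [ez, pk_select (fun _ _ => hf0) hpb, epa₁]
  refine wp_assign_seq (pk w (f + 1) (2 ^ m) pb₁) ?_ ?_ rfl (by simp [geMask]; omega)
  · simp only [Expr.eval_xor, Expr.eval_and, Expr.eval_reg, State.set_reg, Expr.eval_const]
    simp only [reduceIte, Nat.reduceEqDiff]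
    rw [ez, pk_select hpb (fun _ _ => hf0), epb₁]
  -- sorting and spreading in the lower half
  refine wp_run_seq (1950 * (m + 1)) (wp_sortProg (a := a₁) (p := pa₁)
    (hE₂.frame (b := 50) ?_) ha₁ hpa₁ (by simp)
    (by simp)) ?_ (by simp [geMask]; omega)
  · repeat refine Frame.set ?_ (by decide)
    exact Frame.refl 50 _
  rintro σ₃ ⟨F₃, q70, q71, q72⟩
  have k53 := F₃.reg 53 (by decide)
  have k54 := F₃.reg 54 (by decide)
  have k55 := F₃.reg 55 (by decide)
  simp only [State.set_reg, reduceIte, Nat.reduceEqDiff] at k53 k54 k55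
  replace F₃ : Frame 50 σ σ₃ := by
    refine Frame.trans ?_ (F₃.mono (by decide))
    repeat refine Frame.set ?_ (by decide)
    exact F₂
  clear F₂ hE₂ k50 k51 h₂
  rw [← eKA] at q70
  refine wp_assign_seq _ q72 ?_ rfl (by simp; omega)
  refine wp_run_seq (1650 * (m + 1)) (wp_spreadProg (hE.frame (F₃.set (by decide))) hKA
    (netPay_lt (a := a₁) hpa₁ le_rfl) (by simp [q70]) (by simp [q71])) ?_ (by simp; omega)
  rintro σ₄ ⟨F₄, p71⟩
  have p53 := F₄.reg 53 (by decide)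
  have p54 := F₄.reg 54 (by decide)
  have p55 := F₄.reg 55 (by decide)
  have p61 := F₄.reg 61 (by decide)
  have p70 := F₄.reg 70 (by decide)
  simp only [State.set_reg, reduceIte, Nat.reduceEqDiff, k53, k54, k55, q70]
    at p53 p54 p55 p61 p70
  replace F₄ : Frame 50 σ σ₄ := (F₃.set (by decide)).trans (F₄.mono (by decide))
  clear F₃ k53 k54 k55 q70 q71 q72
  rw [← ePA] at p71
  -- the upper half
  refine wp_assign_seq _ p70 ?_ rfl (by simp; omega)
  refine wp_assign_seq (pk w (f + 1) (2 ^ m) PA) (by simp [p71]) ?_ rfl (by simp; omega)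
  refine wp_assign_seq (pk w (f + 1) (2 ^ m) b₁) (by simp [p54]) ?_ rfl (by simp; omega)
  refine wp_assign_seq (pk w (f + 1) (2 ^ m) pb₁) (by simp [p55]) ?_ rfl (by simp; omega)
  refine wp_run_seq (1400 * (m + 1)) (wp_sortProg (a := b₁) (p := pb₁)
    (hE.frame (b := 50) ?_) hb₁ hpb₁ (by simp)
    (by simp)) ?_ (by simp; omega)
  · repeat refine Frame.set ?_ (by decide)
    exact F₄
  rintro σ₅ ⟨F₅, q70, q71, q72⟩
  have k53 := F₅.reg 53 (by decide)
  have k56 := F₅.reg 56 (by decide)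
  have k57 := F₅.reg 57 (by decide)
  have k61 := F₅.reg 61 (by decide)
  simp only [State.set_reg, reduceIte, Nat.reduceEqDiff, p53, p61] at k53 k56 k57 k61
  replace F₅ : Frame 50 σ σ₅ := by
    refine Frame.trans ?_ (F₅.mono (by decide))
    repeat refine Frame.set ?_ (by decide)
    exact F₄
  clear F₄ p53 p54 p55 p61 p70 p71
  rw [← eKB] at q70
  refine wp_assign_seq _ q72 ?_ rfl (by simp; omega)
  refine wp_run_seq (1100 * (m + 1)) (wp_spreadProg (hE.frame (F₅.set (by decide))) hKB
    (netPay_lt (a := b₁) hpb₁ le_rfl) (by simp [q70]) (by simp [q71])) ?_ (by simp; omega)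
  rintro σ₆ ⟨F₆, p71⟩
  have p53 := F₆.reg 53 (by decide)
  have p56 := F₆.reg 56 (by decide)
  have p57 := F₆.reg 57 (by decide)
  have p61 := F₆.reg 61 (by decide)
  have p62 := F₆.reg 62 (by decide)
  have p70 := F₆.reg 70 (by decide)
  simp only [State.set_reg, reduceIte, Nat.reduceEqDiff, k53, k56, k57, k61, q70]
    at p53 p56 p57 p61 p62 p70
  replace F₆ : Frame 50 σ σ₆ := (F₅.set (by decide)).trans (F₆.mono (by decide))
  clear F₅ k53 k56 k57 k61 q70 q71 q72
  rw [← ePB] at p71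
  have hE₆ := hE.frame F₆
  -- the run that crosses from the lower to the upper half
  refine wp_assign_seq (BitVec.ofNat w (KA (2 ^ m - 1))) ?_ ?_ rfl (by simp; omega)
  · simp only [Expr.eval_shr, Expr.eval_sub, Expr.eval_reg, hE₆.r17, hE₆.r7, htop, hn1, p56]
    exact pk_top hq h0 hE.fits' ((hKA _ (by omega)).trans (by omega))
  refine wp_assign_seq (BitVec.ofNat w (PA (2 ^ m - 1))) ?_ ?_ rfl (by simp; omega)
  · simp only [Expr.eval_shr, Expr.eval_sub, Expr.eval_reg, State.set_reg]
    simp only [reduceIte, Nat.reduceEqDiff, hE₆.r17, hE₆.r7, htop, hn1, p57]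
    exact pk_top hq h0 hE.fits' ((hPA _ (by omega)).trans (by omega))
  refine wp_assign_seq (BitVec.ofNat w (KB 0)) ?_ ?_ rfl (by simp; omega)
  · simp only [Expr.eval_and, Expr.eval_reg, State.set_reg]
    simp only [reduceIte, Nat.reduceEqDiff, hE₆.r19, p70]
    exact pk_bottom h0 (hKB _ h0)
  refine wp_assign_seq (BitVec.ofNat w (PB 0)) ?_ ?_ rfl (by simp; omega)
  · simp only [Expr.eval_and, Expr.eval_reg, State.set_reg]
    simp only [reduceIte, Nat.reduceEqDiff, hE₆.r19, p71]
    exact pk_bottom h0 (hPB _ h0)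
  have hbr : ∀ c < 2 ^ f, (pk w (f + 1) (2 ^ m) fun _ => 1) * BitVec.ofNat w c =
      pk w (f + 1) (2 ^ m) fun _ => c := fun c hc => pk_broadcast hq (by omega)
  refine wp_assign_seq (pk w (f + 1) (2 ^ m) (fun i => φ (KB i))) ?_ ?_ rfl
    (by simp [geMask]; omega)
  · simp only [Expr.eval_and, Expr.eval_or]
    rw [eval_geMask (a := fun _ => KA (2 ^ m - 1)) (b := KB) (hE₆.frame (b := 50) ?_)
      (fun _ _ => hKA _ (by omega)) hKB]
    · simp only [Expr.eval_reg, Expr.eval_mul, State.set_reg]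
      simp only [reduceIte, Nat.reduceEqDiff, hE₆.r12, p71]
      rw [hbr _ (hPA _ (by omega)), pk_and hq, pk_or hq]
      refine pk_congr fun i hi => ?_
      simp only [eφ, ← (main i hi).2]
      split_ifs
      · rw [one_mul, Nat.and_comm, and_two_pow_sub_one (hPA _ (by omega))]
      · simp
    · simp only [Expr.eval_reg, Expr.eval_mul, State.set_reg]
      simp only [reduceIte, Nat.reduceEqDiff, hE₆.r12]
      exact hbr _ (hKA _ (by omega))
    · simp [p70]
    · repeat refine Frame.set ?_ (by decide)
      exact Frame.refl 50 _
  refine wp_assign_seq (pk w (f + 1) (2 ^ m) (fun i => φ (KA i))) ?_ ?_ rfl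
    (by simp [geMask]; omega)
  · simp only [Expr.eval_and, Expr.eval_or]
    rw [eval_geMask (a := KA) (b := fun _ => KB 0) (hE₆.frame (b := 50) ?_) hKA
      (fun _ _ => hKB _ h0)]
    · simp only [Expr.eval_reg, Expr.eval_mul, State.set_reg]
      simp only [reduceIte, Nat.reduceEqDiff, hE₆.r12, p57]
      rw [hbr _ (hPB _ h0), pk_and hq, pk_or hq]
      refine pk_congr fun i hi => ?_
      simp only [eφ, ← (main i hi).1]
      split_ifs
      · rw [one_mul, Nat.and_comm, and_two_pow_sub_one (hPB _ h0)]
      · simp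
    · simp [p56]
    · simp only [Expr.eval_reg, Expr.eval_mul, State.set_reg]
      simp only [reduceIte, Nat.reduceEqDiff, hE₆.r12]
      exact hbr _ (hKB _ h0)
    · repeat refine Frame.set ?_ (by decide)
      exact Frame.refl 50 _
  -- back to the original order
  refine wp_assign_seq (pk w (f + 1) (2 ^ m) (netHist m b₁ m)) (by simp [p62]) ?_ rfl
    (by simp [geMask]; omega)
  refine wp_run_seq (750 * (m + 1)) (wp_unsortProg (a := b₁)
    (hE₆.frame (b := 50) ?_) φ (fun _ _ => hφ _)
    (by simp [eKB]) (by simp)) ?_ (by simp [geMask]; omega)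
  · repeat refine Frame.set ?_ (by decide)
    exact Frame.refl 50 _
  rintro σ₇ ⟨F₇, q71⟩
  have k53 := F₇.reg 53 (by decide)
  have k57 := F₇.reg 57 (by decide)
  have k61 := F₇.reg 61 (by decide)
  simp only [State.set_reg, reduceIte, Nat.reduceEqDiff, p53, p61] at k53 k57 k61
  replace F₇ : Frame 50 σ σ₇ := by
    refine Frame.trans ?_ (F₇.mono (by decide))
    repeat refine Frame.set ?_ (by decide)
    exact F₆
  clear F₆ hE₆ p53 p56 p57 p61 p62 p70 p71
  refine wp_assign_seq _ q71 ?_ rfl (by simp; omega)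
  refine wp_assign_seq (pk w (f + 1) (2 ^ m) (fun i => φ (KA i))) (by simp [k57]) ?_ rfl
    (by simp; omega)
  refine wp_assign_seq (pk w (f + 1) (2 ^ m) (netHist m a₁ m)) (by simp [k61]) ?_ rfl
    (by simp; omega)
  refine wp_run_seq (450 * (m + 1)) (wp_unsortProg (a := a₁)
    (hE.frame (b := 50) ?_) φ (fun _ _ => hφ _)
    (by simp [eKA]) (by simp)) ?_ (by simp; omega)
  · repeat refine Frame.set ?_ (by decide)
    exact F₇
  rintro σ₈ ⟨F₈, q71⟩
  have p53 := F₈.reg 53 (by decide)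
  have p58 := F₈.reg 58 (by decide)
  simp only [State.set_reg, reduceIte, Nat.reduceEqDiff, k53] at p53 p58
  replace F₈ : Frame 50 σ σ₈ := by
    refine Frame.trans ?_ (F₈.mono (by decide))
    repeat refine Frame.set ?_ (by decide)
    exact F₇
  refine wp_assign (pk w (f + 1) (2 ^ m) (fun i => gather z v (a i) (2 ^ m))) ?_
    ⟨F₈.set (by decide), by simp⟩ rfl (by simp; omega)
  simp only [Expr.eval_xor, Expr.eval_and, Expr.eval_reg, q71, p53, p58]
  rw [pk_select (fun _ _ => hφ _) (fun _ _ => hφ _)]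
  refine pk_congr fun i _ => ?_
  -- Where `b i ≤ a i`, the argument was the maximum and its value is in the upper word; elsewhere
  -- it is in the lower word.
  rw [← gather_reverse, ← eb, ← epb, eφ, ea₁, eb₁]
  split_ifs with h
  · simp [h]
  · simp [(not_le.1 h).le]

end WordRAM

/-! ## Division and the constants of the computation -/

namespace WordRAM

open WordRAM.Expr in
/-- Leaves in register `71` the quotient of the word length by register `70`. -/
def divProg : Program :=
  .assign 72 (const 1) ;;
  .assign 73 (reg 70) ;;
  .whileLt (reg 73) (reg 0 + const 1)
    (.assign 73 (reg 73 + reg 73) ;; .assign 72 (reg 72 + reg 72)) ;;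
  .assign 71 (const 0) ;;
  .assign 74 (reg 0) ;;
  .whileLt (const 1) (reg 72)
    (.assign 72 (reg 72 >>> const 1) ;;
    .assign 73 (reg 73 >>> const 1) ;;
    .ifLt (reg 74) (reg 73) .skip
      (.assign 74 (reg 74 - reg 73) ;; .assign 71 (reg 71 + reg 72)))

/-- Binary long division: the divisor is doubled until it exceeds `w`, and on the way back it is
subtracted wherever it fits. -/
theorem wp_divProg {w b : ℕ} {σ : State w} (hw : 3 ≤ w) (hb : 0 < b) (hbw : b ≤ w)
    (h0 : σ.reg 0 = BitVec.ofNat w w) (h70 : σ.reg 70 = BitVec.ofNat w b) :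
    wp divProg (100 * (Nat.log 2 (w / b) + 2)) (fun σ' => Frame 70 σ σ' ∧
      σ'.reg 71 = BitVec.ofNat w (w / b)) σ := by
  obtain ⟨L, hL⟩ : ∃ L, L = Nat.log 2 (w / b) := ⟨_, rfl⟩
  have hlog : ∀ j, b * 2 ^ j ≤ w → j ≤ L := fun j hj => by
    rw [hL]
    refine Nat.le_log_of_pow_le (by omega) ?_
    rwa [Nat.le_div_iff_mul_le hb, mul_comm]
  have h1w := toNat_ofNat_of_le (show 1 ≤ w by omega)
  rw [← hL]
  refine wp_assign_seq (BitVec.ofNat w (2 ^ 0)) rfl ?_ rfl (by simp; omega)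
  refine wp_assign_seq (BitVec.ofNat w (b * 2 ^ 0)) (by simp [h70]) ?_ rfl (by simp; omega)
  -- A multiple that is doubled is at most `w`, so the loop ends at most at `2 * w`, without
  -- wrapping around.
  refine wp_run_seq (R := fun σ' => ∃ j, j ≤ L + 1 ∧ w < b * 2 ^ j ∧ b * 2 ^ j ≤ 2 * w ∧
      Frame 70 σ σ' ∧ σ'.reg 72 = BitVec.ofNat w (2 ^ j) ∧ σ'.reg 73 = BitVec.ofNat w (b * 2 ^ j))
    (70 * (L + 2)) (wp_whileLt (T := 16) (T' := 24 * (L + 2)) (k := L + 1)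
      (fun k σ' => ∃ j, j + k = L + 1 ∧ b * 2 ^ j ≤ 2 * w ∧ Frame 70 σ σ' ∧
        σ'.reg 72 = BitVec.ofNat w (2 ^ j) ∧ σ'.reg 73 = BitVec.ofNat w (b * 2 ^ j))
      ?_ ?_ ?_ (by simp; omega)) ?_ (by simp; omega)
  · refine ⟨0, by omega, by simp; omega, ?_, by simp⟩
    repeat refine Frame.set ?_ (by decide)
    exact Frame.refl 70 σ
  · rintro k σ' ⟨j, hj, hle, hF, h1, h2⟩ hc
    refine ⟨j, by omega, ?_, hle, hF, h1, h2⟩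
    simp only [Expr.eval_reg, Expr.eval_add, Expr.eval_const, h2, hF.reg 0 (by decide), h0,
      ← BitVec.ofNat_add, toNat_ofNat_of_le_two_mul hw hle,
      toNat_ofNat_of_le_two_mul hw (show w + 1 ≤ 2 * w by omega)] at hc
    omega
  · rintro k σ' ⟨j, hj, hle, hF, h1, h2⟩ hc
    simp only [Expr.eval_reg, Expr.eval_add, Expr.eval_const, h2, hF.reg 0 (by decide), h0,
      ← BitVec.ofNat_add, toNat_ofNat_of_le_two_mul hw hle,
      toNat_ofNat_of_le_two_mul hw (show w + 1 ≤ 2 * w by omega)] at hc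
    have hjL := hlog j (by omega)
    refine wp_assign_seq (BitVec.ofNat w (b * 2 ^ (j + 1))) ?_ ?_
    · simp only [Expr.eval_add, Expr.eval_reg, h2, ofNat_lane_double]
    refine wp_assign (BitVec.ofNat w (2 ^ (j + 1))) ?_ ?_
    · have := ofNat_lane_double (w := w) 1 j
      simp only [one_mul] at this
      simpa [h1] using this
    refine ⟨k - 1, by omega, j + 1, by omega, ?_, ?_, by simp⟩
    · rw [pow_succ, ← mul_assoc]; omega
    repeat refine Frame.set ?_ (by decide)
    exact hF
  rintro σ' ⟨j, hjL, hlt, hle, hF, h1, h2⟩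
  refine wp_assign_seq (BitVec.ofNat w 0) rfl ?_ rfl (by simp; omega)
  refine wp_assign_seq (BitVec.ofNat w w) (by simp [hF.reg 0 (by decide), h0]) ?_ rfl
    (by simp; omega)
  refine wp_whileLt (T := 40) (k := j)
    -- Here `y` is the partial quotient and `x` the remainder, which is below the current multiple
    -- of the divisor. At `k = 0` this is division with remainder.
    (fun k σ' => ∃ x y, b * 2 ^ k ≤ 2 * w ∧ x < b * 2 ^ k ∧ y * b + x = w ∧ Frame 70 σ σ' ∧
      σ'.reg 72 = BitVec.ofNat w (2 ^ k) ∧ σ'.reg 73 = BitVec.ofNat w (b * 2 ^ k) ∧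
      σ'.reg 74 = BitVec.ofNat w x ∧ σ'.reg 71 = BitVec.ofNat w y) ?_ ?_ ?_ ?_
  · refine ⟨w, 0, hle, hlt, by omega, ?_, by simp [h1, h2]⟩
    repeat refine Frame.set ?_ (by decide)
    exact hF
  · rintro k σ' ⟨x, y, hk, hx, hxy, hF, h1, h2, h3, h4⟩ hc
    have hk' : 2 ^ k ≤ 2 * w := (Nat.le_mul_of_pos_left _ hb).trans hk
    simp only [Expr.eval_reg, Expr.eval_const, h1, h1w, toNat_ofNat_of_le_two_mul hw hk'] at hc
    obtain rfl : k = 0 := by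
      by_contra h
      exact hc (Nat.one_lt_two_pow h)
    refine ⟨hF, ?_⟩
    rw [h4, ← hxy, mul_comm, Nat.mul_add_div hb, Nat.div_eq_of_lt (by simpa using hx), add_zero]
  · rintro k σ' ⟨x, y, hk, hx, hxy, hF, h1, h2, h3, h4⟩ hc
    have hk' : 2 ^ k ≤ 2 * w := (Nat.le_mul_of_pos_left _ hb).trans hk
    simp only [Expr.eval_reg, Expr.eval_const, h1, h1w, toNat_ofNat_of_le_two_mul hw hk'] at hc
    obtain ⟨k, rfl⟩ : ∃ k', k = k' + 1 := by
      refine Nat.exists_eq_succ_of_ne_zero ?_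
      rintro rfl
      simp at hc
    have e1 : 2 ^ (k + 1) = 2 * 2 ^ k := by rw [pow_succ, mul_comm]
    have e2 : b * 2 ^ (k + 1) = 2 * (b * 2 ^ k) := by rw [pow_succ]; ring
    have hlt2 := two_mul_lt_two_pow hw
    rw [e1] at h1 hk'
    rw [e2] at h2 hk hx
    refine wp_assign_seq (BitVec.ofNat w (2 ^ k)) ?_ ?_
    · simp only [Expr.eval_shr, Expr.eval_reg, Expr.eval_const, h1]
      exact ofNat_two_mul_shr (by omega) (by omega)
    refine wp_assign_seq (BitVec.ofNat w (b * 2 ^ k)) ?_ ?_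
    · simp only [Expr.eval_shr, Expr.eval_reg, Expr.eval_const, State.set_reg]
      simp only [reduceIte, Nat.reduceEqDiff, h2]
      exact ofNat_two_mul_shr (by omega) (by omega)
    have hxw := toNat_ofNat_of_le_two_mul hw (show x ≤ 2 * w by omega)
    have hbk := toNat_ofNat_of_le_two_mul hw (show b * 2 ^ k ≤ 2 * w by omega)
    refine wp_ifLt (T := 20) ?_ ?_ (by decide)
    · intro hc
      simp only [Expr.eval_reg, State.set_reg] at hc
      simp only [reduceIte, Nat.reduceEqDiff, h3, hxw, hbk] at hc
      refine wp_mono (wp_skip ?_) (show 1 ≤ 20 by decide) (fun _ h => h)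
      refine ⟨k, by omega, x, y, by omega, hc, hxy, ?_, by simp [h3, h4]⟩
      repeat refine Frame.set ?_ (by decide)
      exact hF
    · intro hc
      simp only [Expr.eval_reg, State.set_reg] at hc
      simp only [reduceIte, Nat.reduceEqDiff, h3, hxw, hbk] at hc
      refine wp_assign_seq (BitVec.ofNat w (x - b * 2 ^ k)) ?_ ?_
      · simp only [Expr.eval_sub, Expr.eval_reg, State.set_reg]
        simp only [reduceIte, Nat.reduceEqDiff, h3]
        exact ofNat_sub_ofNat (by omega)
      refine wp_assign (BitVec.ofNat w (y + 2 ^ k)) ?_ ?_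
      · simp [h4, BitVec.ofNat_add]
      refine ⟨k, by omega, x - b * 2 ^ k, y + 2 ^ k, by omega, by omega, ?_, ?_, by simp⟩
      · rw [add_mul, mul_comm (2 ^ k)]; omega
      repeat refine Frame.set ?_ (by decide)
      exact hF
  · simp
    omega

end WordRAM

/-! ### The number of lanes and the constant words -/

namespace WordRAM

open WordRAM.Expr in
/-- Computes the constants listed in `Env`. -/
def setupProg : Program :=
  .assign 7 (reg 1 + const 1) ;;
  .assign 8 (reg 1 + reg 1 + const 1) ;;
  .assign 19 ((const 1 <<< reg 1) - const 1) ;;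
  .assign 70 (reg 7) ;; divProg ;; .assign 23 (reg 71) ;;
  .assign 70 (reg 8) ;; divProg ;; .assign 24 (reg 71) ;;
  .assign 18 ((const 1 <<< reg 1) * reg 8) ;;
  .ifLt (reg 0) (reg 18) (.assign 18 (reg 0)) .skip ;;
  .assign 10 (const 1) ;; .assign 11 (const 0) ;;
  .assign 12 (const 1) ;; .assign 13 (const 0) ;;
  .assign 14 (const 1) ;; .assign 15 (const 0) ;;
  .assign 16 (reg 8) ;; .assign 17 (reg 7) ;;
  .whileLt (reg 16 + reg 16) (reg 18 + const 1)
    (.assign 13 (reg 13 ||| ((reg 13 + reg 12 * reg 10) <<< reg 17)) ;;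
    .assign 12 (reg 12 ||| (reg 12 <<< reg 17)) ;;
    .assign 15 (reg 15 ||| ((reg 15 + reg 14 * reg 10) <<< reg 16)) ;;
    .assign 14 (reg 14 ||| (reg 14 <<< reg 16)) ;;
    .assign 10 (reg 10 + reg 10) ;; .assign 11 (reg 11 + const 1) ;;
    .assign 16 (reg 16 + reg 16) ;; .assign 17 (reg 17 + reg 17)) ;;
  .assign 20 (reg 12 * reg 19) ;;
  .assign 21 (reg 12 * (const 1 <<< reg 1)) ;;
  .assign 22 (reg 14 * reg 19)

section
variable {w b j : ℕ}

theorem pk_ones_double (hb : 0 < b) :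
    (pk w b (2 ^ j) fun _ => 1) ||| ((pk w b (2 ^ j) fun _ => 1) <<< (b * 2 ^ j)) =
      pk w b (2 ^ (j + 1)) fun _ => 1 := by
  rw [pk_append hb, pow_succ, mul_two]
  exact pk_congr fun i _ => by simp

/-- The upper half of the indices is a copy of the lower half with `2 ^ j` added in every lane; `hj`
leaves room for the larger indices. -/
theorem pk_index_double (hj : j + 1 < b) :
    (pk w b (2 ^ j) fun i => i) ||| (((pk w b (2 ^ j) fun i => i) +
      (pk w b (2 ^ j) fun _ => 1) * BitVec.ofNat w (2 ^ j)) <<< (b * 2 ^ j)) =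
      pk w b (2 ^ (j + 1)) fun i => i := by
  have h1 : 2 ^ (j + 1) < 2 ^ b := Nat.pow_lt_pow_right (by omega) hj
  have h2 : 2 ^ (j + 1) = 2 * 2 ^ j := by rw [pow_succ, mul_comm]
  rw [pk_broadcast (by omega) (by omega), pk_add (fun i hi => by omega), pk_append (by omega), h2,
    two_mul]
  refine pk_congr fun i hi => ?_
  split_ifs <;> omega

end

theorem two_mul_add_one_lt {f : ℕ} (hf : 1 ≤ f) : f + f + 1 < 2 ^ (f + 1) := by
  induction f, hf using Nat.le_induction with
  | base => norm_num
  | succ f h ih => rw [pow_succ]; omega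

theorem wp_setupProg {w f : ℕ} {σ : State w} (hf : 1 ≤ f) (hw : f + f + 1 ≤ w)
    (h0 : σ.reg 0 = BitVec.ofNat w w) (h1 : σ.reg 1 = BitVec.ofNat w f) :
    wp setupProg (500 * (Nat.log 2 (w / (f + 1)) + 2)) (fun σ' => Frame 7 σ σ' ∧
      ∃ m, Env w f m σ' ∧ m ≤ Nat.log 2 (w / (f + 1)) ∧
        (m = f ∨ w < (f + f + 1) * 2 ^ (m + 1))) σ := by
  have hw3 : 3 ≤ w := by omega
  obtain ⟨L, hL⟩ : ∃ L, L = Nat.log 2 (w / (f + 1)) := ⟨_, rfl⟩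
  -- The doublings of the lane number are bounded by the logarithm of `w / (f + 1)`, although the
  -- lanes that must fit are the wider ones.
  have hlog : ∀ j, (f + f + 1) * 2 ^ j ≤ w → j ≤ L := fun j hj => by
    rw [hL]
    refine Nat.le_log_of_pow_le (by omega) ?_
    rw [Nat.le_div_iff_mul_le (by omega), mul_comm]
    exact (Nat.mul_le_mul_right _ (by omega)).trans hj
  have hL' : Nat.log 2 (w / (f + f + 1)) ≤ L := by
    rw [hL]
    exact Nat.log_mono_right (Nat.div_le_div_left (by omega) (by omega))
  have hfw := toNat_ofNat_of_le (show f ≤ w by omega)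
  have hpos : 0 < 2 ^ f := by positivity
  rw [← hL]
  refine wp_assign_seq (BitVec.ofNat w (f + 1)) (by simp [h1, BitVec.ofNat_add]) ?_ rfl
    (by simp; omega)
  refine wp_assign_seq (BitVec.ofNat w (f + f + 1)) (by simp [h1, BitVec.ofNat_add]) ?_ rfl
    (by simp; omega)
  refine wp_assign_seq (BitVec.ofNat w (2 ^ f - 1)) ?_ ?_ rfl (by simp; omega)
  · simp only [Expr.eval_sub, Expr.eval_shl, Expr.eval_const, Expr.eval_reg, State.set_reg]
    simp only [reduceIte, Nat.reduceEqDiff, h1, hfw, one_shl]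
    exact ofNat_sub_ofNat hpos
  refine wp_assign_seq (BitVec.ofNat w (f + 1)) (by simp) ?_ rfl (by simp; omega)
  refine wp_run_seq (390 * (L + 2)) (wp_divProg (b := f + 1) hw3 (by omega) (by omega)
    (by simp [h0]) (by simp)) ?_ (by rw [← hL]; simp; omega)
  rintro σ₁ ⟨F₁, q71⟩
  have k1 := F₁.reg 1 (by decide)
  have k7 := F₁.reg 7 (by decide)
  have k8 := F₁.reg 8 (by decide)
  have k19 := F₁.reg 19 (by decide)
  simp only [State.set_reg, reduceIte, Nat.reduceEqDiff, h1] at k1 k7 k8 k19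
  replace F₁ : Frame 7 σ σ₁ := by
    refine Frame.trans ?_ (F₁.mono (by decide))
    repeat refine Frame.set ?_ (by decide)
    exact Frame.refl 7 σ
  refine wp_assign_seq _ q71 ?_ rfl (by simp; omega)
  refine wp_assign_seq (BitVec.ofNat w (f + f + 1)) (by simp [k8]) ?_ rfl (by simp; omega)
  refine wp_run_seq (280 * (L + 2)) (wp_divProg (b := f + f + 1) hw3 (by omega) (by omega)
    (by simp [F₁.reg 0 (by decide), h0]) (by simp)) ?_ (by simp; omega)
  rintro σ₂ ⟨F₂, q71⟩
  have p1 := F₂.reg 1 (by decide)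
  have p7 := F₂.reg 7 (by decide)
  have p8 := F₂.reg 8 (by decide)
  have p19 := F₂.reg 19 (by decide)
  have p23 := F₂.reg 23 (by decide)
  simp only [State.set_reg, reduceIte, Nat.reduceEqDiff, k1, k7, k8, k19] at p1 p7 p8 p19 p23
  replace F₂ : Frame 7 σ σ₂ := by
    refine Frame.trans ?_ (F₂.mono (by decide))
    repeat refine Frame.set ?_ (by decide)
    exact F₁
  clear k1 k7 k8 k19 F₁
  have p0 : σ₂.reg 0 = BitVec.ofNat w w := by rw [F₂.reg 0 (by decide), h0]
  refine wp_assign_seq _ q71 ?_ rfl (by simp; omega)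
  -- The word length caps the total width of the lanes, and so does `2 ^ f * (2 * f + 1)`, which
  -- enforces `m ≤ f`. The latter is below `2 ^ (2 * f + 1)`, hence a valid word.
  have hcap : (BitVec.ofNat w (2 ^ f * (f + f + 1))).toNat = 2 ^ f * (f + f + 1) := by
    rw [BitVec.toNat_ofNat, Nat.mod_eq_of_lt]
    calc 2 ^ f * (f + f + 1) < 2 ^ f * 2 ^ (f + 1) :=
          Nat.mul_lt_mul_of_pos_left (two_mul_add_one_lt hf) hpos
      _ = 2 ^ (f + f + 1) := by rw [← pow_add, add_assoc]
      _ ≤ 2 ^ w := Nat.pow_le_pow_right (by omega) hw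
  refine wp_assign_seq (BitVec.ofNat w (2 ^ f * (f + f + 1))) ?_ ?_ rfl (by simp; omega)
  · simp only [Expr.eval_mul, Expr.eval_shl, Expr.eval_const, Expr.eval_reg, State.set_reg]
    simp only [reduceIte, Nat.reduceEqDiff, p1, p8, hfw, one_shl, ← BitVec.ofNat_mul]
  refine wp_run_seq (T₁ := 10) (R := fun σ' => Frame 7 σ σ' ∧ σ'.reg 7 = BitVec.ofNat w (f + 1) ∧
      σ'.reg 8 = BitVec.ofNat w (f + f + 1) ∧ σ'.reg 19 = BitVec.ofNat w (2 ^ f - 1) ∧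
      σ'.reg 23 = BitVec.ofNat w (w / (f + 1)) ∧ σ'.reg 24 = BitVec.ofNat w (w / (f + f + 1)) ∧
      σ'.reg 18 = BitVec.ofNat w (min w (2 ^ f * (f + f + 1))))
    (260 * (L + 2)) ?_ ?_ (by simp; omega)
  · have F₃ : Frame 7 σ ((σ₂.set 24 (BitVec.ofNat w (w / (f + f + 1)))).set 18
        (BitVec.ofNat w (2 ^ f * (f + f + 1)))) := (F₂.set (by decide)).set (by decide)
    refine wp_ifLt (T := 5) ?_ ?_ (by decide)
    · intro hc
      simp only [Expr.eval_reg, State.set_reg] at hc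
      simp only [reduceIte, Nat.reduceEqDiff, p0, toNat_ofNat_of_le le_rfl, hcap] at hc
      refine wp_assign (BitVec.ofNat w w) (by simp [p0]) ⟨F₃.set (by decide), ?_⟩
      simp [p7, p8, p19, p23, min_eq_left hc.le]
    · intro hc
      simp only [Expr.eval_reg, State.set_reg] at hc
      simp only [reduceIte, Nat.reduceEqDiff, p0, toNat_ofNat_of_le le_rfl, hcap] at hc
      refine wp_mono (wp_skip ?_) (show 1 ≤ 5 by decide) (fun _ h => h)
      refine ⟨F₃, ?_⟩
      simp [p7, p8, p19, p23, min_eq_right (not_lt.1 hc)]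
  clear p1 p7 p8 p19 p23 p0 q71 F₂
  rintro σ₃ ⟨F₃, k7, k8, k19, k23, k24, k18⟩
  refine wp_assign_seq (BitVec.ofNat w (2 ^ 0)) rfl ?_ rfl (by simp; omega)
  refine wp_assign_seq (BitVec.ofNat w 0) rfl ?_ rfl (by simp; omega)
  refine wp_assign_seq (pk w (f + 1) (2 ^ 0) fun _ => 1) ?_ ?_ rfl (by simp; omega)
  · exact (pk_one (v := fun _ => 1) (Nat.one_lt_two_pow (by omega))).symm
  refine wp_assign_seq (pk w (f + 1) (2 ^ 0) fun i => i) ?_ ?_ rfl (by simp; omega)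
  · exact (pk_one (v := fun i => i) (by positivity)).symm
  refine wp_assign_seq (pk w (f + f + 1) (2 ^ 0) fun _ => 1) ?_ ?_ rfl (by simp; omega)
  · exact (pk_one (v := fun _ => 1) (Nat.one_lt_two_pow (by omega))).symm
  refine wp_assign_seq (pk w (f + f + 1) (2 ^ 0) fun i => i) ?_ ?_ rfl (by simp; omega)
  · exact (pk_one (v := fun i => i) (by positivity)).symm
  refine wp_assign_seq (BitVec.ofNat w ((f + f + 1) * 2 ^ 0)) (by simp [k8]) ?_ rfl
    (by simp; omega)
  refine wp_assign_seq (BitVec.ofNat w ((f + 1) * 2 ^ 0)) (by simp [k7]) ?_ rfl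
    (by simp; omega)
  refine wp_run_seq (R := fun σ' => ∃ m, Frame 7 σ σ' ∧ σ'.reg 7 = BitVec.ofNat w (f + 1) ∧
      σ'.reg 8 = BitVec.ofNat w (f + f + 1) ∧ σ'.reg 19 = BitVec.ofNat w (2 ^ f - 1) ∧
      σ'.reg 23 = BitVec.ofNat w (w / (f + 1)) ∧ σ'.reg 24 = BitVec.ofNat w (w / (f + f + 1)) ∧
      m ≤ f ∧ (f + f + 1) * 2 ^ m ≤ w ∧ (m = f ∨ w < (f + f + 1) * 2 ^ (m + 1)) ∧
      σ'.reg 10 = BitVec.ofNat w (2 ^ m) ∧ σ'.reg 11 = BitVec.ofNat w m ∧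
      (σ'.reg 12 = pk w (f + 1) (2 ^ m) fun _ => 1) ∧
      (σ'.reg 13 = pk w (f + 1) (2 ^ m) fun i => i) ∧
      (σ'.reg 14 = pk w (f + f + 1) (2 ^ m) fun _ => 1) ∧
      (σ'.reg 15 = pk w (f + f + 1) (2 ^ m) fun i => i) ∧
      σ'.reg 17 = BitVec.ofNat w ((f + 1) * 2 ^ m))
    (100 * (L + 2)) (wp_whileLt (T := 60) (T' := 67 * (L + 1)) (k := L)
      (fun k σ' => ∃ j, j + k = L ∧ Frame 7 σ σ' ∧ σ'.reg 7 = BitVec.ofNat w (f + 1) ∧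
      σ'.reg 8 = BitVec.ofNat w (f + f + 1) ∧ σ'.reg 19 = BitVec.ofNat w (2 ^ f - 1) ∧
      σ'.reg 23 = BitVec.ofNat w (w / (f + 1)) ∧ σ'.reg 24 = BitVec.ofNat w (w / (f + f + 1)) ∧
      σ'.reg 18 = BitVec.ofNat w (min w (2 ^ f * (f + f + 1))) ∧
      j ≤ f ∧ (f + f + 1) * 2 ^ j ≤ w ∧
      σ'.reg 10 = BitVec.ofNat w (2 ^ j) ∧ σ'.reg 11 = BitVec.ofNat w j ∧
      (σ'.reg 12 = pk w (f + 1) (2 ^ j) fun _ => 1) ∧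
      (σ'.reg 13 = pk w (f + 1) (2 ^ j) fun i => i) ∧
      (σ'.reg 14 = pk w (f + f + 1) (2 ^ j) fun _ => 1) ∧
      (σ'.reg 15 = pk w (f + f + 1) (2 ^ j) fun i => i) ∧
      σ'.reg 16 = BitVec.ofNat w ((f + f + 1) * 2 ^ j) ∧
      σ'.reg 17 = BitVec.ofNat w ((f + 1) * 2 ^ j))
      ?_ ?_ ?_ (by simp; omega)) ?_ (by simp; omega)
  · refine ⟨0, by omega, ?_, ?_⟩
    · repeat refine Frame.set ?_ (by decide)
      exact F₃
    · simp [k7, k8, k18, k19, k23, k24, hw]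
  · rintro k σ' ⟨j, hj, hF, h7, h8, h19, h23, h24, h18, hjf, hfit, h10, h11, h12, h13, h14, h15,
      h16, h17⟩ hc
    refine ⟨j, hF, h7, h8, h19, h23, h24, hjf, hfit, ?_, h10, h11, h12, h13, h14, h15, h17⟩
    simp only [Expr.eval_reg, Expr.eval_add, Expr.eval_const, h16, h18, ofNat_lane_double] at hc
    rw [← BitVec.ofNat_add, toNat_ofNat_of_le_two_mul hw3 (by rw [pow_succ, ← mul_assoc]; omega),
      toNat_ofNat_of_le_two_mul hw3 (by omega)] at hc
    -- The next doubling violates one of the two caps: either the word is full up to a factor `2`,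
    -- or `m = f`.
    rcases min_lt_iff.1 (show min w (2 ^ f * (f + f + 1)) < (f + f + 1) * 2 ^ (j + 1) by omega)
      with h | h
    · exact Or.inr h
    · rw [mul_comm, Nat.mul_lt_mul_left (by omega), Nat.pow_lt_pow_iff_right (by omega)] at h
      left; omega
  · rintro k σ' ⟨j, hj, hF, h7, h8, h19, h23, h24, h18, hjf, hfit, h10, h11, h12, h13, h14, h15,
      h16, h17⟩ hc
    simp only [Expr.eval_reg, Expr.eval_add, Expr.eval_const, h16, h18, ofNat_lane_double] at hc
    rw [← BitVec.ofNat_add, toNat_ofNat_of_le_two_mul hw3 (by rw [pow_succ, ← mul_assoc]; omega),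
      toNat_ofNat_of_le_two_mul hw3 (by omega)] at hc
    obtain ⟨hfit', hjf'⟩ := le_min_iff.1 (Nat.lt_succ_iff.1 hc)
    rw [mul_comm (2 ^ f), Nat.mul_le_mul_left_iff (by omega),
      Nat.pow_le_pow_iff_right (by omega)] at hjf'
    have hjL := hlog _ hfit'
    have hq := toNat_ofNat_of_le ((Nat.mul_le_mul_right (2 ^ j)
      (show f + 1 ≤ f + f + 1 by omega)).trans hfit)
    have hp := toNat_ofNat_of_le hfit
    refine wp_assign_seq (pk w (f + 1) (2 ^ (j + 1)) fun i => i) ?_ ?_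
    · simp only [Expr.eval_or, Expr.eval_shl, Expr.eval_add, Expr.eval_mul, Expr.eval_reg, h13,
        h12, h10, h17, hq]
      exact pk_index_double (by omega)
    refine wp_assign_seq (pk w (f + 1) (2 ^ (j + 1)) fun _ => 1) ?_ ?_
    · simp only [Expr.eval_or, Expr.eval_shl, Expr.eval_reg, State.set_reg]
      simp only [reduceIte, Nat.reduceEqDiff, h12, h17, hq]
      exact pk_ones_double (by omega)
    refine wp_assign_seq (pk w (f + f + 1) (2 ^ (j + 1)) fun i => i) ?_ ?_
    · simp only [Expr.eval_or, Expr.eval_shl, Expr.eval_add, Expr.eval_mul, Expr.eval_reg,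
        State.set_reg]
      simp only [reduceIte, Nat.reduceEqDiff, h15, h14, h10, h16, hp]
      exact pk_index_double (by omega)
    refine wp_assign_seq (pk w (f + f + 1) (2 ^ (j + 1)) fun _ => 1) ?_ ?_
    · simp only [Expr.eval_or, Expr.eval_shl, Expr.eval_reg, State.set_reg]
      simp only [reduceIte, Nat.reduceEqDiff, h14, h16, hp]
      exact pk_ones_double (by omega)
    refine wp_assign_seq (BitVec.ofNat w (2 ^ (j + 1))) ?_ ?_
    · have := ofNat_lane_double (w := w) 1 j
      simp only [one_mul] at this
      simpa [h10] using this
    refine wp_assign_seq (BitVec.ofNat w (j + 1)) (by simp [h11, BitVec.ofNat_add]) ?_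
    refine wp_assign_seq (BitVec.ofNat w ((f + f + 1) * 2 ^ (j + 1))) ?_ ?_
    · simp only [Expr.eval_add, Expr.eval_reg, State.set_reg]
      simp only [reduceIte, Nat.reduceEqDiff, h16]
      exact ofNat_lane_double _ _
    refine wp_assign (BitVec.ofNat w ((f + 1) * 2 ^ (j + 1))) ?_ ?_
    · simp only [Expr.eval_add, Expr.eval_reg, State.set_reg]
      simp only [reduceIte, Nat.reduceEqDiff, h17]
      exact ofNat_lane_double _ _
    refine ⟨k - 1, by omega, j + 1, by omega, ?_, ?_⟩
    · repeat refine Frame.set ?_ (by decide)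
      exact hF
    · simp [h7, h8, h18, h19, h23, h24, hjf', hfit']
  rintro σ₄ ⟨m, hF, h7, h8, h19, h23, h24, hmf, hfit, hmax, h10, h11, h12, h13, h14, h15, h17⟩
  have hf1 : 2 ^ f < 2 ^ (f + 1) := Nat.pow_lt_pow_right (by omega) (by omega)
  have hf2 : 2 ^ f < 2 ^ (f + f + 1) := Nat.pow_lt_pow_right (by omega) (by omega)
  refine wp_assign_seq (pk w (f + 1) (2 ^ m) fun _ => 2 ^ f - 1) ?_ ?_ rfl (by simp; omega)
  · simp only [Expr.eval_mul, Expr.eval_reg, h12, h19]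
    exact pk_broadcast (by omega) (by omega)
  refine wp_assign_seq (pk w (f + 1) (2 ^ m) fun _ => 2 ^ f) ?_ ?_ rfl (by simp; omega)
  · simp only [Expr.eval_mul, Expr.eval_shl, Expr.eval_const, Expr.eval_reg, State.set_reg]
    simp only [reduceIte, Nat.reduceEqDiff, h12, hF.reg 1 (by decide), h1, hfw, one_shl]
    exact pk_broadcast (by omega) hf1
  refine wp_assign (pk w (f + f + 1) (2 ^ m) fun _ => 2 ^ f - 1) ?_ ?_ rfl (by simp; omega)
  · simp only [Expr.eval_mul, Expr.eval_reg, State.set_reg]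
    simp only [reduceIte, Nat.reduceEqDiff, h14, h19]
    exact pk_broadcast (by omega) (by omega)
  refine ⟨?_, m, ?_, hlog m hfit, hmax⟩
  · repeat refine Frame.set ?_ (by decide)
    exact hF
  · constructor
    case f_pos => exact hf
    case m_le => exact hmf
    case fits => exact hfit
    all_goals
      simp [h7, h8, h10, h11, h12, h13, h14, h15, h17, h19, h23, h24, hF.reg 0 (by decide),
        hF.reg 1 (by decide), h0, h1]

end WordRAM

/-! ## Traversal of packed sequences in blocks of at most `2 ^ m` fields -/

namespace WordRAM

section
variable {w b n N d f : ℕ} {v : ℕ → ℕ}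

theorem pk_extend (h : n ≤ N) (hz : ∀ i, n ≤ i → i < N → v i = 0) : pk w b N v = pk w b n v := by
  obtain ⟨k, rfl⟩ := Nat.exists_eq_add_of_le h
  rw [pk, pk, packNat_add]
  have : packNat b k (fun i => v (n + i)) = 0 := by
    rw [packNat]
    refine Finset.sum_eq_zero fun i hi => ?_
    rw [hz (n + i) (by omega) (by have := Finset.mem_range.1 hi; omega)]
    simp
  rw [this]
  simp

theorem pk_shl (hb : 0 < b) :
    pk w b n v <<< (b * d) = pk w b (d + n) (fun i => if i < d then 0 else v (i - d)) := by
  have := pk_append (w := w) (b := b) (n := d) (n' := n) (u := fun _ => 0) (v := v) hb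
  rwa [pk_zero, BitVec.zero_or] at this

theorem pk_lane {e i : ℕ} (hb : 0 < b) (hw : b * n ≤ w) (hi : i < n) (hf : f < b - e + 1) :
    ((pk w b n v >>> (b * i)) >>> e) &&& BitVec.ofNat w (2 ^ f - 1) =
      BitVec.ofNat w ((v i >>> e) &&& (2 ^ f - 1)) := by
  have hpos : 0 < 2 ^ f := by positivity
  have h1 : 2 ^ f ≤ 2 ^ (b - e) := Nat.pow_le_pow_right (by omega) (by omega)
  have h2 : 2 ^ (b - e) ≤ 2 ^ b := Nat.pow_le_pow_right (by omega) (by omega)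
  have e1 : BitVec.ofNat w (2 ^ f - 1) = pk w b 1 (fun _ => 2 ^ f - 1) :=
    (pk_one (v := fun _ => 2 ^ f - 1) (by omega)).symm
  rw [e1, pk_shr hb hw, pk_inner_shr_and hb (by omega) hw (fun _ _ => by omega), pk_one]
  · simp [hi]
  · have := Nat.and_le_right (n := (if 0 + i < n then v (0 + i) else 0) >>> e) (m := 2 ^ f - 1)
    omega

end

/-! ### Stored sequences as words of lanes -/

theorem value_eq_packNat {f : ℕ} (X : List (BitVec f)) {n : ℕ} (h : X.length ≤ n) :
    Packed.value X = packNat (f + 1) n (fun i => (X.getD i 0).toNat) := by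
  induction X generalizing n with
  | nil => simp [Packed.value, packNat]
  | cons x X ih =>
    obtain ⟨n, rfl⟩ : ∃ k, n = 1 + k := ⟨n - 1, by simp at h; omega⟩
    have h2 : x.toNat < 2 ^ (f + 1) :=
      x.isLt.trans (Nat.pow_lt_pow_right (by omega) (by omega))
    have ih' := ih (n := n) (by simp at h; omega)
    rw [Packed.value] at ih' ⊢
    rw [List.map_cons, Nat.ofDigits_cons, ih', packNat_add, mul_one, add_comm]
    congr 1
    · congr 1
      refine packNat_congr fun i _ => ?_
      rw [add_comm 1 i, List.getD_cons_succ]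
    · simp [packNat]

/-- The default `0` for entries beyond the end agrees with the zero fields that fill up the last
word. -/
theorem word_eq_pk (w : ℕ) {f : ℕ} (X : List (BitVec f)) (j : ℕ) :
    Packed.word w X j = pk w (f + 1) (w / (f + 1))
      (fun i => (X.getD (j * (w / (f + 1)) + i) 0).toNat) := by
  rw [Packed.word, pk, Packed.fieldsPerWord, value_eq_packNat _ (n := w / (f + 1)) (by simp)]
  congr 1
  refine packNat_congr fun i hi => ?_
  congr 1
  rw [List.getD_eq_getElem?_getD, List.getD_eq_getElem?_getD, List.getElem?_take, if_pos hi,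
    List.getElem?_drop]

theorem lt_wordCount {w f r k : ℕ} (hf : f + 1 ≤ w) :
    k < Packed.wordCount w f r ↔ k * (w / (f + 1)) < r := by
  have hs : 0 < w / (f + 1) := Nat.div_pos hf (by omega)
  rw [Packed.wordCount, Packed.fieldsPerWord, ← Nat.succ_le_iff, Nat.le_div_iff_mul_le hs,
    Nat.succ_mul]
  omega

/-- Registers `i, …, i + 3` describe the position in a packed sequence of `len` fields with `s`
fields in each word: the address of the current word, which is the `k`-th one, the number `o` of
fields in it that have been passed, the number of fields from the current word on, and the number
of fields in the current word. -/
structure Cursor {w : ℕ} (σ : State w) (i : ℕ) (base : BitVec w) (len s k o : ℕ) : Prop where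
  addr : σ.reg i = base + BitVec.ofNat w k
  off : σ.reg (i + 1) = BitVec.ofNat w o
  rem : σ.reg (i + 2) = BitVec.ofNat w (len - k * s)
  valid : σ.reg (i + 3) = BitVec.ofNat w (min (len - k * s) s)

/-- The number of fields of a block at offset `o` of the `k`-th word. -/
def blockSize (n len s k o : ℕ) : ℕ := min n (min (len - k * s) s - o)

open WordRAM.Expr in
/-- Advances a cursor by one block; register `r` holds the number of fields in a word. -/
def advance (i r : ℕ) : Program :=
  .assign (i + 1) (reg (i + 1) + reg 10) ;;
  .ifLt (reg (i + 1)) (reg (i + 3)) .skip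
    (.assign i (reg i + const 1) ;;
    .assign (i + 2) (reg (i + 2) - reg (i + 3)) ;;
    .assign (i + 1) (const 0) ;;
    .ifLt (reg (i + 2)) (reg r) (.assign (i + 3) (reg (i + 2))) (.assign (i + 3) (reg r)))

theorem wp_advance {w n len s k o i r : ℕ} {σ : State w} {base : BitVec w}
    (hir : i = 30 ∧ r = 23 ∨ i = 34 ∧ r = 24) (hw : 3 ≤ w) (hn : n ≤ w) (hs : s ≤ w) (ho : o ≤ w)
    (hlen : len < 2 ^ w) (h10 : σ.reg 10 = BitVec.ofNat w n) (hr : σ.reg r = BitVec.ofNat w s)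
    (hC : Cursor σ i base len s k o) :
    wp (advance i r) 50 (fun σ' => σ'.mem = σ.mem ∧
      (∀ y < 100, ¬ (i ≤ y ∧ y < i + 4) → σ'.reg y = σ.reg y) ∧
      (o + n < min (len - k * s) s → Cursor σ' i base len s k (o + n)) ∧
      (¬ o + n < min (len - k * s) s → Cursor σ' i base len s (k + 1) 0)) σ := by
  obtain ⟨h1, h2, h3, h4⟩ := hC
  have e1 := toNat_ofNat_of_le_two_mul hw (show o + n ≤ 2 * w by omega)
  have e2 := toNat_ofNat_of_le_two_mul hw (show min (len - k * s) s ≤ 2 * w by omega)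
  have e3 : (BitVec.ofNat w (len - (k + 1) * s)).toNat = len - (k + 1) * s := by
    rw [BitVec.toNat_ofNat, Nat.mod_eq_of_lt (by omega)]
  have e4 := toNat_ofNat_of_le hs
  have e5 : len - k * s - min (len - k * s) s = len - (k + 1) * s := by rw [add_mul]; omega
  rcases hir with ⟨rfl, rfl⟩ | ⟨rfl, rfl⟩ <;>
  · refine wp_assign_seq (BitVec.ofNat w (o + n)) (by simp [h2, h10, BitVec.ofNat_add]) ?_
    refine wp_ifLt (T := 30) ?_ ?_ (by decide)
    · intro hc
      simp only [Expr.eval_reg, State.set_reg] at hc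
      simp only [Nat.reduceAdd, reduceIte, Nat.reduceEqDiff, h4, e1, e2] at hc
      refine wp_mono (wp_skip ?_) (show 1 ≤ 30 by decide) (fun _ h => h)
      refine ⟨rfl, fun y hy h => ?_, fun _ => ?_, fun h => absurd hc h⟩
      · rw [State.set_reg, if_neg (by omega)]
      · constructor <;> simp [h1, h3, h4]
    · intro hc
      simp only [Expr.eval_reg, State.set_reg] at hc
      simp only [Nat.reduceAdd, reduceIte, Nat.reduceEqDiff, h4, e1, e2] at hc
      refine wp_assign_seq (base + BitVec.ofNat w (k + 1)) ?_ ?_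
      · simp [h1, BitVec.ofNat_add, add_assoc]
      refine wp_assign_seq (BitVec.ofNat w (len - (k + 1) * s)) ?_ ?_
      · simp only [Expr.eval_sub, Expr.eval_reg, State.set_reg]
        simp only [Nat.reduceAdd, reduceIte, Nat.reduceEqDiff, h3, h4]
        rw [ofNat_sub_ofNat (by omega), e5]
      refine wp_assign_seq (BitVec.ofNat w 0) rfl ?_
      refine wp_ifLt (T := 5) ?_ ?_ (by decide)
      · intro hc'
        simp only [Expr.eval_reg, State.set_reg] at hc'
        simp only [Nat.reduceAdd, reduceIte, Nat.reduceEqDiff, hr, e3, e4] at hc'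
        refine wp_assign (BitVec.ofNat w (len - (k + 1) * s)) (by simp) ?_
        refine ⟨rfl, fun y hy h => ?_, fun h => absurd h hc, fun _ => ?_⟩
        · iterate 5 rw [State.set_reg, if_neg (by omega)]
        · constructor <;> simp [min_eq_left hc'.le]
      · intro hc'
        simp only [Expr.eval_reg, State.set_reg] at hc'
        simp only [Nat.reduceAdd, reduceIte, Nat.reduceEqDiff, hr, e3, e4] at hc'
        refine wp_assign (BitVec.ofNat w s) (by simp [hr]) ?_
        refine ⟨rfl, fun y hy h => ?_, fun h => absurd h hc, fun _ => ?_⟩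
        · iterate 5 rw [State.set_reg, if_neg (by omega)]
        · constructor <;> simp [min_eq_right (not_lt.1 hc')]

/-- The potential of a cursor: a bound for the number of blocks that are left. -/
def potential (n len s k o : ℕ) : ℕ := (len - (k * s + o)) / n + (len - k * s + s - 1) / s

/-- A full block has been passed, so the number of full blocks left drops by one. -/
theorem potential_advance_within {n len s k o : ℕ} (hn : 0 < n)
    (h : o + n < min (len - k * s) s) :
    potential n len s k (o + n) < potential n len s k o := by
  rw [potential, potential]
  have : len - (k * s + o) = len - (k * s + (o + n)) + n := by omega
  rw [this, Nat.add_div_right _ hn]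
  omega

/-- The block may be short here, so the count of full blocks need not drop. The count of words does.
-/
theorem potential_advance_word {n len s k o : ℕ} (hs : 0 < s) (ho : o ≤ s)
    (h : 0 < len - k * s) :
    potential n len s (k + 1) 0 < potential n len s k o := by
  rw [potential, potential]
  have h1 : (len - ((k + 1) * s + 0)) / n ≤ (len - (k * s + o)) / n :=
    Nat.div_le_div_right (by rw [add_mul]; omega)
  have h2 : (len - k * s + s - 1) / s = (len - k * s - 1) / s + 1 := by
    rw [← Nat.add_div_right _ hs]; congr 1; omega
  have h3 : (len - (k + 1) * s + s - 1) / s ≤ (len - k * s - 1) / s := by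
    by_cases h4 : len - k * s ≤ s
    · have : len - (k + 1) * s + s - 1 = s - 1 := by rw [add_mul]; omega
      rw [this, Nat.div_eq_of_lt (by omega)]
      exact Nat.zero_le _
    · exact Nat.div_le_div_right (by rw [add_mul]; omega)
  omega

end WordRAM

/-! ## Lookup of a block of arguments in a block of a packed function -/

namespace WordRAM

/-! ### Arguments found in an initial part of the domain -/

section
variable {f : ℕ} {G : PackedFunction f} {X : List (BitVec f)}

theorem toNat_getD_toPacked {j : ℕ} (h : j < G.dom.length) :
    (G.toPacked.getD j 0).toNat =
      (G.dom.getD j 0).toNat * 2 ^ f + (G.g (G.dom.getD j 0)).toNat := by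
  have h' : j < G.toPacked.length := by simpa [PackedFunction.toPacked] using h
  rw [List.getD_eq_getElem _ _ h', List.getD_eq_getElem _ _ h]
  simp only [PackedFunction.toPacked, List.getElem_map, BitVec.toNat_append]
  rw [← Nat.shiftLeft_add_eq_or_of_lt (BitVec.isLt _), Nat.shiftLeft_eq]

theorem toNat_getD_toPacked_shr {j : ℕ} (h : j < G.dom.length) :
    ((G.toPacked.getD j 0).toNat >>> f) &&& (2 ^ f - 1) = (G.dom.getD j 0).toNat := by
  rw [toNat_getD_toPacked h, Nat.shiftRight_eq_div_pow, add_comm,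
    Nat.add_mul_div_right _ _ (by positivity), Nat.div_eq_of_lt (BitVec.isLt _), zero_add,
    and_two_pow_sub_one (BitVec.isLt _)]

theorem toNat_getD_toPacked_and {j : ℕ} (h : j < G.dom.length) :
    (G.toPacked.getD j 0).toNat &&& (2 ^ f - 1) = (G.g (G.dom.getD j 0)).toNat := by
  rw [toNat_getD_toPacked h, Nat.and_two_pow_sub_one_eq_mod, add_comm, Nat.add_mul_mod_self_right,
    Nat.mod_eq_of_lt (BitVec.isLt _)]

theorem getD_le_getD (hX : X.Pairwise (· ≤ ·)) {i j : ℕ} (hij : i ≤ j) (hj : j < X.length) :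
    (X.getD i 0).toNat ≤ (X.getD j 0).toNat := by
  rcases hij.eq_or_lt with rfl | h
  · exact le_rfl
  · rw [List.getD_eq_getElem _ _ hj, List.getD_eq_getElem _ _ (h.trans hj)]
    exact List.pairwise_iff_getElem.1 hX i j (h.trans hj) hj h

theorem getD_lt_getD (hX : X.Pairwise (· < ·)) {i j : ℕ} (hij : i < j) (hj : j < X.length) :
    (X.getD i 0).toNat < (X.getD j 0).toNat := by
  rw [List.getD_eq_getElem _ _ hj, List.getD_eq_getElem _ _ (hij.trans hj)]
  exact List.pairwise_iff_getElem.1 hX i j (hij.trans hj) hj hij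

theorem length_le_two_pow (hX : X.Pairwise (· < ·)) : X.length ≤ 2 ^ f := by
  have h : X.Nodup := hX.imp fun {a b} h hab => by subst hab; exact lt_irrefl a.toNat h
  have := (h.map (f := BitVec.toFin) fun a b h => BitVec.toFin_inj.1 h).length_le_card
  simpa using this

/-- The argument `x` is among the first `J` elements of the domain of `G`. -/
def Seen (G : PackedFunction f) (J : ℕ) (x : BitVec f) : Prop :=
  ∃ j < J, j < G.dom.length ∧ G.dom.getD j 0 = x

open Classical in
/-- The value of `G` at `x`, or `0` if `x` is not among the first `J` elements of the domain. -/
noncomputable def seenMap (G : PackedFunction f) (J : ℕ) (x : BitVec f) : ℕ :=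
  if Seen G J x then (G.g x).toNat else 0

theorem seenMap_of_seen {J : ℕ} {x : BitVec f} (h : Seen G J x) :
    seenMap G J x = (G.g x).toNat := if_pos h

theorem seenMap_of_not_seen {J : ℕ} {x : BitVec f} (h : ¬ Seen G J x) : seenMap G J x = 0 :=
  if_neg h

/-- The fields `J, …, J + c - 1` of `X`, followed by fields that hold the largest number. -/
def blockKeys (X : List (BitVec f)) (J c i : ℕ) : ℕ :=
  if i < c then (X.getD (J + i) 0).toNat else 2 ^ f - 1

/-- The values at the elements `J, …, J + d - 1` of the domain of `G`, followed by zeros. -/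
def blockValues (G : PackedFunction f) (J d i : ℕ) : ℕ :=
  if i < d then (G.g (G.dom.getD (J + i) 0)).toNat else 0

theorem blockKeys_lt (X : List (BitVec f)) (J c i : ℕ) : blockKeys X J c i < 2 ^ f := by
  have : 0 < 2 ^ f := by positivity
  rw [blockKeys]
  split_ifs
  · exact BitVec.isLt _
  · omega

theorem blockValues_lt (G : PackedFunction f) (J d i : ℕ) : blockValues G J d i < 2 ^ f := by
  rw [blockValues]
  split_ifs
  · exact BitVec.isLt _
  · positivity

/-- Padding with the largest number keeps the block sorted, as the merge requires. -/
theorem blockKeys_mono (hX : X.Pairwise (· ≤ ·)) {J c : ℕ} (h : J + c ≤ X.length) {i j : ℕ}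
    (hij : i ≤ j) : blockKeys X J c i ≤ blockKeys X J c j := by
  have h2 := blockKeys_lt X J c i
  rw [blockKeys] at h2 ⊢
  rw [blockKeys]
  split_ifs at h2 ⊢ with h3 h4
  · exact getD_le_getD hX (by omega) (by omega)
  · omega
  · omega
  · exact le_rfl

/-- The padding key `2 ^ f - 1` may be a genuine argument, but the padding value `0` is neutral for
or. All genuine hits for `x` deliver the same value. -/
theorem seenMap_or_gather {J d n : ℕ} (hd : d ≤ n) (hJ : J + d ≤ G.dom.length) (x : BitVec f) :
    seenMap G J x ||| gather (blockKeys G.dom J d) (blockValues G J d) x.toNat n =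
      seenMap G (J + d) x := by
  have key : ∀ b, (gather (blockKeys G.dom J d) (blockValues G J d) x.toNat n).testBit b = true ↔
      (∃ j < d, G.dom.getD (J + j) 0 = x) ∧ (G.g x).toNat.testBit b = true := by
    intro b
    rw [testBit_gather]
    constructor
    · rintro ⟨j, -, h1, h2⟩
      by_cases hj : j < d
      · rw [blockKeys, if_pos hj, ← BitVec.toNat_eq] at h1
        rw [blockValues, if_pos hj, h1] at h2
        exact ⟨⟨j, hj, h1⟩, h2⟩
      · simp [blockValues, hj] at h2
    · rintro ⟨⟨j, hj, h1⟩, h2⟩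
      refine ⟨j, by omega, ?_, ?_⟩
      · rw [blockKeys, if_pos hj, h1]
      · rw [blockValues, if_pos hj, h1, h2]
  have split : Seen G (J + d) x ↔ Seen G J x ∨ ∃ j < d, G.dom.getD (J + j) 0 = x := by
    constructor
    · rintro ⟨j, h1, h2, h3⟩
      by_cases hj : j < J
      · exact Or.inl ⟨j, hj, h2, h3⟩
      · exact Or.inr ⟨j - J, by omega, by rw [show J + (j - J) = j by omega, h3]⟩
    · rintro (⟨j, h1, h2, h3⟩ | ⟨j, h1, h2⟩)
      · exact ⟨j, by omega, h2, h3⟩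
      · exact ⟨J + j, by omega, by omega, h2⟩
  apply Nat.eq_of_testBit_eq
  intro b
  rw [Nat.testBit_or, Bool.eq_iff_iff, Bool.or_eq_true, key, seenMap, seenMap]
  by_cases h1 : Seen G J x
  · have h2 : Seen G (J + d) x := split.2 (Or.inl h1)
    simp only [if_pos h1, if_pos h2]
    tauto
  · by_cases h2 : Seen G (J + d) x
    · have h3 := (split.1 h2).resolve_left h1
      simp only [if_neg h1, if_pos h2, Nat.zero_testBit, Bool.false_eq_true, false_or]
      exact and_iff_right h3
    · have h3 : ¬ ∃ j < d, G.dom.getD (J + j) 0 = x := fun h => h2 (split.2 (Or.inr h))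
      simp only [if_neg h1, if_neg h2, Nat.zero_testBit, Bool.false_eq_true, false_or, iff_false]
      exact fun h => h3 h.1

theorem seen_lt_of_getD_lt {J κ : ℕ} (hJ : J ≤ G.dom.length)
    (h : (G.dom.getD (J - 1) 0).toNat < κ) {x : BitVec f} (hx : Seen G J x) : x.toNat < κ := by
  obtain ⟨j, h1, h2, rfl⟩ := hx
  rcases (show j ≤ J - 1 by omega).eq_or_lt with rfl | h3
  · exact h
  · exact (getD_lt_getD G.dom_increasing h3 (by omega)).trans h

theorem seen_of_le_getD {J : ℕ} (hJ : 0 < J) {x : BitVec f} (hx : x ∈ G.dom)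
    (h : x.toNat ≤ (G.dom.getD (J - 1) 0).toNat) : Seen G J x := by
  obtain ⟨j, h1, rfl⟩ := List.mem_iff_getElem.1 hx
  rw [← List.getD_eq_getElem _ 0 h1] at h ⊢
  refine ⟨j, ?_, h1, rfl⟩
  by_contra h2
  have := getD_lt_getD G.dom_increasing (show J - 1 < j by omega) h1
  omega

/-- Shows that the cursor in `G` has not run out while some argument is still open. -/
theorem lt_length_of_not_seen {J : ℕ} {x : BitVec f} (hx : x ∈ G.dom) (h : ¬ Seen G J x) :
    J < G.dom.length := by
  obtain ⟨j, h1, rfl⟩ := List.mem_iff_getElem.1 hx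
  by_contra h2
  exact h ⟨j, by omega, h1, List.getD_eq_getElem _ 0 h1⟩

/-- When the cursor leaves the last word of `G`, its nominal position may exceed the length; only
the minimum with the length matters. -/
theorem seen_congr {J J' : ℕ} (h : min J G.dom.length = min J' G.dom.length) (x : BitVec f) :
    Seen G J x ↔ Seen G J' x := by
  constructor <;>
  · rintro ⟨j, h1, h2, h3⟩
    exact ⟨j, by omega, h2, h3⟩

end

end WordRAM

/-! ## Loading a block of arguments and a block of the packed function -/

namespace WordRAM

open WordRAM.Expr in
/-- Stores in register `x` the size of the block at the cursor in the registers `i, …, i + 3`. -/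
def sizeProg (x i : ℕ) : Program :=
  .assign x (reg (i + 3) - reg (i + 1)) ;; .ifLt (reg 10) (reg x) (.assign x (reg 10)) .skip

theorem wp_sizeProg {w n len s k o x i : ℕ} {σ : State w} {base : BitVec w}
    (hi : x = 45 ∧ i = 30 ∨ x = 46 ∧ i = 34) (hn : n ≤ w) (hs : s ≤ w)
    (h10 : σ.reg 10 = BitVec.ofNat w n) (hC : Cursor σ i base len s k o)
    (ho : o ≤ min (len - k * s) s) :
    wp (sizeProg x i) 20 (fun σ' => σ'.mem = σ.mem ∧ (∀ y < 100, y ≠ x → σ'.reg y = σ.reg y) ∧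
      σ'.reg x = BitVec.ofNat w (blockSize n len s k o)) σ := by
  obtain ⟨h1, h2, h3, h4⟩ := hC
  have e1 := toNat_ofNat_of_le hn
  have e2 := toNat_ofNat_of_le (show min (len - k * s) s - o ≤ w by omega)
  rcases hi with ⟨rfl, rfl⟩ | ⟨rfl, rfl⟩ <;>
  · refine wp_assign_seq (BitVec.ofNat w (min (len - k * s) s - o)) ?_ ?_
    · simp only [Expr.eval_sub, Expr.eval_reg, h2, h4]
      exact ofNat_sub_ofNat ho
    refine wp_ifLt (T := 10) ?_ ?_ (by decide)
    · intro hc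
      simp only [Expr.eval_reg, State.set_reg] at hc
      simp only [reduceIte, Nat.reduceEqDiff, h10, e1, e2] at hc
      refine wp_assign (BitVec.ofNat w (blockSize n len s k o)) ?_ ⟨rfl, fun y _ hy => ?_, ?_⟩
      · simp [h10, blockSize, min_eq_left hc.le]
      · rw [State.set_reg, if_neg hy, State.set_reg, if_neg hy]
      · simp
    · intro hc
      simp only [Expr.eval_reg, State.set_reg] at hc
      simp only [reduceIte, Nat.reduceEqDiff, h10, e1, e2] at hc
      refine wp_mono (wp_skip ⟨rfl, fun y _ hy => ?_, ?_⟩) (show 1 ≤ 10 by decide) (fun _ h => h)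
      · rw [State.set_reg, if_neg hy]
      · rw [State.set_reg, if_pos rfl, blockSize, min_eq_right (not_lt.1 hc)]

section
variable {w f : ℕ} {G : PackedFunction f} {X : List (BitVec f)} {σ : State w}

theorem load_word {b len s k o i : ℕ} {base : BitVec w} {Y : List (BitVec b)}
    (hb : b + 1 ≤ w) (hY : Packed.StoredAt σ.mem base Y) (hs : s = w / (b + 1))
    (hlen : len = Y.length) (hC : Cursor σ i base len s k o) (hk : k * s + o < len) :
    σ.mem (σ.reg i) = pk w (b + 1) s (fun i => (Y.getD (k * s + i) 0).toNat) := by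
  subst hs
  rw [hC.addr, hY k ((lt_wordCount hb).2 (by omega)), word_eq_pk]

theorem and_or_self (x y : ℕ) : (x &&& y) ||| y = y := by
  apply Nat.eq_of_testBit_eq
  intro i
  rw [Nat.testBit_or, Nat.testBit_and]
  cases x.testBit i <;> cases y.testBit i <;> rfl

/-- The lanes from `c` on may hold fields of the next block; or-ing with all ones replaces them by
the padding. -/
theorem pk_blockKeys {n s k c o : ℕ} (hs : (f + 1) * s ≤ w) (hn : n ≤ s) (hoc : o + c ≤ s) :
    (((pk w (f + 1) s fun i => (X.getD (k * s + i) 0).toNat) >>> ((f + 1) * o)) &&&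
        pk w (f + 1) n fun _ => 2 ^ f - 1) |||
      ((~~~(0#w) <<< ((f + 1) * c)) &&& pk w (f + 1) n fun _ => 2 ^ f - 1) =
    pk w (f + 1) n (blockKeys X (k * s + o) c) := by
  have hf : 0 < f + 1 := by omega
  rw [pk_shr hf hs, pk_and_of_le hf hn, pk_high_and hf, pk_or hf]
  refine pk_congr fun i _ => ?_
  rw [blockKeys]
  by_cases h1 : i < c
  · rw [if_pos h1, if_pos (by omega), if_pos h1, Nat.or_zero, and_two_pow_sub_one (BitVec.isLt _),
      show k * s + (i + o) = k * s + o + i by ring]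
  · rw [if_neg h1, if_neg h1, and_or_self]

theorem pk_blockKeys_dom {n s k d o : ℕ} (hs : (f + f + 1) * s ≤ w) (hn : n ≤ s) (hod : o + d ≤ s)
    (hd : k * s + o + d ≤ G.dom.length) :
    ((((pk w (f + f + 1) s fun i => (G.toPacked.getD (k * s + i) 0).toNat) >>>
        ((f + f + 1) * o)) >>> f) &&& pk w (f + f + 1) n fun _ => 2 ^ f - 1) |||
      ((~~~(0#w) <<< ((f + f + 1) * d)) &&& pk w (f + f + 1) n fun _ => 2 ^ f - 1) =
    pk w (f + f + 1) n (blockKeys G.dom (k * s + o) d) := by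
  have hf : 0 < f + f + 1 := by omega
  rw [pk_shr hf hs, pk_inner_shr_and hf hn hs, pk_high_and hf, pk_or hf]
  · refine pk_congr fun i _ => ?_
    rw [blockKeys]
    by_cases h1 : i < d
    · rw [if_pos h1, if_pos (by omega), if_pos h1, Nat.or_zero,
        toNat_getD_toPacked_shr (by omega), show k * s + (i + o) = k * s + o + i by ring]
    · rw [if_neg h1, if_neg h1, and_or_self]
  · intro i _
    have : 2 ^ f ≤ 2 ^ (f + f + 1 - f) := Nat.pow_le_pow_right (by omega) (by omega)
    have : 0 < 2 ^ f := by positivity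
    omega

/-- No explicit padding is needed: below lane `n` the block ends only where the word or the sequence
ends, and the shifted word is zero from there on. -/
theorem pk_blockValues {n s k o : ℕ} (hs : (f + f + 1) * s ≤ w) (hn : n ≤ s)
    (ho : k * s + o < G.dom.length) :
    ((pk w (f + f + 1) s fun i => (G.toPacked.getD (k * s + i) 0).toNat) >>>
        ((f + f + 1) * o)) &&& (pk w (f + f + 1) n fun _ => 2 ^ f - 1) =
    pk w (f + f + 1) n (blockValues G (k * s + o) (blockSize n G.dom.length s k o)) := by
  have hf : 0 < f + f + 1 := by omega
  rw [pk_shr hf hs, pk_and_of_le hf hn]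
  refine pk_congr fun i hi => ?_
  rw [blockValues]
  by_cases h1 : i < blockSize n G.dom.length s k o
  · rw [if_pos h1]
    rw [blockSize] at h1
    rw [if_pos (by omega), toNat_getD_toPacked_and (by omega),
      show k * s + (i + o) = k * s + o + i by ring]
  · rw [if_neg h1]
    rw [blockSize] at h1
    by_cases h2 : i + o < s
    · rw [if_pos h2, List.getD_eq_default _ _ (by simp [PackedFunction.toPacked]; omega)]
      simp
    · rw [if_neg h2, Nat.zero_and]

end

open WordRAM.Expr in
/-- Loads the blocks at the two cursors. -/
def loadProg : Program :=
  sizeProg 45 30 ;;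
  sizeProg 46 34 ;;
  .assign 47 (load (reg 30)) ;;
  .assign 48 ((reg 47 >>> (reg 7 * (reg 31 + reg 45 - const 1))) &&& reg 19) ;;
  .assign 50 (((reg 47 >>> (reg 7 * reg 31)) &&& reg 20) |||
    ((Expr.not (const 0) <<< (reg 7 * reg 45)) &&& reg 20)) ;;
  .assign 47 (load (reg 34)) ;;
  .assign 49 (((reg 47 >>> (reg 8 * (reg 35 + reg 46 - const 1))) >>> reg 1) &&& reg 19) ;;
  .assign 47 (reg 47 >>> (reg 8 * reg 35)) ;;
  .assign 51 (((reg 47 >>> reg 1) &&& reg 22) |||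
    ((Expr.not (const 0) <<< (reg 8 * reg 46)) &&& reg 22)) ;;
  .assign 52 (reg 47 &&& reg 22)

theorem blockSize_pos {n len s k o : ℕ} (hn : 0 < n) (ho : o < s) (h : k * s + o < len) :
    0 < blockSize n len s k o := by
  rw [blockSize]; omega

theorem Env.two_pow_le {w f m : ℕ} {σ : State w} (h : Env w f m σ) :
    2 ^ m ≤ w / (f + f + 1) := by
  rw [Nat.le_div_iff_mul_le (by omega), mul_comm]
  exact h.fits

theorem Cursor.frame {w i len s k o : ℕ} {σ σ' : State w} {base : BitVec w}
    (h : Cursor σ i base len s k o) (hF : ∀ y, i ≤ y → y < i + 4 → σ'.reg y = σ.reg y) :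
    Cursor σ' i base len s k o := by
  obtain ⟨h1, h2, h3, h4⟩ := h
  constructor <;> rwa [hF _ (by omega) (by omega)]

theorem wp_loadProg {w f m kx ox kg og s s' : ℕ} {G : PackedFunction f} {X : List (BitVec f)}
    {σ : State w} {a b : BitVec w} (hE : Env w f m σ)
    (hs : s = w / (f + 1)) (hs' : s' = w / (f + f + 1))
    (hX : Packed.StoredAt σ.mem a X) (hG : Packed.StoredAt σ.mem b G.toPacked)
    (cX : Cursor σ 30 a X.length s kx ox) (cG : Cursor σ 34 b G.dom.length s' kg og)
    (hox : ox < s) (hx : kx * s + ox < X.length) (hog : og < s')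
    (hg : kg * s' + og < G.dom.length) :
    wp loadProg 400 (fun σ' => Frame 40 σ σ' ∧
      σ'.reg 45 = BitVec.ofNat w (blockSize (2 ^ m) X.length s kx ox) ∧
      σ'.reg 48 = BitVec.ofNat w
        (X.getD (kx * s + ox + blockSize (2 ^ m) X.length s kx ox - 1) 0).toNat ∧
      σ'.reg 49 = BitVec.ofNat w
        (G.dom.getD (kg * s' + og + blockSize (2 ^ m) G.dom.length s' kg og - 1) 0).toNat ∧
      σ'.reg 50 = pk w (f + 1) (2 ^ m)
        (blockKeys X (kx * s + ox) (blockSize (2 ^ m) X.length s kx ox)) ∧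
      σ'.reg 51 = pk w (f + f + 1) (2 ^ m)
        (blockKeys G.dom (kg * s' + og) (blockSize (2 ^ m) G.dom.length s' kg og)) ∧
      σ'.reg 52 = pk w (f + f + 1) (2 ^ m)
        (blockValues G (kg * s' + og) (blockSize (2 ^ m) G.dom.length s' kg og))) σ := by
  have hf := hE.f_pos
  have hw := hE.width
  have hn : 0 < 2 ^ m := by positivity
  have hn' : 2 ^ m ≤ s' := hs' ▸ hE.two_pow_le
  have hss : s' ≤ s := by rw [hs, hs']; exact Nat.div_le_div_left (by omega) (by omega)
  have hsw : (f + 1) * s ≤ w := hs ▸ Nat.mul_div_le _ _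
  have hsw' : (f + f + 1) * s' ≤ w := hs' ▸ Nat.mul_div_le _ _
  have hs1 : s ≤ w := (Nat.le_mul_of_pos_left _ (by omega)).trans hsw
  have hc := blockSize_pos hn hox hx
  have hd := blockSize_pos hn hog hg
  have hc1 : ox + blockSize (2 ^ m) X.length s kx ox ≤ s := by rw [blockSize]; omega
  have hd1 : og + blockSize (2 ^ m) G.dom.length s' kg og ≤ s' := by rw [blockSize]; omega
  have hc2 : kx * s + ox + blockSize (2 ^ m) X.length s kx ox ≤ X.length := by
    rw [blockSize]; omega
  have hd2 : kg * s' + og + blockSize (2 ^ m) G.dom.length s' kg og ≤ G.dom.length := by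
    rw [blockSize]; omega
  refine wp_run_seq 370 (wp_sizeProg (Or.inl ⟨rfl, rfl⟩) (by omega) hs1 hE.r10 cX (by omega)) ?_
    (by decide)
  rintro σ₁ ⟨m₁, r₁, h45⟩
  have F₁ : Frame 40 σ σ₁ := ⟨m₁, fun y hy => r₁ y (by omega) (by omega)⟩
  refine wp_run_seq 350 (wp_sizeProg (Or.inr ⟨rfl, rfl⟩) (by omega) (by omega)
    (hE.frame F₁).r10 (cG.frame fun y _ _ => F₁.reg y (by omega)) (by omega)) ?_ (by decide)
  rintro σ₂ ⟨m₂, r₂, h46⟩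
  have F₂ : Frame 40 σ σ₂ := F₁.trans ⟨m₂, fun y hy => r₂ y (by omega) (by omega)⟩
  rw [← r₂ 45 (by decide) (by decide)] at h45
  generalize blockSize (2 ^ m) X.length s kx ox = c at *
  have hv := pk_blockValues hsw' hn' hg
  generalize blockSize (2 ^ m) G.dom.length s' kg og = d at *
  have hE₂ := hE.frame F₂
  have cX₂ := cX.frame (σ' := σ₂) fun y _ _ => F₂.reg y (by omega)
  have cG₂ := cG.frame (σ' := σ₂) fun y _ _ => F₂.reg y (by omega)
  have lX := load_word (σ := σ₂) (by omega) (F₂.mem ▸ hX) hs rfl cX₂ hx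
  have lG := load_word (σ := σ₂) (by omega) (F₂.mem ▸ hG) hs'
    (show G.dom.length = _ by simp [PackedFunction.toPacked]) cG₂ hg
  have h31 : σ₂.reg 31 = _ := cX₂.off
  have h35 : σ₂.reg 35 = _ := cG₂.off
  -- The shift distances are at most the width of all fields in a word, hence at most `w`, and do
  -- not wrap around.
  have t1 : (BitVec.ofNat w (f + 1) * BitVec.ofNat w ox).toNat = (f + 1) * ox := by
    rw [← BitVec.ofNat_mul, toNat_ofNat_of_le ((Nat.mul_le_mul_left _ hox.le).trans hsw)]
  have t2 : (BitVec.ofNat w (f + 1) * BitVec.ofNat w c).toNat = (f + 1) * c := by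
    rw [← BitVec.ofNat_mul,
      toNat_ofNat_of_le ((Nat.mul_le_mul_left _ (by omega)).trans hsw)]
  have t3 : (BitVec.ofNat w (f + 1) *
      (BitVec.ofNat w ox + BitVec.ofNat w c - BitVec.ofNat w 1)).toNat =
      (f + 1) * (ox + c - 1) := by
    rw [← BitVec.ofNat_add, ofNat_sub_ofNat (by omega), ← BitVec.ofNat_mul,
      toNat_ofNat_of_le ((Nat.mul_le_mul_left _ (by omega)).trans hsw)]
  have t4 : (BitVec.ofNat w (f + f + 1) * BitVec.ofNat w og).toNat = (f + f + 1) * og := by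
    rw [← BitVec.ofNat_mul, toNat_ofNat_of_le ((Nat.mul_le_mul_left _ hog.le).trans hsw')]
  have t5 : (BitVec.ofNat w (f + f + 1) * BitVec.ofNat w d).toNat = (f + f + 1) * d := by
    rw [← BitVec.ofNat_mul,
      toNat_ofNat_of_le ((Nat.mul_le_mul_left _ (by omega)).trans hsw')]
  have t6 : (BitVec.ofNat w (f + f + 1) *
      (BitVec.ofNat w og + BitVec.ofNat w d - BitVec.ofNat w 1)).toNat =
      (f + f + 1) * (og + d - 1) := by
    rw [← BitVec.ofNat_add, ofNat_sub_ofNat (by omega), ← BitVec.ofNat_mul,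
      toNat_ofNat_of_le ((Nat.mul_le_mul_left _ (by omega)).trans hsw')]
  have t7 := toNat_ofNat_of_le (show f ≤ w by omega)
  refine wp_assign_seq _ lX ?_
  refine wp_assign_seq (BitVec.ofNat w (X.getD (kx * s + ox + c - 1) 0).toNat) ?_ ?_
  · simp only [Expr.eval_and, Expr.eval_shr, Expr.eval_mul, Expr.eval_sub, Expr.eval_add,
      Expr.eval_reg, Expr.eval_const, State.set_reg]
    simp only [reduceIte, Nat.reduceEqDiff, hE₂.r7, h31, h45, t3, hE₂.r19]
    have := pk_lane (w := w) (b := f + 1) (n := s) (f := f) (e := 0) (i := ox + c - 1)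
      (v := fun i => (X.getD (kx * s + i) 0).toNat) (by omega) hsw (by omega) (by omega)
    rw [BitVec.ushiftRight_zero, Nat.shiftRight_zero, and_two_pow_sub_one (BitVec.isLt _)] at this
    rw [this, show kx * s + (ox + c - 1) = kx * s + ox + c - 1 by omega]
  refine wp_assign_seq (pk w (f + 1) (2 ^ m) (blockKeys X (kx * s + ox) c)) ?_ ?_
  · simp only [Expr.eval_and, Expr.eval_or, Expr.eval_not, Expr.eval_shl, Expr.eval_shr,
      Expr.eval_mul, Expr.eval_reg, Expr.eval_const, State.set_reg]
    simp only [reduceIte, Nat.reduceEqDiff, hE₂.r7, h31, h45, t1, t2, hE₂.r20]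
    exact pk_blockKeys hsw (hn'.trans hss) hc1
  refine wp_assign_seq _ (by
    simp only [Expr.eval_load, Expr.eval_reg, State.set_reg, State.set_mem]
    simp only [reduceIte, Nat.reduceEqDiff]
    exact lG) ?_
  refine wp_assign_seq (BitVec.ofNat w (G.dom.getD (kg * s' + og + d - 1) 0).toNat) ?_ ?_
  · simp only [Expr.eval_and, Expr.eval_shr, Expr.eval_mul, Expr.eval_sub, Expr.eval_add,
      Expr.eval_reg, Expr.eval_const, State.set_reg]
    simp only [reduceIte, Nat.reduceEqDiff, hE₂.r8, hE₂.r1, h35, h46, t6, t7, hE₂.r19]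
    rw [pk_lane (by omega) hsw' (by omega) (by omega), toNat_getD_toPacked_shr (by omega),
      show kg * s' + (og + d - 1) = kg * s' + og + d - 1 by omega]
  refine wp_assign_seq ((pk w (f + f + 1) s' fun i => (G.toPacked.getD (kg * s' + i) 0).toNat) >>>
    ((f + f + 1) * og)) ?_ ?_
  · simp only [Expr.eval_shr, Expr.eval_mul, Expr.eval_reg, State.set_reg]
    simp only [reduceIte, Nat.reduceEqDiff, hE₂.r8, h35, t4]
  refine wp_assign_seq (pk w (f + f + 1) (2 ^ m) (blockKeys G.dom (kg * s' + og) d)) ?_ ?_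
  · simp only [Expr.eval_and, Expr.eval_or, Expr.eval_not, Expr.eval_shl, Expr.eval_shr,
      Expr.eval_mul, Expr.eval_reg, Expr.eval_const, State.set_reg]
    simp only [reduceIte, Nat.reduceEqDiff, hE₂.r8, hE₂.r1, h46, t5, t7, hE₂.r22]
    exact pk_blockKeys_dom hsw' hn' hd1 hd2
  refine wp_assign (pk w (f + f + 1) (2 ^ m) (blockValues G (kg * s' + og) d)) ?_ ?_
  · simp only [Expr.eval_and, Expr.eval_reg, State.set_reg]
    simp only [reduceIte, Nat.reduceEqDiff, hE₂.r22]
    exact hv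
  refine ⟨?_, by simp [h45], by simp, by simp, by simp, by simp, by simp⟩
  repeat refine Frame.set ?_ (by decide)
  exact F₂

end WordRAM

/-! ## One round of the main loop -/

namespace WordRAM

open WordRAM.Expr in
/-- Adds the values found for the current block of arguments to the current word of the output. -/
def storeProg : Program :=
  .assign 39 (reg 39 ||| ((reg 59 &&& (reg 20 ^^^
    ((Expr.not (const 0) <<< (reg 7 * reg 45)) &&& reg 20))) <<< (reg 7 * reg 31))) ;;
  .write (reg 6 + (reg 30 - reg 4)) (reg 39)

open WordRAM.Expr in
/-- Advances the cursor in `G`, or the cursor in `X` when all arguments of its block are treated. -/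
def nextProg : Program :=
  .ifLt (reg 49) (reg 48) (advance 34 24)
    (advance 30 23 ;; .ifLt (const 0) (reg 31) .skip (.assign 39 (const 0)))

section
variable {w f : ℕ} {G : PackedFunction f} {X : List (BitVec f)}

/-- The fields of the `k`-th word of the output when the first `o` fields are complete and, for the
`c` fields that follow, only the first `J` elements of the domain have been searched. -/
noncomputable def accLane (G : PackedFunction f) (X : List (BitVec f)) (J k s o c i : ℕ) : ℕ :=
  if i < o then (G.g (X.getD (k * s + i) 0)).toNat
  else if i < o + c then seenMap G J (X.getD (k * s + i) 0) else 0

theorem accLane_congr {J J' k s o c : ℕ} (h : ∀ x, Seen G J x ↔ Seen G J' x) :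
    accLane G X J k s o c = accLane G X J' k s o c := by
  have h' : seenMap G J = seenMap G J' := by
    funext x
    by_cases hx : Seen G J x
    · rw [seenMap_of_seen hx, seenMap_of_seen ((h x).1 hx)]
    · rw [seenMap_of_not_seen hx, seenMap_of_not_seen (fun h' => hx ((h x).2 h'))]
  funext i
  rw [accLane, accLane, h']

/-- The values found are cut to the `c` genuine lanes, since padding lanes may also find a value,
and shifted to the position of the block in the output word. -/
theorem pk_accLane_or {J k s o c d n : ℕ} (hoc : o + c ≤ s) (hc : c ≤ n) (hd : d ≤ n)
    (hJ : J + d ≤ G.dom.length) :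
    pk w (f + 1) s (accLane G X J k s o c) |||
      ((pk w (f + 1) n (fun i => gather (blockKeys G.dom J d) (blockValues G J d)
          (blockKeys X (k * s + o) c i) n) &&&
        ((pk w (f + 1) n fun _ => 2 ^ f - 1) ^^^
          ((~~~(0#w) <<< ((f + 1) * c)) &&& pk w (f + 1) n fun _ => 2 ^ f - 1))) <<<
        ((f + 1) * o)) =
    pk w (f + 1) s (accLane G X (J + d) k s o c) := by
  have hf : 0 < f + 1 := by omega
  have e1 : pk w (f + 1) n (fun i => gather (blockKeys G.dom J d) (blockValues G J d)
      (blockKeys X (k * s + o) c i) n &&& ((2 ^ f - 1) ^^^ if i < c then 0 else 2 ^ f - 1)) =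
      pk w (f + 1) c (fun i => gather (blockKeys G.dom J d) (blockValues G J d)
        (X.getD (k * s + o + i) 0).toNat n) := by
    rw [pk_extend hc]
    · refine pk_congr fun i hi => ?_
      rw [if_pos hi, Nat.xor_zero, and_two_pow_sub_one, blockKeys, if_pos hi]
      exact gather_lt (fun j _ => blockValues_lt _ _ _ _) _
    · intro i hi _
      rw [if_neg (by omega), Nat.xor_self, Nat.and_zero]
  have e2 : pk w (f + 1) (o + c) (fun i => if i < o then 0 else
      gather (blockKeys G.dom J d) (blockValues G J d)
        (X.getD (k * s + o + (i - o)) 0).toNat n) =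
      pk w (f + 1) s (fun i => if i < o ∨ o + c ≤ i then 0 else
        gather (blockKeys G.dom J d) (blockValues G J d) (X.getD (k * s + i) 0).toNat n) := by
    rw [pk_extend hoc]
    · refine pk_congr fun i hi => ?_
      by_cases h : i < o
      · rw [if_pos h, if_pos (Or.inl h)]
      · rw [if_neg h, if_neg (by omega), show k * s + o + (i - o) = k * s + i by omega]
    · intro i h1 _
      rw [if_pos (Or.inr h1)]
  rw [pk_high_and hf, pk_xor hf, pk_and hf, e1, pk_shl hf, e2, pk_or hf]
  refine pk_congr fun i _ => ?_
  rw [accLane, accLane]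
  by_cases h1 : i < o
  · rw [if_pos h1, if_pos h1, if_pos (Or.inl h1), Nat.or_zero]
  · rw [if_neg h1, if_neg h1]
    by_cases h2 : i < o + c
    · rw [if_pos h2, if_pos h2, if_neg (by omega)]
      exact seenMap_or_gather hd hJ _
    · rw [if_neg h2, if_neg h2, if_pos (by omega), Nat.zero_or]

theorem word_map_eq_pk {J k o c s : ℕ} (hs : s = w / (f + 1))
    (ho : k * s + o ≤ X.length)
    (hoc : o + c = min (X.length - k * s) s)
    (h : ∀ i < c, Seen G J (X.getD (k * s + o + i) 0)) :
    Packed.word w (G.map X) k = pk w (f + 1) s (accLane G X J k s o c) := by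
  rw [word_eq_pk, ← hs]
  refine pk_congr fun i hi => ?_
  rw [accLane]
  by_cases h0 : k * s + i < X.length
  · have e : ((G.map X).getD (k * s + i) 0) =
        G.g (X.getD (k * s + i) 0) := by
      rw [List.getD_eq_getElem _ _ (by simpa [PackedFunction.map] using h0),
        List.getD_eq_getElem _ _ h0]
      simp [PackedFunction.map]
    rw [e]
    by_cases h1 : i < o
    · rw [if_pos h1]
    · have := h (i - o) (by omega)
      rw [show k * s + o + (i - o) = k * s + i by omega] at this
      rw [if_neg h1, if_pos (by omega), seenMap_of_seen this]
  · rw [List.getD_eq_default _ _ (by simp [PackedFunction.map]; omega), if_neg (by omega),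
      if_neg (by omega)]
    simp

end

theorem wp_storeProg {w f m J d kx ox s len : ℕ} {G : PackedFunction f} {X : List (BitVec f)}
    {σ : State w} {a p : BitVec w} (hE : Env w f m σ) (hs : s = w / (f + 1))
    (h4 : σ.reg 4 = a) (h6 : σ.reg 6 = p)
    (cX : Cursor σ 30 a len s kx ox) (hox : ox < s)
    {c : ℕ} (hoc : ox + c ≤ s) (hc : c ≤ 2 ^ m) (hd : d ≤ 2 ^ m) (hJ : J + d ≤ G.dom.length)
    (h39 : σ.reg 39 = pk w (f + 1) s (accLane G X J kx s ox c))
    (h45 : σ.reg 45 = BitVec.ofNat w c)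
    (h59 : σ.reg 59 = pk w (f + 1) (2 ^ m) (fun i => gather (blockKeys G.dom J d)
      (blockValues G J d) (blockKeys X (kx * s + ox) c i) (2 ^ m))) :
    wp storeProg 60 (fun σ' => σ' = (σ.set 39 (pk w (f + 1) s (accLane G X (J + d) kx s ox c))).put
      (p + BitVec.ofNat w kx) (pk w (f + 1) s (accLane G X (J + d) kx s ox c))) σ := by
  have hsw : (f + 1) * s ≤ w := hs ▸ Nat.mul_div_le _ _
  have t1 : (BitVec.ofNat w (f + 1) * BitVec.ofNat w ox).toNat = (f + 1) * ox := by
    rw [← BitVec.ofNat_mul, toNat_ofNat_of_le ((Nat.mul_le_mul_left _ hox.le).trans hsw)]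
  have t2 : (BitVec.ofNat w (f + 1) * BitVec.ofNat w c).toNat = (f + 1) * c := by
    rw [← BitVec.ofNat_mul, toNat_ofNat_of_le ((Nat.mul_le_mul_left _ (by omega)).trans hsw)]
  have h31 : σ.reg 31 = _ := cX.off
  refine wp_assign_seq (pk w (f + 1) s (accLane G X (J + d) kx s ox c)) ?_ ?_
  · simp only [Expr.eval_and, Expr.eval_or, Expr.eval_xor, Expr.eval_not, Expr.eval_shl,
      Expr.eval_mul, Expr.eval_reg, Expr.eval_const]
    simp only [h39, h59, hE.r7, h31, h45, t1, t2, hE.r20]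
    exact pk_accLane_or hoc hc hd hJ
  · refine wp_write (p + BitVec.ofNat w kx) _ ?_ rfl ?_
    · simp [cX.addr, h4, h6]
    · simp

end WordRAM

/-! ## The main loop -/

namespace WordRAM

theorem wp_advance_potential {w n len s k o i r : ℕ} {σ : State w} {base : BitVec w}
    (hir : i = 30 ∧ r = 23 ∨ i = 34 ∧ r = 24) (hw : 3 ≤ w) (hn0 : 0 < n) (hn : n ≤ w) (hs : s ≤ w)
    (ho : o < s) (hlen : len < 2 ^ w) (h10 : σ.reg 10 = BitVec.ofNat w n)
    (hr : σ.reg r = BitVec.ofNat w s) (hC : Cursor σ i base len s k o) (hk : k * s + o < len) :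
    wp (advance i r) 50 (fun σ' => σ'.mem = σ.mem ∧
      (∀ y < 100, ¬ (i ≤ y ∧ y < i + 4) → σ'.reg y = σ.reg y) ∧
      ∃ k' o', Cursor σ' i base len s k' o' ∧ o' < s ∧ (k' * s < len → k' * s + o' < len) ∧
        potential n len s k' o' < potential n len s k o ∧
        (k' = k ∧ o' = o + n ∧ blockSize n len s k o = n ∨
          k' = k + 1 ∧ o' = 0 ∧ o + blockSize n len s k o = min (len - k * s) s)) σ := by
  refine wp_mono (wp_advance hir hw hn hs (by omega) hlen h10 hr hC) le_rfl ?_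
  rintro σ' ⟨hm, hreg, h1, h2⟩
  refine ⟨hm, hreg, ?_⟩
  by_cases h : o + n < min (len - k * s) s
  · exact ⟨k, o + n, h1 h, by omega, by omega, potential_advance_within hn0 h,
      Or.inl ⟨rfl, rfl, by rw [blockSize]; omega⟩⟩
  · exact ⟨k + 1, 0, h2 h, by omega, by omega, potential_advance_word (by omega) ho.le (by omega),
      Or.inr ⟨rfl, rfl, by rw [blockSize]; omega⟩⟩

/-- The invariant of the main loop, with the cursor in `X` at field `ox` of the word `kx` and the
cursor in `G` at field `og` of the word `kg`. -/
structure MapInv {w f : ℕ} (m : ℕ) (G : PackedFunction f) (X : List (BitVec f)) (a b p : BitVec w)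
    (s s' kx ox kg og : ℕ) (σ : State w) : Prop where
  env : Env w f m σ
  reg4 : σ.reg 4 = a
  reg6 : σ.reg 6 = p
  stored_X : Packed.StoredAt σ.mem a X
  stored_G : Packed.StoredAt σ.mem b G.toPacked
  cursor_X : Cursor σ 30 a X.length s kx ox
  cursor_G : Cursor σ 34 b G.dom.length s' kg og
  off_X : ox < s
  off_G : og < s'
  pos_X : kx * s < X.length → kx * s + ox < X.length
  done : ∀ j < kx, j < Packed.wordCount w f X.length →
    σ.mem (p + BitVec.ofNat w j) = Packed.word w (G.map X) j
  acc : kx * s < X.length → σ.reg 39 = pk w (f + 1) s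
    (accLane G X (kg * s' + og) kx s ox
      (blockSize (2 ^ m) X.length s kx ox))
  seen : kx * s < X.length → ∀ x, Seen G (kg * s' + og) x →
    x.toNat < (X.getD (kx * s + ox +
      blockSize (2 ^ m) X.length s kx ox - 1) 0).toNat

/-- The body of the main loop. -/
def roundProg : Program := loadProg ;; lookupProg ;; storeProg ;; nextProg

/-- The decisive part of the invariant is `seen`: all domain elements passed so far are below the
last argument of the current block. Hence that argument is still open and `G` is not exhausted. The
comparison of the last keys of the blocks preserves this. If the cursor in `X` moves, the block of
`G` stays and is searched again, because it may also contain later arguments. -/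
theorem wp_roundProg {w f m s s' kx ox kg og : ℕ} {G : PackedFunction f} {X : List (BitVec f)}
    {a b p : BitVec w} {σ : State w} (hX : X.Pairwise (· ≤ ·)) (hdom : ∀ x ∈ X, x ∈ G.dom)
    (hr : X.length ≤ 2 ^ f) (hs : s = w / (f + 1)) (hs' : s' = w / (f + f + 1))
    (dX : Disjoint (Packed.block a (Packed.wordCount w f X.length))
      (Packed.block p (Packed.wordCount w f X.length)))
    (dG : Disjoint (Packed.block b (Packed.wordCount w (f + f) G.dom.length))
      (Packed.block p (Packed.wordCount w f X.length)))
    (hI : MapInv m G X a b p s s' kx ox kg og σ) (hk : kx * s < X.length) :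
    wp roundProg (4000 * (m + 1)) (fun σ' => ∃ kx' ox' kg' og',
      potential (2 ^ m) X.length s kx' ox' +
        potential (2 ^ m) G.dom.length s' kg' og' <
      potential (2 ^ m) X.length s kx ox +
        potential (2 ^ m) G.dom.length s' kg og ∧
      MapInv m G X a b p s s' kx' ox' kg' og' σ') σ := by
  obtain ⟨hE, h4, h6, sX, sG, cX, cG, hox, hog, px, done, acc, seen⟩ := hI
  have hx := px hk
  replace acc := acc hk
  replace seen := seen hk
  have hf := hE.f_pos
  have hw := hE.width
  have hn : 0 < 2 ^ m := by positivity
  have hfw : 2 ^ f < 2 ^ w := Nat.pow_lt_pow_right (by omega) (by omega)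
  have hrw : X.length < 2 ^ w := hr.trans_lt hfw
  have huw : G.dom.length < 2 ^ w := (length_le_two_pow G.dom_increasing).trans_lt hfw
  have hn' : 2 ^ m ≤ s' := hs' ▸ hE.two_pow_le
  have hss : s' ≤ s := by rw [hs, hs']; exact Nat.div_le_div_left (by omega) (by omega)
  have hsw : (f + 1) * s ≤ w := hs ▸ Nat.mul_div_le _ _
  have hs1 : s ≤ w := (Nat.le_mul_of_pos_left _ (by omega)).trans hsw
  have hwc := lt_wordCount (w := w) (f := f) (r := X.length) (k := kx) (by omega)
  rw [← hs] at hwc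
  obtain ⟨c, ec⟩ : ∃ c, c = blockSize (2 ^ m) X.length s kx ox := ⟨_, rfl⟩
  obtain ⟨d, ed⟩ : ∃ d, d = blockSize (2 ^ m) G.dom.length s' kg og := ⟨_, rfl⟩
  have hc := blockSize_pos hn hox hx
  rw [← ec] at hc acc seen
  have hc1 : ox + c ≤ s := by rw [ec, blockSize]; omega
  have hc2 : kx * s + ox + c ≤ X.length := by rw [ec, blockSize]; omega
  have hc3 : c ≤ 2 ^ m := by rw [ec, blockSize]; omega
  have hmem : ∀ j < X.length, X.getD j 0 ∈ G.dom := fun j hj => hdom _ (by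
    rw [List.getD_eq_getElem _ _ hj]; exact List.getElem_mem hj)
  -- Since `X` is sorted, the last argument of the block and all later ones are beyond every domain
  -- element passed so far.
  have hnseen : ∀ j, kx * s + ox + c - 1 ≤ j → j < X.length →
      ¬ Seen G (kg * s' + og) (X.getD j 0) := fun j h1 h2 h => by
    have h3 := seen _ h
    have h4 := getD_le_getD hX h1 h2
    omega
  have hg : kg * s' + og < G.dom.length :=
    lt_length_of_not_seen (hmem _ (show kx * s + ox + c - 1 < _ by omega))
      (hnseen _ le_rfl (by omega))
  have hd := blockSize_pos hn hog hg
  rw [← ed] at hd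
  have hd2 : kg * s' + og + d ≤ G.dom.length := by rw [ed, blockSize]; omega
  have hd3 : d ≤ 2 ^ m := by rw [ed, blockSize]; omega
  refine wp_run_seq (3500 * (m + 1)) (wp_loadProg hE hs hs' sX sG cX cG hox hx hog hg) ?_ (by omega)
  rintro σ₁ ⟨F₁, h45, h48, h49, h50, h51, h52⟩
  rw [← ec] at h45 h48 h50
  rw [← ed] at h49 h51 h52
  refine wp_run_seq (200 * (m + 1)) (wp_lookupProg (hE.frame F₁)
    (fun i _ => blockKeys_lt _ _ _ i) (fun i _ => blockKeys_lt _ _ _ i)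
    (fun i _ => blockValues_lt _ _ _ i) (fun i j hij _ => blockKeys_mono hX hc2 hij)
    (fun i j hij _ => blockKeys_mono
      (G.dom_increasing.imp fun {x y} (h : x.toNat < y.toNat) => show x.toNat ≤ y.toNat from h.le)
      hd2 hij) h50 h51 h52) ?_ (by omega)
  rintro σ₂ ⟨F₂, h59⟩
  have F : Frame 40 σ σ₂ := F₁.trans (F₂.mono (by decide))
  rw [← F₂.reg _ (by decide)] at h45 h48 h49
  refine wp_run_seq 120 (wp_storeProg (hE.frame F) hs ((F.reg 4 (by decide)).trans h4)
    ((F.reg 6 (by decide)).trans h6) (cX.frame fun y _ _ => F.reg y (by omega)) hox hc1 hc3 hd3 hd2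
    ((F.reg 39 (by decide)).trans acc) h45 h59) ?_ (by omega)
  rintro σ₃ rfl
  obtain ⟨v, ev⟩ : ∃ v, v = pk w (f + 1) s (accLane G X (kg * s' + og + d) kx s ox c) := ⟨_, rfl⟩
  obtain ⟨σ₃, e₃⟩ : ∃ σ₃, σ₃ = (σ₂.set 39 v).put (p + BitVec.ofNat w kx) v := ⟨_, rfl⟩
  rw [← ev, ← e₃]
  have r₃ : ∀ y < 40, y ≠ 39 → σ₃.reg y = σ.reg y := fun y h1 h2 => by
    rw [e₃, State.put_reg, State.set_reg, if_neg h2, F.reg y h1]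
  have hne : ∀ q, q ≠ p + BitVec.ofNat w kx → σ₃.mem q = σ.mem q := fun q h1 => by
    rw [e₃, State.put_mem, if_neg h1, State.set_mem, F.mem]
  have sX₃ : Packed.StoredAt σ₃.mem a X := fun j hj => by
    rw [hne _ fun h => Set.disjoint_left.1 dX ⟨j, hj, rfl⟩ ⟨kx, hwc.2 hk, h⟩, sX j hj]
  have hlen : G.toPacked.length = G.dom.length := by simp [PackedFunction.toPacked]
  have sG₃ : Packed.StoredAt σ₃.mem b G.toPacked := fun j hj => by
    rw [hne _ fun h => Set.disjoint_left.1 dG ⟨j, hlen ▸ hj, rfl⟩ ⟨kx, hwc.2 hk, h⟩, sG j hj]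
  -- Word numbers are below `2 ^ w`, so different words of the output have different addresses and
  -- earlier ones are not overwritten.
  have done₃ : ∀ j < kx, j < Packed.wordCount w f X.length →
      σ₃.mem (p + BitVec.ofNat w j) = Packed.word w (G.map X) j := fun j h1 h2 => by
    rw [hne _ fun h => ?_, done j h1 h2]
    have h3 := congrArg BitVec.toNat (add_left_cancel h)
    have h4 : kx ≤ kx * s := Nat.le_mul_of_pos_right _ (by omega)
    rw [BitVec.toNat_ofNat, BitVec.toNat_ofNat, Nat.mod_eq_of_lt (by omega),
      Nat.mod_eq_of_lt (by omega)] at h3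
    omega
  have h39 : σ₃.reg 39 = v := by rw [e₃, State.put_reg, State.set_reg, if_pos rfl]
  have h48' : σ₃.reg 48 = σ₂.reg 48 := by
    rw [e₃, State.put_reg, State.set_reg, if_neg (by decide)]
  rw [h48] at h48'
  have h49' : σ₃.reg 49 = σ₂.reg 49 := by
    rw [e₃, State.put_reg, State.set_reg, if_neg (by decide)]
  rw [h49] at h49'
  have hE₃ : Env w f m σ₃ := hE.congr fun y hy => r₃ y (by omega) (by omega)
  have cX₃ := cX.frame (σ' := σ₃) fun y _ _ => r₃ y (by omega) (by omega)
  have cG₃ := cG.frame (σ' := σ₃) fun y _ _ => r₃ y (by omega) (by omega)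
  have tkey : ∀ x : BitVec f, (BitVec.ofNat w x.toNat).toNat = x.toNat := fun x => by
    rw [BitVec.toNat_ofNat, Nat.mod_eq_of_lt (x.isLt.trans hfw)]
  refine wp_ifLt (T := 100) ?_ ?_ (by decide)
  · intro hlt
    simp only [Expr.eval_reg, h48', h49', tkey] at hlt
    refine wp_mono (wp_advance_potential (Or.inr ⟨rfl, rfl⟩) (by omega) hn (by omega) (by omega) hog
      huw hE₃.r10 (by rw [hE₃.r24, hs']) cG₃ hg) (by decide) ?_
    rintro σ₄ ⟨m₄, r₄, kg', og', cG₄, hog', -, hpot, hcase⟩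
    -- At a change of word the new position is the start of the next word, which may lie beyond the
    -- end of the domain.
    have hJ : min (kg' * s' + og') G.dom.length = min (kg * s' + og + d) G.dom.length := by
      rcases hcase with ⟨rfl, rfl, h⟩ | ⟨rfl, rfl, h⟩
      · rw [ed, h, add_assoc]
      · rw [← ed] at h
        rw [add_mul]
        omega
    have hseen := seen_congr (G := G) hJ
    refine ⟨kx, ox, kg', og', by omega, hE₃.congr fun y hy => r₄ y (by omega) (by omega),
      ?_, ?_, m₄ ▸ sX₃, m₄ ▸ sG₃, cX₃.frame fun y _ _ => r₄ y (by omega) (by omega), cG₄, hox, hog',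
      px, m₄ ▸ done₃, fun _ => ?_, fun _ x hx => ?_⟩
    · rw [r₄ _ (by decide) (by decide), r₃ _ (by decide) (by decide), h4]
    · rw [r₄ _ (by decide) (by decide), r₃ _ (by decide) (by decide), h6]
    · rw [r₄ _ (by decide) (by decide), h39, ev, ← ec, accLane_congr hseen]
    · rw [← ec]
      exact seen_lt_of_getD_lt hd2 hlt ((hseen x).1 hx)
  · intro hge
    simp only [Expr.eval_reg, h48', h49', tkey] at hge
    -- All arguments of the block are at most the last domain element searched, and they belong to
    -- the domain, so they have been found.
    have hall : ∀ i < c, Seen G (kg * s' + og + d) (X.getD (kx * s + ox + i) 0) := fun i hi =>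
      seen_of_le_getD (by omega) (hmem _ (by omega))
        ((getD_le_getD hX (show _ ≤ kx * s + ox + c - 1 by omega) (by omega)).trans (not_lt.1 hge))
    refine wp_run_seq 40 (wp_advance_potential (Or.inl ⟨rfl, rfl⟩) (by omega) hn (by omega) hs1 hox
      hrw hE₃.r10 (by rw [hE₃.r23, hs]) cX₃ hx) ?_ (by decide)
    rintro σ₄ ⟨m₄, r₄, kx', ox', cX₄, hox', px', hpot, hcase⟩
    have h31 : σ₄.reg 31 = _ := cX₄.off
    have hoxw := toNat_ofNat_of_le (show ox' ≤ w by omega)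
    have h39' : σ₄.reg 39 = v := by rw [r₄ _ (by decide) (by decide), h39]
    -- The accumulator is cleared exactly when the offset is `0`, that is, when a new word of the
    -- output begins.
    refine wp_mono (Q := fun σ' => σ'.mem = σ₃.mem ∧ (∀ y < 39, σ'.reg y = σ₄.reg y) ∧
      σ'.reg 39 = if 0 < ox' then v else 0) ?_ le_rfl ?_
    · refine wp_ifLt (T := 10) ?_ ?_ (by decide)
      · intro h
        simp only [Expr.eval_reg, Expr.eval_const, h31, hoxw, BitVec.toNat_ofNat, Nat.zero_mod] at h
        refine wp_mono (wp_skip ⟨m₄, fun _ _ => rfl, ?_⟩) (show 1 ≤ 10 by decide) (fun _ h => h)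
        rw [if_pos h, h39']
      · intro h
        simp only [Expr.eval_reg, Expr.eval_const, h31, hoxw, BitVec.toNat_ofNat, Nat.zero_mod] at h
        refine wp_assign 0 rfl ⟨m₄, fun y hy => ?_, ?_⟩
        · rw [State.set_reg, if_neg (by omega)]
        · rw [State.set_reg, if_pos rfl, if_neg h]
    rintro σ₅ ⟨m₅, r₅, h39₅⟩
    have r₅' : ∀ y < 39, ¬ (30 ≤ y ∧ y < 34) → σ₅.reg y = σ.reg y := fun y h1 h2 => by
      rw [r₅ y h1, r₄ y (by omega) (by omega), r₃ y (by omega) (by omega)]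
    have hnew : ∀ x, kx' * s < X.length → Seen G (kg * s' + og) x → x.toNat <
        (X.getD (kx' * s + ox' + blockSize (2 ^ m) X.length s kx' ox' - 1) 0).toNat :=
      fun x h1 h2 => by
      have h3 := blockSize_pos hn hox' (px' h1)
      have h4 : kx' * s + ox' + blockSize (2 ^ m) X.length s kx' ox' ≤ X.length := by
        have := px' h1
        rw [blockSize]; omega
      refine (seen x h2).trans_le (getD_le_getD hX ?_ (by omega))
      rcases hcase with ⟨rfl, rfl, h⟩ | ⟨rfl, rfl, h⟩
      · omega
      · rw [add_mul] at *
        omega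
    refine ⟨kx', ox', kg, og, by omega, hE.congr fun y hy => r₅' y (by omega) (by omega),
      ?_, ?_, m₅ ▸ sX₃, m₅ ▸ sG₃, cX₄.frame fun y _ _ => r₅ y (by omega),
      cG.frame fun y _ _ => r₅' y (by omega) (by omega), hox', hog, px', ?_,
      fun h => ?_, fun h x hx => ?_⟩
    · rw [r₅' _ (by decide) (by decide), h4]
    · rw [r₅' _ (by decide) (by decide), h6]
    · rw [m₅]
      rcases hcase with ⟨rfl, rfl, h⟩ | ⟨rfl, rfl, h⟩
      · exact done₃
      · intro j h1 h2
        rcases (show j ≤ kx by omega).eq_or_lt with rfl | h3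
        · rw [e₃, State.put_mem, if_pos rfl, ev, word_map_eq_pk hs hx.le (ec ▸ h) hall]
        · exact done₃ j h3 h2
    -- The arguments of the new block are still unseen, so their lanes of the accumulator must be
    -- zero.
    · have hnew' : ∀ i, ox' ≤ i → i < ox' + blockSize (2 ^ m) X.length s kx' ox' →
          seenMap G (kg * s' + og) (X.getD (kx' * s + i) 0) = 0 := fun i h1 h2 => by
        have h3 := px' h
        have h4 : kx' * s + i < X.length := by rw [blockSize] at h2; omega
        refine seenMap_of_not_seen (hnseen _ ?_ h4)
        rcases hcase with ⟨rfl, rfl, h⟩ | ⟨rfl, rfl, h⟩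
        · omega
        · rw [add_mul] at *
          omega
      rw [h39₅]
      rcases hcase with ⟨rfl, rfl, hcn⟩ | ⟨rfl, rfl, hcn⟩
      · rw [if_pos (by omega), ev]
        refine pk_congr fun i hi => ?_
        rw [accLane, accLane]
        rw [← ec] at hcn
        by_cases h1 : i < ox
        · rw [if_pos h1, if_pos (by omega)]
        · rw [if_neg h1]
          by_cases h2 : i < ox + c
          · have h3 := hall (i - ox) (by omega)
            rw [show kx' * s + ox + (i - ox) = kx' * s + i by omega] at h3
            rw [if_pos h2, if_pos (by omega), seenMap_of_seen h3]
          · rw [if_neg h2, if_neg (by omega)]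
            split_ifs with h3
            · exact (hnew' i (by omega) h3).symm
            · rfl
      · rw [if_neg (by omega)]
        refine (pk_zero (b := f + 1) (n := s)).symm.trans (pk_congr fun i hi => ?_)
        rw [accLane, if_neg (by omega)]
        split_ifs with h3
        · exact (hnew' i (by omega) h3).symm
        · rfl
    · exact hnew x h hx

end WordRAM

/-! ## The program -/

namespace WordRAM

open WordRAM.Expr in
/-- Places a cursor in registers `i, …, i + 3` at the beginning of a sequence; registers `b`, `l`
and `r` hold its address, its length and the number of fields in a word. -/
def startProg (i b l r : ℕ) : Program :=
  .assign i (reg b) ;; .assign (i + 1) (const 0) ;; .assign (i + 2) (reg l) ;;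
  .ifLt (reg l) (reg r) (.assign (i + 3) (reg l)) (.assign (i + 3) (reg r))

theorem wp_startProg {w len s i b l r : ℕ} {σ : State w}
    (hi : i = 30 ∧ b = 4 ∧ l = 2 ∧ r = 23 ∨ i = 34 ∧ b = 5 ∧ l = 3 ∧ r = 24) (hs : s ≤ w)
    (hlen : len < 2 ^ w) (hl : σ.reg l = BitVec.ofNat w len) (hr : σ.reg r = BitVec.ofNat w s) :
    wp (startProg i b l r) 30 (fun σ' => Frame i σ σ' ∧ Cursor σ' i (σ.reg b) len s 0 0) σ := by
  have e1 := toNat_ofNat_of_le hs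
  have e2 : (BitVec.ofNat w len).toNat = len := by
    rw [BitVec.toNat_ofNat, Nat.mod_eq_of_lt hlen]
  rcases hi with ⟨rfl, rfl, rfl, rfl⟩ | ⟨rfl, rfl, rfl, rfl⟩ <;>
  · refine wp_assign_seq _ rfl ?_
    refine wp_assign_seq (BitVec.ofNat w 0) rfl ?_
    refine wp_assign_seq (BitVec.ofNat w len) (by simp [hl]) ?_
    refine wp_ifLt (T := 10) ?_ ?_ (by decide)
    · intro hc
      simp only [Expr.eval_reg, State.set_reg] at hc
      simp only [Nat.reduceAdd, reduceIte, Nat.reduceEqDiff, hl, hr, e1, e2] at hc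
      refine wp_assign (BitVec.ofNat w len) (by simp [hl]) ⟨?_, ?_⟩
      · repeat refine Frame.set ?_ (by decide)
        exact Frame.refl _ σ
      · constructor <;> simp [min_eq_left hc.le]
    · intro hc
      simp only [Expr.eval_reg, State.set_reg] at hc
      simp only [Nat.reduceAdd, reduceIte, Nat.reduceEqDiff, hl, hr, e1, e2] at hc
      refine wp_assign (BitVec.ofNat w s) (by simp [hr]) ⟨?_, ?_⟩
      · repeat refine Frame.set ?_ (by decide)
        exact Frame.refl _ σ
      · constructor <;> simp [min_eq_right (not_lt.1 hc)]

open WordRAM.Expr in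
/-- Computes `Map(G, X)` for a sorted sequence `X`. -/
def mapProg : Program :=
  setupProg ;; startProg 30 4 2 23 ;; startProg 34 5 3 24 ;; .assign 39 (const 0) ;;
  .whileLt (const 0) (reg 32) roundProg

/-- A bound for the number of rounds of the main loop. -/
def rounds (w f n r u : ℕ) : ℕ :=
  potential n r (w / (f + 1)) 0 0 + potential n u (w / (f + f + 1)) 0 0

theorem wp_mapProg {w f R : ℕ} {G : PackedFunction f} {X : List (BitVec f)} {σ : State w}
    (hf : 1 ≤ f) (hw : f + f + 1 ≤ w) (hr : X.length ≤ 2 ^ f) (hX : X.Pairwise (· ≤ ·))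
    (hdom : ∀ x ∈ X, x ∈ G.dom) (hσ : IsMapInput G X σ)
    (hR : ∀ m, (m = f ∨ w < (f + f + 1) * 2 ^ (m + 1)) →
      rounds w f (2 ^ m) X.length G.dom.length ≤ R) :
    wp mapProg (5000 * (Nat.log 2 (w / (f + 1)) + 1) * (R + 2))
      (fun σ' => Packed.StoredAt σ'.mem (σ.reg 6) (G.map X)) σ := by
  obtain ⟨h0, h1, h2, h3, sX, sG, dX, dG⟩ := hσ
  have hfw : 2 ^ f < 2 ^ w := Nat.pow_lt_pow_right (by omega) (by omega)
  have hrw : X.length < 2 ^ w := hr.trans_lt hfw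
  have huw : G.dom.length < 2 ^ w := (length_le_two_pow G.dom_increasing).trans_lt hfw
  have hs := Nat.div_le_self w (f + 1)
  have hs' := Nat.div_le_self w (f + f + 1)
  have hs0 : 0 < w / (f + 1) := Nat.div_pos (by omega) (by omega)
  have hs0' : 0 < w / (f + f + 1) := Nat.div_pos (by omega) (by omega)
  generalize eL : Nat.log 2 (w / (f + 1)) = L
  -- `B` is the budget of the main loop; setup and initialisation cost at most `1500 * A`.
  obtain ⟨A, hA⟩ : ∃ A, A = L + 1 := ⟨_, rfl⟩
  obtain ⟨B, hB⟩ : ∃ B, B = (R + 1) * (4100 * A) := ⟨_, rfl⟩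
  have hT : 1500 * A + B ≤ 5000 * A * (R + 2) := by
    have e1 : B = 4100 * (A * R) + 4100 * A := by rw [hB]; ring
    have e2 : 5000 * A * (R + 2) = 5000 * (A * R) + 10000 * A := by ring
    omega
  rw [← hA]
  refine wp_mono ?_ hT (fun _ h => h)
  have hsetup := wp_setupProg hf hw h0 h1
  rw [eL] at hsetup
  refine wp_run_seq (500 * A + B) hsetup ?_ (by omega)
  rintro σ₁ ⟨F₁, m, hE₁, hm, hmw⟩
  refine wp_run_seq (400 * A + B)
    (wp_startProg (Or.inl ⟨rfl, rfl, rfl, rfl⟩) hs hrw ((F₁.reg 2 (by decide)).trans h2) hE₁.r23)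
    ?_ (by omega)
  rintro σ₂ ⟨F₂, cX⟩
  have hE₂ := hE₁.frame F₂
  refine wp_run_seq (300 * A + B)
    (wp_startProg (Or.inr ⟨rfl, rfl, rfl, rfl⟩) hs' huw
      ((F₂.reg 3 (by decide)).trans ((F₁.reg 3 (by decide)).trans h3)) hE₂.r24) ?_ (by omega)
  rintro σ₃ ⟨F₃, cG⟩
  have hE₃ := hE₂.frame F₃
  have hF : Frame 7 σ σ₃ := (F₁.trans (F₂.mono (by decide))).trans (F₃.mono (by decide))
  refine wp_assign_seq (BitVec.ofNat w 0) rfl ?_ rfl (by simp; omega)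
  have hseen : ∀ x, ¬ Seen G (0 * (w / (f + f + 1)) + 0) x := by
    rintro x ⟨j, hj, -⟩
    omega
  refine wp_whileLt (T := 4000 * (m + 1)) (k := rounds w f (2 ^ m) X.length G.dom.length)
    (fun k σ' => ∃ kx ox kg og, potential (2 ^ m) X.length (w / (f + 1)) kx ox +
        potential (2 ^ m) G.dom.length (w / (f + f + 1)) kg og = k ∧
      MapInv m G X (σ.reg 4) (σ.reg 5) (σ.reg 6) (w / (f + 1)) (w / (f + f + 1)) kx ox kg og σ')
    ⟨0, 0, 0, 0, rfl, ?_⟩ ?_ ?_ ?_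
  · have hreg : ∀ y < 39, (σ₃.set 39 (BitVec.ofNat w 0)).reg y = σ₃.reg y := fun y hy => by
      rw [State.set_reg, if_neg (by omega)]
    constructor
    case env => exact hE₃.congr fun y hy => hreg y (by omega)
    case reg4 => rw [hreg _ (by decide), hF.reg _ (by decide)]
    case reg6 => rw [hreg _ (by decide), hF.reg _ (by decide)]
    case stored_X => exact hF.mem.symm ▸ sX
    case stored_G => exact hF.mem.symm ▸ sG
    case cursor_X =>
      rw [F₁.reg 4 (by decide)] at cX
      exact (cX.frame fun y _ _ => F₃.reg y (by omega)).frame fun y _ _ => hreg y (by omega)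
    case cursor_G =>
      rw [F₂.reg 5 (by decide), F₁.reg 5 (by decide)] at cG
      exact cG.frame fun y _ _ => hreg y (by omega)
    case off_X => exact hs0
    case off_G => exact hs0'
    case pos_X => exact fun h => h
    case done => exact fun j hj => absurd hj (by omega)
    case acc =>
      intro _
      rw [State.set_reg, if_pos rfl]
      refine (pk_zero (b := f + 1) (n := w / (f + 1))).symm.trans (pk_congr fun i hi => ?_)
      rw [accLane, if_neg (by omega), seenMap_of_not_seen (hseen _), ite_self]
    case seen => exact fun _ x hx => absurd hx (hseen x)
  · rintro k σ' ⟨kx, ox, kg, og, -, hI⟩ hc j hj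
    have h32 : σ'.reg 32 = _ := hI.cursor_X.rem
    simp only [Expr.eval_reg, Expr.eval_const, h32, BitVec.toNat_ofNat, Nat.zero_mod] at hc
    rw [Nat.mod_eq_of_lt (by omega)] at hc
    have hlen : (G.map X).length = X.length := by simp [PackedFunction.map]
    rw [hlen] at hj
    refine hI.done j ?_ hj
    -- The loop stops when no fields remain, so the cursor has passed every word that the output
    -- occupies.
    have h4 := (lt_wordCount (w := w) (f := f) (by omega)).1 hj
    by_contra h5
    have := Nat.mul_le_mul_right (w / (f + 1)) (not_lt.1 h5)
    omega
  · rintro k σ' ⟨kx, ox, kg, og, rfl, hI⟩ hc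
    have h32 : σ'.reg 32 = _ := hI.cursor_X.rem
    simp only [Expr.eval_reg, Expr.eval_const, h32, BitVec.toNat_ofNat, Nat.zero_mod] at hc
    rw [Nat.mod_eq_of_lt (by omega)] at hc
    refine wp_mono (wp_roundProg hX hdom hr rfl rfl dX dG hI (by omega)) le_rfl ?_
    rintro σ'' ⟨kx', ox', kg', og', hlt, hI'⟩
    exact ⟨_, hlt, kx', ox', kg', og', rfl, hI'⟩
  · have h4 : rounds w f (2 ^ m) X.length G.dom.length + 1 ≤ R + 1 := Nat.succ_le_succ (hR m hmw)
    have h5 : 4000 * (m + 1) + 1 + 1 + 1 ≤ 4100 * A := by omega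
    exact (Nat.mul_le_mul h4 h5).trans (by simp only [Expr.cost]; omega)

/-! ### The number of rounds -/

theorem mul_div_le_mul {w a n r : ℕ} (h : w ≤ a * n) : w * (r / n) ≤ a * r :=
  calc w * (r / n) ≤ a * n * (r / n) := Nat.mul_le_mul_right _ h
    _ = a * (n * (r / n)) := mul_assoc _ _ _
    _ ≤ a * r := Nat.mul_le_mul_left _ (Nat.mul_div_le _ _)

theorem le_two_mul_mul_div {w q : ℕ} (hq : 0 < q) (h : q ≤ w) : w ≤ 2 * q * (w / q) := by
  have h1 : 1 ≤ w / q := Nat.div_pos h hq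
  have h2 := Nat.div_add_mod w q
  have h3 := Nat.mod_lt w hq
  have h4 : q * 1 ≤ q * (w / q) := Nat.mul_le_mul_left _ h1
  rw [mul_assoc]
  omega

/-- Both blocks and words hold at least `w / a` fields, unless one block has room for the whole
sequence. Rounding costs one extra unit in each of the two counts. -/
theorem mul_potential_le {w n len s a : ℕ} (hn : w ≤ a * n ∨ len ≤ n)
    (hs : w ≤ a * s) (hs0 : 0 < s) : w * potential n len s 0 0 ≤ 2 * w + 2 * a * len := by
  have h1 : w * (len / n) ≤ w + a * len := by
    rcases hn with h | h
    · exact (mul_div_le_mul h).trans (Nat.le_add_left _ _)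
    · have : len / n ≤ 1 := Nat.div_le_of_le_mul (by omega)
      have := Nat.mul_le_mul_left w this
      omega
  have h2 : w * ((len + s - 1) / s) ≤ w + a * len := by
    have h3 : (len + s - 1) / s ≤ len / s + 1 := by
      rw [← Nat.add_div_right _ hs0]
      exact Nat.div_le_div_right (by omega)
    have h4 := Nat.mul_le_mul_left w h3
    have h5 := mul_div_le_mul (r := len) hs
    rw [mul_add] at h4
    omega
  simp only [potential, zero_mul, add_zero, Nat.sub_zero]
  rw [mul_add, mul_assoc]
  omega

/-- If `m = f`, one block has room for each sequence. Otherwise maximality gives `w < 2 * (2 * f +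
1) * 2 ^ m`. The factor `6 * f` bounds both `2 * (2 * f + 1)` and `2 * (f + 1)`, as `f ≥ 1`; the
factor `2` in the word counts makes up for the floor. -/
theorem mul_rounds_le {w f m r u : ℕ} (hf : 1 ≤ f) (hw : f + f + 1 ≤ w)
    (hm : m = f ∨ w < (f + f + 1) * 2 ^ (m + 1)) (hr : r ≤ 2 ^ f) (hu : u ≤ 2 ^ f) :
    w * rounds w f (2 ^ m) r u ≤ 4 * w + 12 * ((r + u) * f) := by
  have hn : ∀ len, len ≤ 2 ^ f → w ≤ 6 * f * 2 ^ m ∨ len ≤ 2 ^ m := by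
    intro len hlen
    rcases hm with rfl | h
    · exact Or.inr hlen
    · left
      rw [pow_succ] at h
      calc w ≤ (f + f + 1) * (2 ^ m * 2) := h.le
        _ = (2 * (f + f + 1)) * 2 ^ m := by ring
        _ ≤ 6 * f * 2 ^ m := Nat.mul_le_mul_right _ (by omega)
  have h1 := mul_potential_le (hn r hr)
    ((le_two_mul_mul_div (Nat.succ_pos f) (by omega)).trans
      (Nat.mul_le_mul_right (w / (f + 1)) (show 2 * (f + 1) ≤ 6 * f by omega)))
    (Nat.div_pos (by omega) (by omega))
  have h2 := mul_potential_le (hn u hu)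
    ((le_two_mul_mul_div (Nat.succ_pos (f + f)) (by omega)).trans
      (Nat.mul_le_mul_right (w / (f + f + 1)) (show 2 * (f + f + 1) ≤ 6 * f by omega)))
    (Nat.div_pos (by omega) (by omega))
  rw [rounds, mul_add]
  calc _ ≤ _ := Nat.add_le_add h1 h2
    _ = _ := by ring

end WordRAM

theorem mainTheorem4 :
    ∃ (P : WordRAM.Program) (C : ℝ), 0 < C ∧
      ∀ (w f : ℕ) (G : PackedFunction f) (X : List (BitVec f)) (σ : WordRAM.State w),
        1 ≤ f → 2 * f + 1 ≤ w → X.length ≤ 2 ^ f →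
        X.Pairwise (· ≤ ·) → (∀ x ∈ X, x ∈ G.dom) →
        IsMapInput G X σ →
        ∃ (t : ℕ) (σ' : WordRAM.State w),
          WordRAM.Exec P σ t σ' ∧
          Packed.StoredAt σ'.mem (σ.reg 6) (G.map X) ∧
          (t : ℝ) ≤ C * (max (((X.length : ℝ) + G.dom.length) * f / w) 1 * Real.logb 2 w) ∧
          (X.length ≤ Packed.fieldsPerWord w f → G.dom.length ≤ Packed.fieldsPerWord w f →
            (t : ℝ) ≤ C * (Real.logb 2 (Packed.fieldsPerWord w f) + 1)) := by
  -- The running time is at most `5000 * (L + 1) * (R + 2)` with `L = ⌊log₂ s⌋`. The general bound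
  -- uses `L + 1 ≤ 2 * log₂ w` and `R + 2 ≤ 18 * A` for the maximum `A`, which gives `180000`; the
  -- bound for short sequences uses `R + 2 ≤ 30`, which gives `150000`.
  refine ⟨WordRAM.mapProg, 200000, by norm_num, ?_⟩
  intro w f G X σ hf hw hr hX hdom hσ
  have hw' : f + f + 1 ≤ w := by omega
  have hu := WordRAM.length_le_two_pow G.dom_increasing
  have hs0 : 0 < w / (f + 1) := Nat.div_pos (by omega) (by omega)
  obtain ⟨R, hRdef⟩ : ∃ R, R = (4 * w + 12 * ((X.length + G.dom.length) * f)) / w := ⟨_, rfl⟩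
  have hR : ∀ m, (m = f ∨ w < (f + f + 1) * 2 ^ (m + 1)) →
      WordRAM.rounds w f (2 ^ m) X.length G.dom.length ≤ R := fun m hm => by
    rw [hRdef, Nat.le_div_iff_mul_le (by omega), mul_comm]
    exact WordRAM.mul_rounds_le hf hw' hm hr hu
  obtain ⟨t, ht, τ, σ', he, ha, hQ⟩ :=
    WordRAM.wp_mapProg hf hw' hr hX hdom hσ hR σ (WordRAM.Agree.refl σ)
  refine ⟨t, τ, he, ?_, ?_⟩
  · rw [ha.1]
    exact hQ
  have hw0 : (0 : ℝ) < w := by exact_mod_cast (show 0 < w by omega)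
  have hlog : (Nat.log 2 (w / (f + 1)) : ℝ) ≤ Real.logb 2 ((w / (f + 1) : ℕ) : ℝ) :=
    Real.natLog_le_logb _ _
  have hlogw : Real.logb 2 ((w / (f + 1) : ℕ) : ℝ) ≤ Real.logb 2 w :=
    Real.logb_le_logb_of_le (by norm_num) (by exact_mod_cast hs0)
      (by exact_mod_cast Nat.div_le_self _ _)
  have hlog1 : 1 ≤ Real.logb 2 w := by
    rw [Real.le_logb_iff_rpow_le (by norm_num) hw0, Real.rpow_one]
    exact_mod_cast (show 2 ≤ w by omega)
  have hL0 : (0 : ℝ) ≤ Nat.log 2 (w / (f + 1)) := Nat.cast_nonneg _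
  have hRw : (R : ℝ) ≤ 4 + 12 * (((X.length : ℝ) + G.dom.length) * f / w) := by
    have h1 : (R : ℝ) ≤ ((4 * w + 12 * ((X.length + G.dom.length) * f) : ℕ) : ℝ) / (w : ℕ) := by
      rw [hRdef]
      exact Nat.cast_div_le
    refine h1.trans (le_of_eq ?_)
    push_cast
    field_simp
  have ht' : (t : ℝ) ≤ 5000 * ((Nat.log 2 (w / (f + 1)) : ℝ) + 1) * (R + 2) := by
    exact_mod_cast ht
  generalize (Nat.log 2 (w / (f + 1)) : ℝ) = L at *
  refine ⟨?_, fun h1 h2 => ?_⟩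
  · have hA := le_max_left (((X.length : ℝ) + G.dom.length) * f / w) 1
    have hA' := le_max_right (((X.length : ℝ) + G.dom.length) * f / w) 1
    generalize max (((X.length : ℝ) + G.dom.length) * f / w) 1 = A at *
    calc (t : ℝ) ≤ 5000 * (L + 1) * (R + 2) := ht'
      _ ≤ 5000 * (2 * Real.logb 2 w) * (18 * A) := by gcongr <;> linarith
      _ = 180000 * (A * Real.logb 2 w) := by ring
      _ ≤ 200000 * (A * Real.logb 2 w) := by gcongr; norm_num
  · rw [Packed.fieldsPerWord] at *
    have hfw : ((w / (f + 1) : ℕ) : ℝ) * f ≤ w := by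
      have := Nat.div_mul_le_self w (f + 1)
      exact_mod_cast (Nat.mul_le_mul_left _ (Nat.le_succ f)).trans this
    -- Sequences of at most `s` entries satisfy `(r + u) * f ≤ 2 * s * f ≤ 2 * w`, so the number of
    -- rounds is bounded.
    have hA : ((X.length : ℝ) + G.dom.length) * f / w ≤ 2 := by
      rw [div_le_iff₀ hw0]
      have e1 : (X.length : ℝ) ≤ (w / (f + 1) : ℕ) := by exact_mod_cast h1
      have e2 : (G.dom.length : ℝ) ≤ (w / (f + 1) : ℕ) := by exact_mod_cast h2
      calc ((X.length : ℝ) + G.dom.length) * f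
          ≤ (((w / (f + 1) : ℕ) : ℝ) + ((w / (f + 1) : ℕ) : ℝ)) * f := by gcongr
        _ ≤ 2 * w := by linarith
    calc (t : ℝ) ≤ 5000 * (L + 1) * (R + 2) := ht'
      _ ≤ 5000 * (Real.logb 2 ((w / (f + 1) : ℕ) : ℝ) + 1) * 30 := by gcongr <;> linarith
      _ ≤ 200000 * (Real.logb 2 ((w / (f + 1) : ℕ) : ℝ) + 1) := by linarith
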